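/- **Setting.** Let $\mathbb T=\mathbb R/2\pi\mathbb Z$ and, for $\sigma>0$, $\Omega_\sigma=\{z\in\mathbb C:\ |\Im z|<\min\{\sigma\Re z,\sigma\}\}$. Functions $f(x,z)=\sum_{\alpha\in\mathbb Z}f_\alpha(z)e^{i\alpha x}$ on $\mathbb T\times\Omega_\sigma$ are assumed continuous, and holomorphic in $z$. Fix $\beta_0>0$ and $P>1$, and put $\psi(z)=\frac{z}{1+z}$, $\phi_P(z)=\frac1{1+|\Re z|^P}$, $\delta=\sqrt\nu$, $\delta_t=\sqrt{\nu t}$. Define, with values in $[0,\infty]$, $$\|f\|_{\mathcal L^1_{\rho,\sigma}}=\sum_{\alpha}e^{\rho|\alpha|}\sup_{0\le\theta<\sigma}\int_{\partial\Omega_\theta}|f_\alpha(z)|\,|dz|,\qquad |||f|||_{\mathcal W^{k,1}_{\rho,\sigma}}=\sum_{j+\ell\le k}\|\partial_x^j(\psi\partial_z)^\ell f\|_{\mathcal L^1_{\rho,\sigma}},$$ $$\|f\|_{\rho,\sigma,\delta(t)}=\sum_\alpha e^{\rho|\alpha|}\sup_{z\in\Omega_\sigma}|f_\alpha(z)|e^{\beta_0\Re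 z}\Bigl(1+\delta_t^{-1}\phi_P(\delta_t^{-1}z)+\delta^{-1}\phi_P(\delta^{-1}z)\Bigr)^{-1},\qquad |||f|||_{\rho,\sigma,\delta(t),k}=\sum_{j+\ell\le k}\|\partial_x^j(\psi\partial_z)^\ell f\|_{\rho,\sigma,\delta(t)},$$ where $\partial\Omega_0$ is the half-line $[0,\infty)$ run through twice, and for $t=0$ the term $\delta_t^{-1}\phi_P(\delta_t^{-1}z)$ is omitted. **Stokes problem.** Let $\nu>0$. A solution with initial datum $f$ is a function $\omega(t,x,z)$, $t\ge0$, on $\mathbb T\times\Omega_\sigma$ with $\omega(0)=f$, holomorphic in $z$, continuous for $t>0$ on $\mathbb T\times(\Omega_\sigma\cup\{0\})$ (jointly with $t$), with $t\mapsto\omega_\alpha(t)$ continuous from $[0,\infty)$ to $L^1(\mathbb R_+)$ for every $\alpha\in\mathbb Z$, and such that for all $t>0$ and all $\alpha\in\mathbb Z$ $$\partial_t\omega_\alpha=\nu(\partial_z^2-\alpha^2)\omega_\alpha\ \text{ on }\Omega_\sigma,\qquad \nu\,\omega_\alpha(t,0)=-\int_0^\infty e^{-|\alpha|y}\omega_\alpha(t,y)\,dy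 .$$ This is the heat equation $\partial_t\omega=\nu\Delta\omega$ with the critical-slip condition $\nu\omega=u_1$ at $z=0$, where $u=\nabla^\perp\Delta^{-1}\omega$ and $\Delta^{-1}$ is taken with Dirichlet boundary condition. **Proposition 5.1.** (a) Let $\nu,\rho,\sigma>0$. For every $f$ with $\|f\|_{\mathcal L^1_{\rho,\sigma}}<\infty$ the Stokes problem has exactly one solution, denoted $e^{\nu tB}f$, and $\partial_x$ commutes with $e^{\nu tB}$: for all $t\ge0$, $\partial_x(e^{\nu tB}f)$ exists and equals $e^{\nu tB}(\partial_xf)$ on $\mathbb T\times\Omega_\sigma$. (b) For every $k\ge0$, $T>0$, $\nu_0>0$ and $0<\sigma_1<1$ there is a constant $C>0$ (depending only on these and on $\beta_0,P$) such that for all $0<\nu\le\nu_0$, $0<\sigma\le\sigma_1$, $\rho>0$ and all $f$, the following bounds hold (each being void when its right-hand side is infinite): $$|||e^{\nu tB}f|||_{\rho,\sigma,\delta(t),k}\le C\,|||f|||_{\rho,\sigma,\delta(0),k}\qquad(0<t\le T),$$ $$|||e^{\nu(t-s)B}f|||_{\rho,\sigma,\delta(t),k}\le C\Bigl(\sqrt{\tfrac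 t{t-s}}\,|||f|||_{\mathcal W^{k,1}_{\rho,\sigma}}+\sqrt{\tfrac ts}\,|||f|||_{\rho,\sigma,\delta(s),k}\Bigr)\qquad(0<s<t\le T),$$ $$|||e^{\nu tB}f|||_{\mathcal W^{k,1}_{\rho,\sigma}}\le C\,|||f|||_{\mathcal W^{k,1}_{\rho,\sigma}}\qquad(0<t\le T).$$ -/

import Mathlib

open scoped ENNReal Topology

noncomputable section

namespace StokesSlip

/-- The torus `𝕋 = ℝ / 2πℤ`. -/
abbrev Torus : Type := AddCircle (2 * Real.pi)

instance fact_two_pi_pos : Fact (0 < 2 * Real.pi) := ⟨Real.two_pi_pos⟩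

/-- The pencil-like complex domain `Ω_σ = {|Im z| < min (σ Re z, σ)}`. -/
def pencil (σ : ℝ) : Set ℂ := {z | |z.im| < min (σ * z.re) σ}

/-- The Fourier coefficient `f_α(z)` in `f(x,z) = ∑_α f_α(z) e^{iαx}`. -/
def mode (f : Torus → ℂ → ℂ) (α : ℤ) (z : ℂ) : ℂ := fourierCoeff (fun x => f x z) α

/-- The partial derivative `∂_x`. -/
def dx (f : Torus → ℂ → ℂ) : Torus → ℂ → ℂ :=
  fun x z => deriv (fun h : ℝ => f (x + (h : Torus)) z) 0

/-- The conormal derivative `ψ(z) ∂_z` with `ψ(z) = z / (1 + z)`. -/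
def psiDz (f : Torus → ℂ → ℂ) : Torus → ℂ → ℂ :=
  fun x z => z / (1 + z) * deriv (f x) z

/-- Functions on `𝕋 × Ω_σ` that are continuous, and holomorphic in `z ∈ Ω_σ`. Only the values on
`𝕋 × Ω_σ` are relevant. (Analyticity in `x` is then a consequence of the finiteness of any of the
norms below.) -/
structure IsAnalyticField (σ : ℝ) (f : Torus → ℂ → ℂ) : Prop where
  continuousOn : ContinuousOn (fun p : Torus × ℂ => f p.1 p.2) (Set.univ ×ˢ pencil σ)
  holomorphic : ∀ x, DifferentiableOn ℂ (f x) (pencil σ)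

/-! ### Analytic `L¹` norms -/

/-- The upper half of `∂Ω_θ`, parametrized by the real part `r > 0`: `r + i min (θ r, θ)`.
The lower half is its complex conjugate. -/
def contour (θ r : ℝ) : ℂ := ⟨r, min (θ * r) θ⟩

/-- The arc length density `|dz| / dr` on `∂Ω_θ`. -/
def contourSpeed (θ r : ℝ) : ℝ := if r < 1 then Real.sqrt (1 + θ ^ 2) else 1

/-- `∫_{∂Ω_θ} |g(z)| |dz|`. For `θ = 0` the contour is the half-line, run through twice (the two
halves of `∂Ω_θ` coincide in the limit). -/
def contourL1 (θ : ℝ) (g : ℂ → ℂ) : ℝ≥0∞ :=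
  ∫⁻ r in Set.Ioi (0 : ℝ),
    (‖g (contour θ r)‖ₑ + ‖g ((starRingEnd ℂ) (contour θ r))‖ₑ) *
      ENNReal.ofReal (contourSpeed θ r)

/-- `‖g‖_{L¹_σ} = sup_{0 ≤ θ < σ} ∫_{∂Ω_θ} |g(z)| |dz|`. -/
def modeL1 (σ : ℝ) (g : ℂ → ℂ) : ℝ≥0∞ := ⨆ θ ∈ Set.Ico 0 σ, contourL1 θ g

/-- `‖f‖_{𝓛¹_{ρ,σ}} = ∑_α e^{ρ|α|} ‖f_α‖_{L¹_σ}`. -/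
def normL1 (ρ σ : ℝ) (f : Torus → ℂ → ℂ) : ℝ≥0∞ :=
  ∑' α : ℤ, ENNReal.ofReal (Real.exp (ρ * |(α : ℝ)|)) * modeL1 σ (mode f α)

/-- `|||f|||_{𝓦^{k,1}_{ρ,σ}} = ∑_{j+ℓ ≤ k} ‖∂_x^j (ψ ∂_z)^ℓ f‖_{𝓛¹_{ρ,σ}}`. -/
def normW (ρ σ : ℝ) (k : ℕ) (f : Torus → ℂ → ℂ) : ℝ≥0∞ :=
  ∑ j ∈ Finset.range (k + 1), ∑ l ∈ Finset.range (k + 1 - j), normL1 ρ σ (dx^[j] (psiDz^[l] f))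

/-! ### Boundary layer norms -/

/-- The boundary layer profile `φ_P(z) = 1 / (1 + |Re z|^P)`, as a function of `r = Re z`. -/
def profile (P r : ℝ) : ℝ := 1 / (1 + |r| ^ P)

/-- A layer of thickness `d`: `d⁻¹ φ_P (d⁻¹ z)`. -/
def layer (P d r : ℝ) : ℝ := d⁻¹ * profile P (d⁻¹ * r)

/-- The boundary layer weight `1 + δ_t⁻¹ φ_P(δ_t⁻¹ z) + δ⁻¹ φ_P(δ⁻¹ z)`, with `δ_t = √(νt)` and
`δ = √ν`; at time `t = 0` only the layer of thickness `δ` is present. -/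
def blWeight (ν P t r : ℝ) : ℝ :=
  1 + (if t = 0 then 0 else layer P (Real.sqrt (ν * t)) r) + layer P (Real.sqrt ν) r

/-- `‖g‖_{σ,δ(t)} = sup_{z ∈ Ω_σ} |g(z)| e^{β₀ Re z} (blWeight)⁻¹`. -/
def modeBL (ν β₀ P σ t : ℝ) (g : ℂ → ℂ) : ℝ≥0∞ :=
  ⨆ z ∈ pencil σ, ‖g z‖ₑ * ENNReal.ofReal (Real.exp (β₀ * z.re) * (blWeight ν P t z.re)⁻¹)

/-- `‖f‖_{ρ,σ,δ(t)} = ∑_α e^{ρ|α|} ‖f_α‖_{σ,δ(t)}`. -/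
def normBL (ν β₀ P ρ σ t : ℝ) (f : Torus → ℂ → ℂ) : ℝ≥0∞ :=
  ∑' α : ℤ, ENNReal.ofReal (Real.exp (ρ * |(α : ℝ)|)) * modeBL ν β₀ P σ t (mode f α)

/-- `|||f|||_{ρ,σ,δ(t),k} = ∑_{j+ℓ ≤ k} ‖∂_x^j (ψ ∂_z)^ℓ f‖_{ρ,σ,δ(t)}`. -/
def normBLk (ν β₀ P ρ σ t : ℝ) (k : ℕ) (f : Torus → ℂ → ℂ) : ℝ≥0∞ :=
  ∑ j ∈ Finset.range (k + 1), ∑ l ∈ Finset.range (k + 1 - j),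
    normBL ν β₀ P ρ σ t (dx^[j] (psiDz^[l] f))

/-! ### The linear Stokes problem -/

/-- The `α`-th Fourier coefficient of the tangential velocity `u₁` on the wall `z = 0`, where
`u = ∇^⊥ Δ⁻¹ ω` with the Dirichlet Laplacian on `𝕋 × ℝ₊`. -/
def wallVelocity (ω : Torus → ℂ → ℂ) (α : ℤ) : ℂ :=
  -∫ y in Set.Ioi (0 : ℝ), (Real.exp (-|(α : ℝ)| * y) : ℂ) * mode ω α (y : ℂ)

/-- `ω` solves the linear Stokes problem in vorticity form on `𝕋 × Ω_σ` with initial datum `f`: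
the heat equation `∂_t ω = ν Δ ω`, written for the Fourier coefficients in `x`, and the critical
slip condition `ν ω = u₁` on the wall `z = 0`. The solution is continuous up to the wall for `t > 0`
and its Fourier coefficients are continuous in time with values in `L¹(ℝ₊)` for `t ≥ 0`. -/
structure IsStokesSolution (ν σ : ℝ) (f : Torus → ℂ → ℂ) (ω : ℝ → Torus → ℂ → ℂ) : Prop where
  initial : ∀ x, ∀ z ∈ pencil σ, ω 0 x z = f x z
  continuousOn : ContinuousOn (fun p : ℝ × Torus × ℂ => ω p.1 p.2.1 p.2.2)
    (Set.Ioi 0 ×ˢ Set.univ ×ˢ insert 0 (pencil σ))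
  holomorphic : ∀ t, 0 < t → ∀ x, DifferentiableOn ℂ (ω t x) (pencil σ)
  heat : ∀ t, 0 < t → ∀ α : ℤ, ∀ z ∈ pencil σ,
    HasDerivAt (fun τ : ℝ => mode (ω τ) α z)
      ((ν : ℂ) * (deriv (deriv (mode (ω t) α)) z - (α : ℂ) ^ 2 * mode (ω t) α z)) t
  slip : ∀ t, 0 < t → ∀ α : ℤ, (ν : ℂ) * mode (ω t) α 0 = wallVelocity (ω t) α
  integrable : ∀ t, 0 ≤ t → ∀ α : ℤ,
    MeasureTheory.IntegrableOn (fun y : ℝ => mode (ω t) α (y : ℂ)) (Set.Ioi 0)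
  continuousL1 : ∀ t, 0 ≤ t → ∀ α : ℤ,
    Filter.Tendsto
      (fun τ : ℝ => ∫⁻ y in Set.Ioi (0 : ℝ), ‖mode (ω τ) α (y : ℂ) - mode (ω t) α (y : ℂ)‖ₑ)
      (𝓝[Set.Ici 0] t) (𝓝 0)

open Classical in
/-- The Stokes semigroup `e^{νtB}`: the solution operator of the linear Stokes problem. -/
def stokesSemigroup (ν σ t : ℝ) (f : Torus → ℂ → ℂ) : Torus → ℂ → ℂ :=
  if h : ∃ ω, IsStokesSolution ν σ f ω then h.choose t else 0

end StokesSlip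

end

open scoped ENNReal
open StokesSlip

/-!
On a Fourier mode `α`, with `a = |α|`, the Stokes problem is the heat equation on the half-line with
damping `ν a²` and the nonlocal boundary condition `ν w(0) = -∫ e^{-ay} w(y) dy`. It is solved by
reflection. A datum `u` on the half-line has an extension `F = extDatum ν a u` to the whole
line for which `ν F(x) + ∫ e^{-ay} F(x + y) dy` is odd in `x` (`slip_combination_odd`); the heat flow
preserves oddness, so the heat evolution of `F` satisfies the boundary condition at all later times
(`slip_gconv`). The reflected part of `F` combines `u` with convolutions of `u` with exponentials,
of total mass bounded independently of `ν` and `a`, so that `F` is controlled in `L¹` by `u`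
(`lintegral_enorm_reflDatum_le`). Summing the modes gives a solution, since the modes of `f` decay
exponentially (`HasDecayingData.isStokesSolution`).

For uniqueness, let `w` be a mode of the difference of two solutions. The weighted primitive
`tail a w = ∫_x^∞ e^{-a(y-x)} w(y) dy` solves the damped heat equation, and the slip condition turns
into the local Robin condition `∂ₓ (tail a w) = (a + 1/ν) tail a w` at the wall, with the sign for
which the maximum principle holds (`IsHalfLineSolution.re_mul_tail_nonpos`). Hence `tail a w = 0`,
and `w = 0`.

For the bounds, a mode of the solution is split into the integral over the half-line of the heat
kernel against the datum (`halfConv`), and the contribution of the reflected datum (`reflConv`).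
* The derivative `ψ ∂_z` maps each of the two families, with arbitrary polynomials as prefactors of
  the Gaussian, into itself: for `halfConv` one integrates by parts and uses
  `ψ(z) - ψ(y) = (z - y) / ((1 + z) (1 + y))` (`pd_halfConv`). So bounds without derivatives, for all
  prefactors, imply the bounds with derivatives (`exists_conSum_modeSol_le`), while `∂ₓ` multiplies
  the modes by `i α` (`NiceField.fieldNorm_eq`).
* The integral over the half-line is shifted by Cauchy's theorem to the curve `gam θ` through `z`
  (`integral_Ioi_eq_integral_gam`). Along this curve the differences `z - w` stay in a double sector
  of aperture `θ < 1`, where the kernels decay like Gaussians (`exists_norm_gker_le_genv`). The `L¹`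
  bound follows by Tonelli's theorem.
* For the boundary layer norms, the points closer to the wall than half the distance of `z` see only
  the Gaussian tail, which is dominated by the weight at time `t`; at the other points the weight is
  comparable to the one at `z` (`exists_modeBL_halfConv_le`). The factors `√(t / (t - s))` and
  `√(t / s)` are ratios of layer widths.
-/

open scoped ENNReal
open StokesSlip
open MeasureTheory Set Filter Topology Polynomial

/-! ### Geometry of the pencil-like domain -/

theorem mem_pencil_iff {σ : ℝ} {z : ℂ} : z ∈ pencil σ ↔ |z.im| < σ * z.re ∧ |z.im| < σ := by
  simp [pencil]

theorem re_pos_of_mem_pencil {σ : ℝ} {z : ℂ} (hz : z ∈ pencil σ) : 0 < z.re := by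
  rw [mem_pencil_iff] at hz
  have h1 : 0 < σ := (abs_nonneg _).trans_lt hz.2
  have h2 : 0 < σ * z.re := (abs_nonneg _).trans_lt hz.1
  exact (pos_iff_pos_of_mul_pos h2).1 h1

theorem isOpen_pencil (σ : ℝ) : IsOpen (pencil σ) := by
  unfold pencil
  exact isOpen_lt (by fun_prop) (by fun_prop)

theorem convex_pencil (σ : ℝ) : Convex ℝ (pencil σ) := by
  intro z hz w hw a b ha hb hab
  rw [mem_pencil_iff] at hz hw ⊢
  have key : |(a • z + b • w).im| ≤ a * |z.im| + b * |w.im| := by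
    simp only [Complex.add_im, Complex.real_smul, Complex.mul_im, Complex.ofReal_re,
      Complex.ofReal_im, zero_mul, add_zero]
    calc |a * z.im + b * w.im| ≤ |a * z.im| + |b * w.im| := abs_add_le _ _
      _ = _ := by rw [abs_mul, abs_mul, abs_of_nonneg ha, abs_of_nonneg hb]
  have hre : (a • z + b • w).re = a * z.re + b * w.re := by simp
  have strict : ∀ x y x' y' : ℝ, x < x' → y < y' → a * x + b * y < a * x' + b * y' := by
    intro x y x' y' hx hy
    rcases ha.eq_or_lt with h | h
    · subst h
      have : b = 1 := by linarith
      subst this; linarith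
    · have := mul_lt_mul_of_pos_left hx h
      have := mul_le_mul_of_nonneg_left hy.le hb
      linarith
  constructor
  · rw [hre]
    have := strict _ _ _ _ hz.1 hw.1
    linarith
  · have := strict _ _ _ _ hz.2 hw.2
    have h3 : a * σ + b * σ = σ := by rw [← add_mul, hab, one_mul]
    linarith

theorem ofReal_mem_pencil {σ y : ℝ} (hσ : 0 < σ) (hy : 0 < y) : (y : ℂ) ∈ pencil σ := by
  simp [mem_pencil_iff, hσ, mul_pos hσ hy]

theorem one_add_ne_zero_of_re_pos {z : ℂ} (hz : 0 < z.re) : 1 + z ≠ 0 := by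
  intro h
  have := congrArg Complex.re h
  simp at this
  linarith

theorem norm_one_add_inv_le_one {z : ℂ} (hz : 0 < z.re) : ‖(1 + z)⁻¹‖ ≤ 1 := by
  rw [norm_inv]
  apply inv_le_one_of_one_le₀
  calc (1 : ℝ) ≤ |(1 + z).re| := by
        rw [abs_of_pos (by simp; linarith)]; simp; linarith
    _ ≤ _ := Complex.abs_re_le_norm _

/-- The curve with real part `r` along which `Im z = θ min (r, 1)`; for `0 ≤ θ` this is `contour θ`,
and `gam (-θ)` is its complex conjugate. -/
noncomputable def gam (θ r : ℝ) : ℂ := ⟨r, θ * min r 1⟩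

@[simp] theorem gam_re (θ r : ℝ) : (gam θ r).re = r := rfl
@[simp] theorem gam_im (θ r : ℝ) : (gam θ r).im = θ * min r 1 := rfl

theorem gam_eq (θ r : ℝ) : gam θ r = r + (θ * min r 1 : ℝ) * Complex.I := by
  apply Complex.ext <;> simp

theorem gam_zero (r : ℝ) : gam 0 r = r := by apply Complex.ext <;> simp

theorem contour_eq_gam {θ : ℝ} (hθ : 0 ≤ θ) (r : ℝ) : contour θ r = gam θ r := by
  apply Complex.ext
  · rfl
  · simp only [contour, gam]
    rw [mul_min_of_nonneg _ _ hθ, mul_one]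

theorem conj_contour_eq_gam {θ : ℝ} (hθ : 0 ≤ θ) (r : ℝ) :
    (starRingEnd ℂ) (contour θ r) = gam (-θ) r := by
  rw [contour_eq_gam hθ]
  apply Complex.ext <;> simp

theorem gam_mem_pencil {σ θ r : ℝ} (hθ : |θ| < σ) (hr : 0 < r) : gam θ r ∈ pencil σ := by
  rw [mem_pencil_iff]
  have hm : 0 < min r 1 := lt_min hr one_pos
  have h1 : |(gam θ r).im| = |θ| * min r 1 := by rw [gam_im, abs_mul, abs_of_pos hm]
  rw [h1, gam_re]
  constructor
  · calc |θ| * min r 1 ≤ |θ| * r := by gcongr; exact min_le_left _ _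
      _ < σ * r := by gcongr
  · calc |θ| * min r 1 ≤ |θ| * 1 := by gcongr; exact min_le_right _ _
      _ < σ := by linarith

/-- The curves `gam θ`, `|θ| < σ`, cover the pencil. -/
theorem exists_eq_gam {σ : ℝ} {z : ℂ} (hz : z ∈ pencil σ) :
    ∃ θ, |θ| < σ ∧ z = gam θ z.re := by
  have hre := re_pos_of_mem_pencil hz
  have hm : 0 < min z.re 1 := lt_min hre one_pos
  refine ⟨z.im / min z.re 1, ?_, ?_⟩
  · rw [abs_div, abs_of_pos hm, div_lt_iff₀ hm]
    rw [mem_pencil_iff] at hz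
    rcases le_total z.re 1 with h | h
    · rw [min_eq_left h]; exact hz.1
    · rw [min_eq_right h]; linarith [hz.2]
  · apply Complex.ext
    · rfl
    · simp [div_mul_cancel₀ _ hm.ne']

theorem continuous_gam : Continuous fun p : ℝ × ℝ => gam p.1 p.2 := by
  simp only [gam_eq]
  fun_prop

theorem abs_min_sub_min_le (r r' : ℝ) : |min r 1 - min r' 1| ≤ |r - r'| := by
  have := abs_min_sub_min_le_max r 1 r' 1
  simpa using this

/-- Differences of points on one curve stay in the double sector of aperture `θ`. -/
theorem abs_im_gam_sub_gam_le (θ r r' : ℝ) :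
    |(gam θ r - gam θ r').im| ≤ |θ| * |(gam θ r - gam θ r').re| := by
  simp only [Complex.sub_im, Complex.sub_re, gam_im, gam_re, ← mul_sub, abs_mul]
  exact mul_le_mul_of_nonneg_left (abs_min_sub_min_le r r') (abs_nonneg θ)

/-! ### Gaussian kernels with polynomial prefactors -/

theorem exists_norm_eval_le_exp (q : ℂ[X]) {ε : ℝ} (hε : 0 < ε) :
    ∃ C : ℝ, 0 < C ∧ ∀ w : ℂ, ‖q.eval w‖ ≤ C * Real.exp (ε * ‖w‖ ^ 2) := by
  induction q using Polynomial.induction_on' with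
  | add p q hp hq =>
    obtain ⟨C, hC, h⟩ := hp
    obtain ⟨D, hD, h'⟩ := hq
    refine ⟨C + D, by positivity, fun w => ?_⟩
    rw [eval_add, add_mul]
    exact (norm_add_le _ _).trans (add_le_add (h w) (h' w))
  | monomial n a =>
    refine ⟨‖a‖ * (1 + n.factorial / ε ^ n) + 1, by positivity, fun w => ?_⟩
    rw [eval_monomial, norm_mul, norm_pow]
    have h1 : ‖w‖ ^ n ≤ 1 + (‖w‖ ^ 2) ^ n := by
      rcases le_total ‖w‖ 1 with h | h
      · have := pow_le_one₀ (n := n) (norm_nonneg w) h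
        have : 0 ≤ (‖w‖ ^ 2) ^ n := by positivity
        linarith
      · have : ‖w‖ ^ n ≤ (‖w‖ ^ 2) ^ n :=
          pow_le_pow_left₀ (norm_nonneg _) (by nlinarith) n
        linarith
    have h2 : (ε * ‖w‖ ^ 2) ^ n / n.factorial ≤ Real.exp (ε * ‖w‖ ^ 2) :=
      Real.pow_div_factorial_le_exp _ (by positivity) n
    have h3 : (‖w‖ ^ 2) ^ n ≤ n.factorial / ε ^ n * Real.exp (ε * ‖w‖ ^ 2) := by
      rw [div_le_iff₀ (by positivity), mul_pow] at h2
      rw [div_mul_eq_mul_div, le_div_iff₀ (by positivity)]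
      linarith
    have h4 : 1 ≤ Real.exp (ε * ‖w‖ ^ 2) := Real.one_le_exp (by positivity)
    calc ‖a‖ * ‖w‖ ^ n ≤ ‖a‖ * (Real.exp (ε * ‖w‖ ^ 2) +
          n.factorial / ε ^ n * Real.exp (ε * ‖w‖ ^ 2)) := by gcongr; linarith
      _ ≤ _ := by nlinarith

/-- The kernel `s⁻¹ q(x/s) exp (-(x/s)²/4)` with polynomial prefactor `q`, at length scale `s`. This
family contains the heat kernel (`s² = νt`) and is closed under `∂ₓ` and `x ∂ₓ`. -/
noncomputable def gker (q : ℂ[X]) (s : ℝ) (x : ℂ) : ℂ :=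
  (s : ℂ)⁻¹ * q.eval (x / s) * Complex.exp (-(x / s) ^ 2 / 4)

/-- The prefactor of `s ∂ₓ` applied to the kernel with prefactor `q`. -/
noncomputable def dq (q : ℂ[X]) : ℂ[X] := derivative q - C (1 / 2) * X * q

theorem hasDerivAt_gker (q : ℂ[X]) (s : ℝ) (x : ℂ) :
    HasDerivAt (gker q s) ((s : ℂ)⁻¹ * gker (dq q) s x) x := by
  have h0 : HasDerivAt (fun x : ℂ => x / s) (1 / s) x := (hasDerivAt_id x).div_const _
  have h1 : HasDerivAt (fun x : ℂ => q.eval (x / s)) ((derivative q).eval (x / s) * (1 / s)) x := by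
    have := (q.hasDerivAt (x / s)).comp x h0
    exact this
  have h2 : HasDerivAt (fun x : ℂ => Complex.exp (-(x / s) ^ 2 / 4))
      (Complex.exp (-(x / s) ^ 2 / 4) * (-(2 * (x / s) * (1 / s)) / 4)) x := by
    refine (((h0.fun_pow 2).fun_neg).div_const 4).cexp.congr_deriv ?_
    simp
  have := (h1.const_mul (s : ℂ)⁻¹).mul h2
  refine this.congr_deriv ?_
  simp only [gker, dq, eval_sub, eval_mul, eval_C, eval_X]
  ring

theorem differentiable_gker (q : ℂ[X]) (s : ℝ) : Differentiable ℂ (gker q s) :=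
  fun x => (hasDerivAt_gker q s x).differentiableAt

theorem continuousOn_gker (q : ℂ[X]) :
    ContinuousOn (fun p : ℝ × ℂ => gker q p.1 p.2) {p | p.1 ≠ 0} := by
  unfold gker
  have : ContinuousOn (fun p : ℝ × ℂ => (p.1 : ℂ)) {p | p.1 ≠ 0} := by fun_prop
  have h2 : ContinuousOn (fun p : ℝ × ℂ => p.2 / (p.1 : ℂ)) {p | p.1 ≠ 0} :=
    continuousOn_snd.div this fun p hp => by simpa using hp
  refine ((this.inv₀ fun p hp => by simpa using hp).mul
    (q.continuous.comp_continuousOn h2)).mul ?_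
  exact Complex.continuous_exp.comp_continuousOn ((h2.pow 2).neg.div_const 4)

theorem gker_C_mul (c : ℂ) (q : ℂ[X]) (s : ℝ) (x : ℂ) :
    gker (C c * q) s x = c * gker q s x := by
  simp only [gker, eval_mul, eval_C]; ring

theorem gker_X_mul (q : ℂ[X]) (s : ℝ) (x : ℂ) :
    gker (X * q) s x = x / s * gker q s x := by
  simp only [gker, eval_mul, eval_X]; ring

/-- The derivative of a kernel in its scale belongs to the same family of kernels. -/
theorem hasDerivAt_gker_scale (q : ℂ[X]) {s : ℝ} (hs : s ≠ 0) (x : ℂ) :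
    HasDerivAt (fun s : ℝ => gker q s x) (-(s : ℂ)⁻¹ * gker (q + X * dq q) s x) s := by
  have hs' : (s : ℂ) ≠ 0 := by exact_mod_cast hs
  have hc : HasDerivAt (fun s : ℂ => s⁻¹ * q.eval (x / s) * Complex.exp (-(x / s) ^ 2 / 4))
      (-(s : ℂ)⁻¹ * gker (q + X * dq q) s x) (s : ℂ) := by
    have h0 : HasDerivAt (fun s : ℂ => x / s) (-x / s ^ 2) (s : ℂ) := by
      simp only [div_eq_mul_inv x]
      refine ((hasDerivAt_inv hs').const_mul x).congr_deriv ?_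
      ring
    have h1 : HasDerivAt (fun s : ℂ => q.eval (x / s))
        ((derivative q).eval (x / s) * (-x / s ^ 2)) (s : ℂ) := by
      have := (q.hasDerivAt (x / s)).comp (s : ℂ) h0
      exact this
    have h2 := ((h0.fun_pow 2).fun_neg.div_const 4).cexp
    have h3 := ((hasDerivAt_inv hs').fun_mul h1).fun_mul h2
    refine h3.congr_deriv ?_
    simp only [gker, dq, eval_add, eval_sub, eval_mul, eval_C, eval_X,
      pow_one, show 2 - 1 = 1 from rfl]
    generalize eval (x / (s : ℂ)) q = A, eval (x / (s : ℂ)) (derivative q) = B,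
      Complex.exp (-(x / (s : ℂ)) ^ 2 / 4) = E
    field_simp
    push_cast
    ring
  exact hc.comp_ofReal

/-- The Gaussian envelope `s⁻¹ exp (-c (r/s)²)`. -/
noncomputable def genv (c s r : ℝ) : ℝ := s⁻¹ * Real.exp (-c * (r / s) ^ 2)

theorem genv_nonneg (c : ℝ) {s : ℝ} (hs : 0 < s) (r : ℝ) : 0 ≤ genv c s r := by
  unfold genv; positivity

theorem continuous_genv (c s : ℝ) : Continuous (genv c s) := by
  unfold genv; fun_prop

theorem exists_norm_gker_le (q : ℂ[X]) {ε : ℝ} (hε : 0 < ε) :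
    ∃ C : ℝ, 0 < C ∧ ∀ s : ℝ, 0 < s → ∀ x : ℂ, ‖gker q s x‖ ≤
      C * (s⁻¹ * Real.exp (-(1 / 4 - ε) * (x.re / s) ^ 2 + (1 / 4 + ε) * (x.im / s) ^ 2)) := by
  obtain ⟨C, hC, h⟩ := exists_norm_eval_le_exp q hε
  refine ⟨C, hC, fun s hs x => ?_⟩
  have hre : (x / s).re = x.re / s := Complex.div_ofReal_re x s
  have him : (x / s).im = x.im / s := Complex.div_ofReal_im x s
  have h1 : ‖x / s‖ ^ 2 = (x.re / s) ^ 2 + (x.im / s) ^ 2 := by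
    rw [Complex.sq_norm, Complex.normSq_apply, hre, him]; ring
  have h2 : (-(x / s) ^ 2 / 4).re = -(x.re / s) ^ 2 / 4 + (x.im / s) ^ 2 / 4 := by
    have : (-(x / s) ^ 2 / 4) = ((x / s) * (x / s)) * ((-1 / 4 : ℝ) : ℂ) := by push_cast; ring
    rw [this, Complex.re_mul_ofReal, Complex.mul_re, hre, him]; ring
  unfold gker
  rw [norm_mul, norm_mul, norm_inv, Complex.norm_real, Real.norm_of_nonneg hs.le,
    Complex.norm_exp, h2]
  calc s⁻¹ * ‖eval (x / s) q‖ * Real.exp (-(x.re / s) ^ 2 / 4 + (x.im / s) ^ 2 / 4)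
      ≤ s⁻¹ * (C * Real.exp (ε * ‖x / s‖ ^ 2)) *
        Real.exp (-(x.re / s) ^ 2 / 4 + (x.im / s) ^ 2 / 4) := by
        gcongr; exact h _
    _ = C * (s⁻¹ * (Real.exp (ε * ‖x / s‖ ^ 2) *
        Real.exp (-(x.re / s) ^ 2 / 4 + (x.im / s) ^ 2 / 4))) := by ring
    _ = _ := by rw [← Real.exp_add, h1]; congr 3; ring

/-- In a double sector of aperture less than `π/4` the kernels decay like a Gaussian. -/
theorem exists_norm_gker_le_genv (q : ℂ[X]) {σ₁ : ℝ} (h0 : 0 ≤ σ₁) (h1 : σ₁ < 1) :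
    ∃ C : ℝ, 0 < C ∧ ∀ s : ℝ, 0 < s → ∀ x : ℂ, |x.im| ≤ σ₁ * |x.re| →
      ‖gker q s x‖ ≤ C * genv ((1 - σ₁ ^ 2) / 8) s x.re := by
  have hσ : 0 < 1 - σ₁ ^ 2 := by nlinarith
  obtain ⟨C, hC, h⟩ := exists_norm_gker_le q (ε := (1 - σ₁ ^ 2) / 16) (by positivity)
  refine ⟨C, hC, fun s hs x hx => (h s hs x).trans ?_⟩
  unfold genv
  gcongr C * (s⁻¹ * Real.exp ?_)
  have h2 : (x.im / s) ^ 2 ≤ σ₁ ^ 2 * (x.re / s) ^ 2 := by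
    rw [div_pow, div_pow, ← mul_div_assoc]
    gcongr
    rw [← sq_abs, ← sq_abs x.re, ← mul_pow]
    gcongr
  have h3 : 0 ≤ (1 - σ₁ ^ 2) * (1 - σ₁ ^ 2) * (x.re / s) ^ 2 := by positivity
  have h4 := mul_le_mul_of_nonneg_left h2 (show 0 ≤ 1 / 4 + (1 - σ₁ ^ 2) / 16 by positivity)
  nlinarith

/-- In a horizontal strip the kernels at a fixed scale decay like a Gaussian. -/
theorem exists_norm_gker_le_genv_strip (q : ℂ[X]) :
    ∃ C : ℝ, 0 < C ∧ ∀ s : ℝ, 0 < s → ∀ x : ℂ,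
      ‖gker q s x‖ ≤ C * Real.exp ((x.im / s) ^ 2) * genv (1 / 8) s x.re := by
  obtain ⟨C, hC, h⟩ := exists_norm_gker_le q (ε := 1 / 8) (by norm_num)
  refine ⟨C, hC, fun s hs x => (h s hs x).trans ?_⟩
  unfold genv
  rw [Real.exp_add]
  have : Real.exp ((1 / 4 + 1 / 8) * (x.im / s) ^ 2) ≤ Real.exp ((x.im / s) ^ 2) := by
    gcongr; nlinarith [sq_nonneg (x.im / s)]
  have h3 : Real.exp (-(1 / 4 - 1 / 8) * (x.re / s) ^ 2) =
    Real.exp (-(1 / 8) * (x.re / s) ^ 2) := by congr 1; ring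
  rw [h3]
  calc C * (s⁻¹ * (Real.exp (-(1 / 8) * (x.re / s) ^ 2) *
        Real.exp ((1 / 4 + 1 / 8) * (x.im / s) ^ 2)))
      ≤ C * (s⁻¹ * (Real.exp (-(1 / 8) * (x.re / s) ^ 2) * Real.exp ((x.im / s) ^ 2))) := by
        gcongr
    _ = _ := by ring

theorem genv_le (c : ℝ) (hc : 0 ≤ c) {s : ℝ} (hs : 0 < s) (r : ℝ) : genv c s r ≤ s⁻¹ := by
  unfold genv
  have : Real.exp (-c * (r / s) ^ 2) ≤ 1 := by
    rw [Real.exp_le_one_iff]; nlinarith [mul_nonneg hc (sq_nonneg (r / s))]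
  calc _ ≤ s⁻¹ * 1 := by gcongr
    _ = _ := mul_one _

theorem integrable_genv {c s : ℝ} (hc : 0 < c) (hs : 0 < s) : Integrable (genv c s) := by
  unfold genv
  exact ((integrable_exp_neg_mul_sq hc).comp_div hs.ne').const_mul _

theorem integral_genv {c s : ℝ} (hs : 0 < s) : ∫ r, genv c s r = Real.sqrt (Real.pi / c) := by
  unfold genv
  rw [integral_const_mul, Measure.integral_comp_div (fun y => Real.exp (-c * y ^ 2)) s,
    integral_gaussian, abs_of_pos hs, smul_eq_mul]
  field_simp

/-! ### Parametric holomorphic functions and Fourier modes -/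

theorem tendstoLocallyUniformlyOn_of_continuousOn_prod {P : Type*} [TopologicalSpace P]
    {S : Set P} {U : Set ℂ} {f : P → ℂ → ℂ}
    (hf : ContinuousOn (fun p : P × ℂ => f p.1 p.2) (S ×ˢ U)) {p₀ : P} (hp : p₀ ∈ S) :
    TendstoLocallyUniformlyOn f (f p₀) (𝓝[S] p₀) U := by
  rw [Metric.tendstoLocallyUniformlyOn_iff]
  intro ε hε z hz
  have h1 := Metric.tendsto_nhds.1 (hf (p₀, z) ⟨hp, hz⟩) (ε / 2) (half_pos hε)
  rw [nhdsWithin_prod_eq, eventually_prod_iff] at h1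
  obtain ⟨a, ha, b, hb, hab⟩ := h1
  refine ⟨{y | b y}, hb, ?_⟩
  filter_upwards [ha] with p hpa y hy
  have h2 := hab hpa hy
  have h3 := hab (ha.self_of_nhdsWithin hp) hy
  simp only at h2 h3
  calc dist (f p₀ y) (f p y) ≤ dist (f p₀ y) (f p₀ z) + dist (f p y) (f p₀ z) :=
        dist_triangle_right _ _ _
    _ < ε := by linarith

/-- The complex derivative of a jointly continuous family of holomorphic functions is jointly
continuous. -/
theorem continuousOn_deriv_of_continuousOn_prod {P : Type*} [TopologicalSpace P]
    {S : Set P} {U : Set ℂ} (hU : IsOpen U) {f : P → ℂ → ℂ}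
    (hf : ContinuousOn (fun p : P × ℂ => f p.1 p.2) (S ×ˢ U))
    (hd : ∀ p ∈ S, DifferentiableOn ℂ (f p) U) :
    ContinuousOn (fun p : P × ℂ => deriv (f p.1) p.2) (S ×ˢ U) := by
  rintro ⟨p₀, z₀⟩ ⟨hp, hz⟩
  simp only at hp hz
  have h1 : TendstoLocallyUniformlyOn (fun n : P × ℂ => f n.1) (f p₀)
      (𝓝[S ×ˢ U] (p₀, z₀)) U := by
    intro u hu x hx
    obtain ⟨t, ht, h⟩ := tendstoLocallyUniformlyOn_of_continuousOn_prod hf hp u hu x hx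
    refine ⟨t, ht, ?_⟩
    have : Tendsto Prod.fst (𝓝[S ×ˢ U] (p₀, z₀)) (𝓝[S] p₀) := by
      rw [nhdsWithin_prod_eq]; exact tendsto_fst
    exact this.eventually h
  have h2 := h1.deriv (by filter_upwards [self_mem_nhdsWithin] with n hn using hd _ hn.1) hU
  have h3 : ContinuousWithinAt (deriv (f p₀)) U z₀ :=
    ((hd p₀ hp).deriv hU).continuousOn z₀ hz
  refine h2.tendsto_comp h3 hz ?_
  rw [nhdsWithin_prod_eq]; exact tendsto_snd

/-- The Fourier coefficient as a continuous functional on `C(𝕋)`. -/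
noncomputable def fcL (α : ℤ) : C(Torus, ℂ) →L[ℂ] ℂ :=
  LinearMap.mkContinuous
    { toFun := fun g => fourierCoeff g α
      map_add' := fun g h => by
        have hi : ∀ g : C(Torus, ℂ), Integrable (fun t : Torus => fourier (-α) t • g t)
            AddCircle.haarAddCircle := fun g =>
          ((map_continuous (fourier (-α))).smul (map_continuous g)).integrable_of_hasCompactSupport
            (HasCompactSupport.of_compactSpace _)
        simp only [fourierCoeff, ContinuousMap.add_apply, smul_add]
        exact integral_add (hi g) (hi h)
      map_smul' := fun c g => by
        simp only [fourierCoeff, ContinuousMap.smul_apply, RingHom.id_apply]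
        rw [← integral_smul]
        congr 1; ext t; simp only [smul_eq_mul]; ring } 1
    (fun g => by
      simp only [LinearMap.coe_mk, AddHom.coe_mk, one_mul, fourierCoeff]
      have := norm_integral_le_of_norm_le_const (μ := (AddCircle.haarAddCircle : Measure Torus))
        (f := fun t : Torus => fourier (-α) t • g t) (C := ‖g‖) (Eventually.of_forall fun t => by
          rw [norm_smul]
          calc _ = 1 * ‖g t‖ := by rw [fourier_apply, Circle.norm_coe]
            _ ≤ ‖g‖ := by rw [one_mul]; exact g.norm_coe_le_norm t)
      simpa using this)

@[simp] theorem fcL_apply (α : ℤ) (g : C(Torus, ℂ)) : fcL α g = fourierCoeff g α := rfl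

theorem continuousOn_fourierCoeff {X : Type*} [TopologicalSpace X] {S : Set X}
    {F : X → Torus → ℂ} (hF : ContinuousOn (fun p : X × Torus => F p.1 p.2) (S ×ˢ univ)) (α : ℤ) :
    ContinuousOn (fun x => fourierCoeff (F x) α) S := by
  rw [continuousOn_iff_continuous_domRestrict]
  let g : C(S × Torus, ℂ) := ⟨fun p => F p.1 p.2, by
    rw [continuousOn_iff_continuous_domRestrict] at hF
    exact hF.comp (f := fun p : S × Torus => ⟨(p.1.1, p.2), p.1.2, trivial⟩) (by fun_prop)⟩
  exact (fcL α).continuous.comp g.curry.continuous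

theorem continuous_section {σ : ℝ} {f : Torus → ℂ → ℂ} (hf : ContinuousOn
    (fun p : Torus × ℂ => f p.1 p.2) (univ ×ˢ pencil σ)) {z : ℂ} (hz : z ∈ pencil σ) :
    Continuous fun x => f x z :=
  hf.comp_continuous (f := fun x : Torus => (x, z)) (by fun_prop) fun _ => ⟨trivial, hz⟩

namespace StokesSlip.IsAnalyticField

variable {σ : ℝ} {f : Torus → ℂ → ℂ}

theorem continuousOn_deriv (hf : IsAnalyticField σ f) :
    ContinuousOn (fun p : Torus × ℂ => deriv (f p.1) p.2) (univ ×ˢ pencil σ) :=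
  continuousOn_deriv_of_continuousOn_prod (isOpen_pencil σ) hf.continuousOn
    fun x _ => hf.holomorphic x

theorem hasDerivAt_mode (hf : IsAnalyticField σ f) (α : ℤ) {z : ℂ} (hz : z ∈ pencil σ) :
    HasDerivAt (mode f α) (mode (fun x z => deriv (f x) z) α z) z := by
  obtain ⟨r, hr, hB⟩ := Metric.nhds_basis_closedBall.mem_iff.1 ((isOpen_pencil σ).mem_nhds hz)
  have hc : IsCompact ((univ : Set Torus) ×ˢ Metric.closedBall z r) :=
    isCompact_univ.prod (isCompact_closedBall _ _)
  obtain ⟨C, hC⟩ := hc.exists_bound_of_continuousOn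
    (hf.continuousOn_deriv.mono (prod_mono subset_rfl hB))
  have hcz : ∀ w ∈ pencil σ, Continuous fun x => fourier (-α) x • f x w := fun w hw =>
    (fourier (-α) : C(Torus, ℂ)).continuous.smul (continuous_section hf.continuousOn hw)
  have hcz' : Continuous fun x => fourier (-α) x • deriv (f x) z :=
    (fourier (-α) : C(Torus, ℂ)).continuous.smul (continuous_section (f := fun x w => deriv (f x) w)
      hf.continuousOn_deriv hz)
  refine (hasDerivAt_integral_of_dominated_loc_of_deriv_le (bound := fun _ => C)
    (F := fun w x => fourier (-α) x • f x w) (F' := fun w x => fourier (-α) x • deriv (f x) w)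
    (Metric.closedBall_mem_nhds z hr) ?_ ?_ hcz'.aestronglyMeasurable ?_ (integrable_const _) ?_).2
  · filter_upwards [(isOpen_pencil σ).mem_nhds hz] with w hw
    exact (hcz w hw).aestronglyMeasurable
  · exact (hcz z hz).integrable_of_hasCompactSupport (HasCompactSupport.of_compactSpace _)
  · refine Eventually.of_forall fun x w hw => ?_
    rw [norm_smul, fourier_apply, Circle.norm_coe, one_mul]
    exact hC (x, w) ⟨trivial, hw⟩
  · refine Eventually.of_forall fun x w hw => ?_
    exact (((hf.holomorphic x).differentiableAt
      ((isOpen_pencil σ).mem_nhds (hB hw))).hasDerivAt).const_smul (fourier (-α) x)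

theorem differentiableOn_mode (hf : IsAnalyticField σ f) (α : ℤ) :
    DifferentiableOn ℂ (mode f α) (pencil σ) := fun _ hz =>
  (hf.hasDerivAt_mode α hz).differentiableAt.differentiableWithinAt

theorem psiDz (hf : IsAnalyticField σ f) : IsAnalyticField σ (StokesSlip.psiDz f) where
  continuousOn := by
    refine ContinuousOn.mul ?_ hf.continuousOn_deriv
    refine continuousOn_snd.div (by fun_prop) fun p hp => ?_
    exact one_add_ne_zero_of_re_pos (re_pos_of_mem_pencil hp.2)
  holomorphic x := by
    refine DifferentiableOn.mul ?_ ((hf.holomorphic x).deriv (isOpen_pencil σ))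
    refine differentiableOn_id.div (by fun_prop) fun z hz => ?_
    exact one_add_ne_zero_of_re_pos (re_pos_of_mem_pencil hz)

end StokesSlip.IsAnalyticField

/-- The conormal derivative `ψ(z) ∂_z` of a function of `z`. -/
noncomputable def pd (g : ℂ → ℂ) : ℂ → ℂ := fun z => z / (1 + z) * deriv g z

theorem pd_congr {σ : ℝ} {g h : ℂ → ℂ} (H : EqOn g h (pencil σ)) : EqOn (pd g) (pd h) (pencil σ) :=
  fun z hz => by
    have : g =ᶠ[𝓝 z] h := H.eventuallyEq_of_mem ((isOpen_pencil σ).mem_nhds hz)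
    simp only [pd, this.deriv_eq]

theorem pd_iter_congr {σ : ℝ} {g h : ℂ → ℂ} (H : EqOn g h (pencil σ)) (l : ℕ) :
    EqOn (pd^[l] g) (pd^[l] h) (pencil σ) := by
  induction l with
  | zero => exact H
  | succ l ih => rw [Function.iterate_succ_apply', Function.iterate_succ_apply']; exact pd_congr ih

theorem differentiableOn_pd {σ : ℝ} {g : ℂ → ℂ} (hg : DifferentiableOn ℂ g (pencil σ)) :
    DifferentiableOn ℂ (pd g) (pencil σ) := by
  refine DifferentiableOn.mul ?_ (hg.deriv (isOpen_pencil σ))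
  refine differentiableOn_id.div (by fun_prop) fun z hz => ?_
  exact one_add_ne_zero_of_re_pos (re_pos_of_mem_pencil hz)

theorem differentiableOn_pd_iter {σ : ℝ} {g : ℂ → ℂ} (hg : DifferentiableOn ℂ g (pencil σ))
    (l : ℕ) : DifferentiableOn ℂ (pd^[l] g) (pencil σ) := by
  induction l with
  | zero => exact hg
  | succ l ih => rw [Function.iterate_succ_apply']; exact differentiableOn_pd ih

theorem mode_psiDz {σ : ℝ} {f : Torus → ℂ → ℂ} (hf : IsAnalyticField σ f) (α : ℤ) :
    EqOn (mode (psiDz f) α) (pd (mode f α)) (pencil σ) := fun z hz => by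
  simp only [pd, (hf.hasDerivAt_mode α hz).deriv, mode, psiDz, fourierCoeff, ← integral_const_mul]
  congr 1; ext x; simp only [smul_eq_mul]; ring

theorem isAnalyticField_psiDz_iter {σ : ℝ} {f : Torus → ℂ → ℂ} (hf : IsAnalyticField σ f) (l : ℕ) :
    IsAnalyticField σ (psiDz^[l] f) := by
  induction l with
  | zero => exact hf
  | succ l ih => rw [Function.iterate_succ_apply']; exact ih.psiDz

theorem mode_psiDz_iter {σ : ℝ} {f : Torus → ℂ → ℂ} (hf : IsAnalyticField σ f) (α : ℤ) (l : ℕ) :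
    EqOn (mode (psiDz^[l] f) α) (pd^[l] (mode f α)) (pencil σ) := by
  induction l with
  | zero => exact fun _ _ => rfl
  | succ l ih =>
    rw [Function.iterate_succ_apply', Function.iterate_succ_apply']
    exact (mode_psiDz (isAnalyticField_psiDz_iter hf l) α).trans (pd_congr ih)

/-! ### Fourier series with exponentially decaying coefficients -/

theorem summable_pow_mul_exp_neg_abs (n : ℕ) {ρ : ℝ} (hρ : 0 < ρ) :
    Summable fun α : ℤ => |(α : ℝ)| ^ n * Real.exp (-ρ * |(α : ℝ)|) := by
  have h : Summable fun m : ℕ => (m : ℝ) ^ n * Real.exp (-ρ * m) := by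
    have := Real.summable_pow_mul_exp_neg_nat_mul n hρ
    simpa using this
  refine Summable.of_nat_of_neg ?_ ?_
  · simpa using h
  · simpa using h

theorem hasDerivAt_fourier_shift (α : ℤ) (x : Torus) (h : ℝ) :
    HasDerivAt (fun h : ℝ => fourier α (x + (h : Torus)))
      (Complex.I * α * fourier α (x + (h : Torus))) h := by
  induction x using QuotientAddGroup.induction_on with
  | H y =>
    have h1 : ∀ h : ℝ, fourier α (((y : ℝ) : Torus) + (h : Torus)) =
        Complex.exp (Complex.I * α * (y + h : ℂ)) := by
      intro h
      have h2 : (((y : ℝ) : Torus) + (h : Torus)) = ((y + h : ℝ) : Torus) := rfl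
      rw [h2, fourier_coe_apply]
      congr 1
      have : (Real.pi : ℂ) ≠ 0 := by exact_mod_cast Real.pi_ne_zero
      push_cast
      field_simp
    have h3 : HasDerivAt (fun h : ℝ => Complex.exp (Complex.I * α * (y + h : ℂ)))
        (Complex.exp (Complex.I * α * (y + h : ℂ)) * (Complex.I * α * 1)) h := by
      have h4 : HasDerivAt (fun h : ℝ => ((y : ℂ) + (h : ℂ))) 1 h :=
        (Complex.ofRealCLM.hasDerivAt.const_add (y : ℂ)).congr_deriv (by simp)
      exact (h4.const_mul _).cexp
    have h5 := h1 h
    refine (h3.congr_of_eventuallyEq (Eventually.of_forall h1)).congr_deriv ?_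
    erw [h5]; ring

theorem norm_fourier_apply (α : ℤ) (x : Torus) : ‖fourier α x‖ = 1 := by
  rw [fourier_apply, Circle.norm_coe]

theorem norm_fourierSeries_term_le {c : ℤ → ℂ} {B ρ : ℝ}
    (hc : ∀ α, ‖c α‖ ≤ B * Real.exp (-ρ * |(α : ℝ)|)) (x : Torus) (α : ℤ) :
    ‖c α * fourier α x‖ ≤ B * Real.exp (-ρ * |(α : ℝ)|) := by
  rw [norm_mul, norm_fourier_apply, mul_one]; exact hc α

theorem summable_exp_neg_abs {ρ : ℝ} (hρ : 0 < ρ) (B : ℝ) :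
    Summable fun α : ℤ => B * Real.exp (-ρ * |(α : ℝ)|) := by
  simpa using (summable_pow_mul_exp_neg_abs 0 hρ).mul_left B

theorem hasDerivAt_fourierSeries {c : ℤ → ℂ} {B ρ : ℝ} (hρ : 0 < ρ)
    (hc : ∀ α, ‖c α‖ ≤ B * Real.exp (-ρ * |(α : ℝ)|)) (x : Torus) :
    HasDerivAt (fun h : ℝ => ∑' α : ℤ, c α * fourier α (x + (h : Torus)))
      (∑' α : ℤ, Complex.I * α * c α * fourier α x) 0 := by
  have h0 := hasDerivAt_tsum (u := fun α : ℤ => B * (|(α : ℝ)| ^ 1 * Real.exp (-ρ * |(α : ℝ)|)))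
    ((summable_pow_mul_exp_neg_abs 1 hρ).mul_left B)
    (g := fun (α : ℤ) (h : ℝ) => c α * fourier α (x + (h : Torus)))
    (g' := fun (α : ℤ) (h : ℝ) => c α * (Complex.I * α * fourier α (x + (h : Torus))))
    (y₀ := 0) (fun α h => (hasDerivAt_fourier_shift α x h).const_mul (c α))
    (fun α h => by
      rw [norm_mul, norm_mul, norm_fourier_apply, norm_mul, Complex.norm_I, Complex.norm_intCast]
      have := mul_le_mul_of_nonneg_right (hc α) (abs_nonneg (α : ℝ))
      calc _ = ‖c α‖ * |(α : ℝ)| := by ring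
        _ ≤ _ := this
        _ = _ := by ring)
    (Summable.of_norm_bounded (summable_exp_neg_abs hρ B)
      (norm_fourierSeries_term_le hc (x + ((0 : ℝ) : Torus)))) 0
  refine h0.congr_deriv (tsum_congr fun α => ?_)
  have : x + ((0 : ℝ) : Torus) = x := by simp
  rw [this]; ring

theorem fourierCoeff_fourierSeries {c : ℤ → ℂ} {B ρ : ℝ} (hρ : 0 < ρ)
    (hc : ∀ α, ‖c α‖ ≤ B * Real.exp (-ρ * |(α : ℝ)|)) (α : ℤ) :
    fourierCoeff (fun x : Torus => ∑' β : ℤ, c β * fourier β x) α = c α := by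
  have hs : Summable fun β : ℤ => c β • (fourier β : C(Torus, ℂ)) := by
    refine Summable.of_norm_bounded (summable_exp_neg_abs hρ B) fun β => ?_
    rw [norm_smul, fourier_norm, mul_one]; exact hc β
  have h1 : (fun x : Torus => ∑' β : ℤ, c β * fourier β x) =
      ⇑(∑' β : ℤ, c β • (fourier β : C(Torus, ℂ))) := by
    ext x
    rw [← ContinuousMap.tsum_apply hs]
    rfl
  rw [h1, ← fcL_apply, (fcL α).map_tsum hs]
  simp only [map_smul, fcL_apply, fourierCoeff_fourier]
  rw [tsum_eq_single α]
  · simp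
  · intro β hβ
    simp [hβ]

/-- A continuous function on the torus with summable Fourier coefficients is the sum of its
Fourier series. -/
theorem eq_fourierSeries {g : Torus → ℂ} (hg : Continuous g) (hs : Summable (fourierCoeff g))
    (x : Torus) : g x = ∑' α : ℤ, fourierCoeff g α * fourier α x := by
  have := has_pointwise_sum_fourier_series_of_summable (f := ⟨g, hg⟩) hs x
  exact this.tsum_eq.symm

theorem eq_zero_of_fourierCoeff_eq_zero {g : Torus → ℂ} (hg : Continuous g)
    (h : ∀ α, fourierCoeff g α = 0) (x : Torus) : g x = 0 := by
  rw [eq_fourierSeries hg (by rw [funext h]; exact summable_zero) x]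
  simp [h]

/-! ### Pointwise bounds from contour integrals -/

theorem one_le_contourSpeed (θ r : ℝ) : 1 ≤ contourSpeed θ r := by
  unfold contourSpeed
  split_ifs
  · rw [Real.one_le_sqrt]; nlinarith [sq_nonneg θ]
  · exact le_rfl

theorem contourSpeed_le_two {θ : ℝ} (h0 : 0 ≤ θ) (h1 : θ ≤ 1) (r : ℝ) : contourSpeed θ r ≤ 2 := by
  unfold contourSpeed
  split_ifs
  · rw [Real.sqrt_le_left (by norm_num)]; nlinarith
  · norm_num

/-- The `L¹` norm of a function along each curve `gam θ` is controlled by `modeL1`. -/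
theorem lintegral_gam_le_modeL1 {σ θ : ℝ} (hθ : |θ| < σ) (g : ℂ → ℂ) :
    ∫⁻ r in Ioi (0 : ℝ), ‖g (gam θ r)‖ₑ ≤ modeL1 σ g := by
  have h1 : ∫⁻ r in Ioi (0 : ℝ), ‖g (gam θ r)‖ₑ ≤ contourL1 |θ| g := by
    unfold contourL1
    refine lintegral_mono fun r => ?_
    have h2 : ‖g (gam θ r)‖ₑ ≤ ‖g (contour |θ| r)‖ₑ + ‖g ((starRingEnd ℂ) (contour |θ| r))‖ₑ := by
      rw [contour_eq_gam (abs_nonneg θ), ← contour_eq_gam (abs_nonneg θ),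
        conj_contour_eq_gam (abs_nonneg θ), contour_eq_gam (abs_nonneg θ)]
      rcases abs_cases θ with h | h
      · rw [h.1]; exact le_self_add
      · rw [h.1, neg_neg]; exact le_add_self
    calc ‖g (gam θ r)‖ₑ ≤ (‖g (contour |θ| r)‖ₑ + ‖g ((starRingEnd ℂ) (contour |θ| r))‖ₑ) * 1 := by
          rw [mul_one]; exact h2
      _ ≤ _ := by
          gcongr
          rw [← ENNReal.ofReal_one]
          exact ENNReal.ofReal_le_ofReal (one_le_contourSpeed _ _)
  refine h1.trans ?_
  unfold modeL1
  exact le_iSup₂ (f := fun θ (_ : θ ∈ Ico 0 σ) => contourL1 θ g) |θ| ⟨abs_nonneg θ, hθ⟩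

theorem lintegral_eq_mul_lintegral_comp_mul {φ : ℝ → ℝ≥0∞} (hφ : Measurable φ) {a : ℝ}
    (ha : a ≠ 0) : ∫⁻ y, φ y = ENNReal.ofReal |a| * ∫⁻ θ, φ (a * θ) := by
  conv_lhs => rw [← Real.smul_map_volume_mul_left ha]
  rw [lintegral_smul_measure, lintegral_map hφ (by fun_prop)]
  rfl

theorem measurable_indicator_enorm {σ : ℝ} {v : ℂ → ℂ} (hv : ContinuousOn v (pencil σ)) :
    Measurable ((pencil σ).indicator fun z => ‖v z‖ₑ) := by
  have hm := (isOpen_pencil σ).measurableSet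
  have : (pencil σ).indicator (fun z => ‖v z‖ₑ) = fun z => ‖(pencil σ).indicator v z‖ₑ := by
    ext z; by_cases h : z ∈ pencil σ <;> simp [h]
  rw [this]
  refine Measurable.enorm ?_
  classical
  rw [← Set.piecewise_eq_indicator]
  exact hv.measurable_piecewise continuousOn_const hm

/-- Integration over the pencil along the curves `gam θ`; the Jacobian `min r 1` of
`(r, θ) ↦ gam θ r` is at most one. -/
theorem lintegral_pencil_le {σ : ℝ} {v : ℂ → ℂ} (hv : ContinuousOn v (pencil σ)) :
    ∫⁻ z, (pencil σ).indicator (fun z => ‖v z‖ₑ) z ≤ ENNReal.ofReal (2 * σ) * modeL1 σ v := by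
  set φ := (pencil σ).indicator fun z => ‖v z‖ₑ with hφ
  have hφm : Measurable φ := measurable_indicator_enorm hv
  have hgm : Measurable fun p : ℝ × ℝ => φ (gam p.2 p.1) :=
    hφm.comp (continuous_gam.comp continuous_swap).measurable
  have h1 : ∀ r : ℝ, ∫⁻ y, φ ⟨r, y⟩ ≤
      (Ioi (0 : ℝ)).indicator (fun r => ∫⁻ θ, φ (gam θ r)) r := by
    intro r
    by_cases hr : 0 < r
    · rw [indicator_of_mem (by exact hr)]
      have hm : 0 < min r 1 := lt_min hr one_pos
      have hmeas : Measurable fun y : ℝ => φ ⟨r, y⟩ := by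
        refine hφm.comp ?_
        have : (fun y : ℝ => (⟨r, y⟩ : ℂ)) = fun y : ℝ => (r : ℂ) + y * Complex.I := by
          ext y; apply Complex.ext <;> simp
        change Measurable fun y : ℝ => (⟨r, y⟩ : ℂ)
        rw [this]; fun_prop
      rw [lintegral_eq_mul_lintegral_comp_mul hmeas hm.ne', abs_of_pos hm]
      calc _ ≤ 1 * ∫⁻ θ, φ ⟨r, min r 1 * θ⟩ := by
            gcongr
            rw [← ENNReal.ofReal_one]
            exact ENNReal.ofReal_le_ofReal (min_le_right _ _)
        _ = _ := by rw [one_mul]; simp only [gam, mul_comm]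
    · have : ∀ y : ℝ, φ ⟨r, y⟩ = 0 := fun y => by
        rw [hφ, indicator_of_notMem]
        intro h; exact hr (re_pos_of_mem_pencil h)
      simp [this]
  have h2 : ∀ θ : ℝ, ∫⁻ r in Ioi (0 : ℝ), φ (gam θ r) ≤
      (Ioo (-σ) σ).indicator (fun _ => modeL1 σ v) θ := by
    intro θ
    by_cases hθ : |θ| < σ
    · rw [indicator_of_mem (show θ ∈ Ioo (-σ) σ from abs_lt.1 hθ)]
      refine le_trans (lintegral_mono fun r => ?_) (lintegral_gam_le_modeL1 hθ v)
      exact indicator_le_self (pencil σ) (fun z => ‖v z‖ₑ) _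
    · have : ∀ r ∈ Ioi (0 : ℝ), φ (gam θ r) = 0 := fun r hr => by
        rw [hφ, indicator_of_notMem]
        intro h
        rw [mem_pencil_iff, gam_im, gam_re] at h
        have hm : 0 < min r 1 := lt_min hr one_pos
        rw [abs_mul, abs_of_pos hm] at h
        rcases le_total r 1 with h' | h'
        · rw [min_eq_left h'] at h
          exact hθ (lt_of_mul_lt_mul_right h.1 (le_of_lt hr))
        · rw [min_eq_right h', mul_one] at h
          exact hθ h.2
      rw [setLIntegral_congr_fun measurableSet_Ioi this]
      simp
  rw [← (Complex.volume_preserving_equiv_real_prod.symm).lintegral_comp_emb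
    Complex.measurableEquivRealProd.symm.measurableEmbedding, Measure.volume_eq_prod,
    lintegral_prod (fun a => φ (Complex.measurableEquivRealProd.symm a))
      (hφm.comp Complex.measurableEquivRealProd.symm.measurable).aemeasurable]
  calc ∫⁻ r, ∫⁻ y, φ (Complex.measurableEquivRealProd.symm (r, y))
      ≤ ∫⁻ r, (Ioi (0 : ℝ)).indicator (fun r => ∫⁻ θ, φ (gam θ r)) r := lintegral_mono h1
    _ = ∫⁻ r in Ioi (0 : ℝ), ∫⁻ θ, φ (gam θ r) := lintegral_indicator measurableSet_Ioi _
    _ = ∫⁻ θ, ∫⁻ r in Ioi (0 : ℝ), φ (gam θ r) :=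
        lintegral_lintegral_swap (f := fun r θ => φ (gam θ r)) hgm.aemeasurable
    _ ≤ ∫⁻ θ, (Ioo (-σ) σ).indicator (fun _ => modeL1 σ v) θ := lintegral_mono h2
    _ = _ := by
        rw [lintegral_indicator measurableSet_Ioo, setLIntegral_const, Real.volume_Ioo, mul_comm]
        congr 2; ring

theorem enorm_mul_two_pi_le {v : ℂ → ℂ} {z : ℂ} {r : ℝ} (hr : 0 < r)
    (hv : DifferentiableOn ℂ v (Metric.closedBall z r)) :
    ‖v z‖ₑ * ENNReal.ofReal (2 * Real.pi) ≤
      ∫⁻ θ in Ioo (-Real.pi) Real.pi, ‖v (circleMap z r θ)‖ₑ := by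
  have h1 : Real.circleAverage v z r = v z := by
    refine DiffContOnCl.circleAverage (DifferentiableOn.diffContOnCl ?_)
    rwa [abs_of_pos hr, closure_ball z hr.ne']
  rw [Real.circleAverage_eq_integral_add (-Real.pi),
    intervalIntegral.integral_comp_add_right (fun t => v (circleMap z r t))] at h1
  rw [show 0 + -Real.pi = -Real.pi by ring, show 2 * Real.pi + -Real.pi = Real.pi by ring,
    intervalIntegral.integral_of_le (by linarith [Real.pi_pos]), integral_Ioc_eq_integral_Ioo] at h1
  rw [← h1, enorm_smul]
  have h2 : ‖(2 * Real.pi)⁻¹‖ₑ = (ENNReal.ofReal (2 * Real.pi))⁻¹ := by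
    rw [← ENNReal.ofReal_inv_of_pos Real.two_pi_pos, Real.enorm_of_nonneg (by positivity)]
  rw [h2, mul_comm, ← mul_assoc, ENNReal.mul_inv_cancel, one_mul]
  · exact enorm_integral_le_lintegral_enorm _
  · simp [Real.pi_pos]
  · exact ENNReal.ofReal_ne_top

/-- The area mean value inequality for holomorphic functions. -/
theorem enorm_mul_sq_le_lintegral {v : ℂ → ℂ} {U : Set ℂ}
    (hv : DifferentiableOn ℂ v U) {z : ℂ} {R : ℝ} (hR : 0 < R) (hB : Metric.closedBall z R ⊆ U) :
    ‖v z‖ₑ * ENNReal.ofReal R ^ 2 ≤ ∫⁻ w, U.indicator (fun w => ‖v w‖ₑ) w := by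
  set φ := U.indicator fun w => ‖v w‖ₑ with hφ
  have h0 : ∫⁻ w, φ w = ∫⁻ w, φ (z + w) := (lintegral_add_left_eq_self φ z).symm
  rw [h0, ← Complex.lintegral_comp_polarCoord_symm, polarCoord_target]
  have hsub : Ioo (R / 2) R ×ˢ Ioo (-Real.pi) Real.pi ⊆ Ioi (0 : ℝ) ×ˢ Ioo (-Real.pi) Real.pi :=
    prod_mono (fun r hr => (half_pos hR).trans hr.1) subset_rfl
  refine le_trans ?_ (lintegral_mono_set hsub)
  have hpt : ∀ p ∈ Ioo (R / 2) R ×ˢ Ioo (-Real.pi) Real.pi,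
      ENNReal.ofReal (R / 2) * ‖v (circleMap z p.1 p.2)‖ₑ ≤
      ENNReal.ofReal p.1 • φ (z + Complex.polarCoord.symm p) := by
    rintro ⟨r, θ⟩ ⟨hr, hθ⟩
    have h1 : z + Complex.polarCoord.symm (r, θ) = circleMap z r θ := by
      rw [Complex.polarCoord_symm_apply, circleMap, Complex.exp_mul_I]
      push_cast; rfl
    have hr0 : 0 < r := (half_pos hR).trans hr.1
    have h2 : circleMap z r θ ∈ U := hB (Metric.closedBall_subset_closedBall hr.2.le
      (circleMap_mem_closedBall z hr0.le θ))
    rw [h1, hφ, indicator_of_mem h2, smul_eq_mul]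
    gcongr
    exact hr.1.le
  refine le_trans ?_ (setLIntegral_mono' (measurableSet_Ioo.prod measurableSet_Ioo) hpt)
  rw [Measure.volume_eq_prod, ← Measure.prod_restrict]
  have hc : ContinuousOn (fun p : ℝ × ℝ => v (circleMap z p.1 p.2))
      (Ioo (R / 2) R ×ˢ Ioo (-Real.pi) Real.pi) := by
    refine hv.continuousOn.comp (by simp only [circleMap]; fun_prop) ?_
    rintro ⟨r, θ⟩ ⟨hr, hθ⟩
    exact hB (Metric.closedBall_subset_closedBall hr.2.le
      (circleMap_mem_closedBall z ((half_pos hR).trans hr.1).le θ))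
  rw [lintegral_prod]
  swap
  · rw [Measure.prod_restrict]
    exact ((hc.aestronglyMeasurable (measurableSet_Ioo.prod measurableSet_Ioo)).enorm).const_mul _
  calc ‖v z‖ₑ * ENNReal.ofReal R ^ 2
      ≤ ∫⁻ r in Ioo (R / 2) R, ENNReal.ofReal (R / 2) * (‖v z‖ₑ * ENNReal.ofReal (2 * Real.pi)) := by
        rw [setLIntegral_const, Real.volume_Ioo, show R - R / 2 = R / 2 by ring]
        have : ENNReal.ofReal R ^ 2 ≤ ENNReal.ofReal (R / 2) * ENNReal.ofReal (2 * Real.pi) *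
            ENNReal.ofReal (R / 2) := by
          rw [← ENNReal.ofReal_mul (by positivity), ← ENNReal.ofReal_mul (by positivity),
            ← ENNReal.ofReal_pow hR.le]
          apply ENNReal.ofReal_le_ofReal
          nlinarith [Real.pi_gt_three, sq_nonneg R, mul_pos hR hR]
        calc ‖v z‖ₑ * ENNReal.ofReal R ^ 2 ≤ ‖v z‖ₑ * (ENNReal.ofReal (R / 2) *
              ENNReal.ofReal (2 * Real.pi) * ENNReal.ofReal (R / 2)) := by gcongr
          _ = _ := by ring
    _ ≤ ∫⁻ r in Ioo (R / 2) R, ∫⁻ θ in Ioo (-Real.pi) Real.pi,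
          ENNReal.ofReal (R / 2) * ‖v (circleMap z r θ)‖ₑ := by
        refine setLIntegral_mono' measurableSet_Ioo fun r hr => ?_
        rw [lintegral_const_mul' _ _ ENNReal.ofReal_ne_top]
        gcongr
        exact enorm_mul_two_pi_le ((half_pos hR).trans hr.1)
          (hv.mono ((Metric.closedBall_subset_closedBall hr.2.le).trans hB))

/-- On compact subsets of the pencil the modulus of a holomorphic function is controlled by its
`L¹` norm along the contours. -/
theorem exists_enorm_le_modeL1 {σ : ℝ} (hσ : 0 < σ) {K : Set ℂ} (hK : IsCompact K)
    (hKs : K ⊆ pencil σ) : ∃ C : ℝ, 0 < C ∧ ∀ v : ℂ → ℂ, DifferentiableOn ℂ v (pencil σ) →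
      ∀ z ∈ K, ‖v z‖ₑ ≤ ENNReal.ofReal C * modeL1 σ v := by
  obtain ⟨R, hR, hRs⟩ := hK.exists_cthickening_subset_open (isOpen_pencil σ) hKs
  refine ⟨2 * σ / R ^ 2, by positivity, fun v hv z hz => ?_⟩
  have hB : Metric.closedBall z R ⊆ pencil σ := (Metric.closedBall_subset_cthickening hz R).trans hRs
  have h := (enorm_mul_sq_le_lintegral hv hR hB).trans
    (lintegral_pencil_le hv.continuousOn)
  have h0 : ENNReal.ofReal R ^ 2 ≠ 0 := by simp [hR]
  have h1 : ENNReal.ofReal R ^ 2 ≠ ∞ := by finiteness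
  rw [← ENNReal.le_div_iff_mul_le (Or.inl h0) (Or.inl h1)] at h
  refine h.trans (le_of_eq ?_)
  rw [ENNReal.ofReal_div_of_pos (by positivity), ENNReal.ofReal_pow hR.le, div_eq_mul_inv,
    div_eq_mul_inv]
  ring

/-! ### Fields with exponentially decaying Fourier modes -/

/-- An analytic field whose Fourier modes decay exponentially, locally uniformly in `z`. This class
is stable under `∂ₓ` and `ψ ∂_z`, and contains the fields with finite `normL1`. -/
structure NiceField (σ : ℝ) (f : Torus → ℂ → ℂ) : Prop where
  analytic : IsAnalyticField σ f
  decay : ∀ K, IsCompact K → K ⊆ pencil σ → ∃ B ρ : ℝ, 0 < ρ ∧ ∀ α : ℤ, ∀ z ∈ K,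
    ‖mode f α z‖ ≤ B * Real.exp (-ρ * |(α : ℝ)|)

theorem niceField_of_normL1_lt_top {ρ σ : ℝ} (hρ : 0 < ρ) (hσ : 0 < σ) {f : Torus → ℂ → ℂ}
    (hf : IsAnalyticField σ f) (h : normL1 ρ σ f < ∞) : NiceField σ f where
  analytic := hf
  decay K hK hKs := by
    obtain ⟨C, hC, hb⟩ := exists_enorm_le_modeL1 hσ hK hKs
    refine ⟨C * (normL1 ρ σ f).toReal, ρ, hρ, fun α z hz => ?_⟩
    have h1 : ENNReal.ofReal (Real.exp (ρ * |(α : ℝ)|)) * modeL1 σ (mode f α) ≤ normL1 ρ σ f :=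
      ENNReal.le_tsum (f := fun α : ℤ =>
        ENNReal.ofReal (Real.exp (ρ * |(α : ℝ)|)) * modeL1 σ (mode f α)) α
    have h2 := hb _ (hf.differentiableOn_mode α) z hz
    have h3 : ENNReal.ofReal (Real.exp (ρ * |(α : ℝ)|)) * ‖mode f α z‖ₑ ≤
        ENNReal.ofReal C * normL1 ρ σ f := by
      calc _ ≤ ENNReal.ofReal (Real.exp (ρ * |(α : ℝ)|)) *
            (ENNReal.ofReal C * modeL1 σ (mode f α)) := by gcongr
        _ = ENNReal.ofReal C *
            (ENNReal.ofReal (Real.exp (ρ * |(α : ℝ)|)) * modeL1 σ (mode f α)) := by ring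
        _ ≤ _ := by gcongr
    rw [← ENNReal.ofReal_toReal h.ne, ← ENNReal.ofReal_mul hC.le, ← ofReal_norm,
      ← ENNReal.ofReal_mul (by positivity), ENNReal.ofReal_le_ofReal_iff (by positivity)] at h3
    rw [neg_mul, Real.exp_neg, ← div_eq_mul_inv, le_div_iff₀ (by positivity), mul_comm]
    exact h3

namespace NiceField

variable {σ : ℝ} {f : Torus → ℂ → ℂ}

theorem decay_at (hf : NiceField σ f) {z : ℂ} (hz : z ∈ pencil σ) :
    ∃ B ρ : ℝ, 0 < ρ ∧ ∀ α : ℤ, ‖mode f α z‖ ≤ B * Real.exp (-ρ * |(α : ℝ)|) := by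
  obtain ⟨B, ρ, hρ, h⟩ := hf.decay {z} isCompact_singleton (by simpa using hz)
  exact ⟨B, ρ, hρ, fun α => h α z rfl⟩

theorem eq_tsum (hf : NiceField σ f) {z : ℂ} (hz : z ∈ pencil σ) (x : Torus) :
    f x z = ∑' α : ℤ, mode f α z * fourier α x := by
  obtain ⟨B, ρ, hρ, h⟩ := hf.decay_at hz
  exact eq_fourierSeries (continuous_section hf.analytic.continuousOn hz)
    (Summable.of_norm_bounded (summable_exp_neg_abs hρ B) h) x

theorem hasDerivAt_dx (hf : NiceField σ f) {z : ℂ} (hz : z ∈ pencil σ) (x : Torus) :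
    HasDerivAt (fun h : ℝ => f (x + (h : Torus)) z)
      (∑' α : ℤ, Complex.I * α * mode f α z * fourier α x) 0 := by
  obtain ⟨B, ρ, hρ, h⟩ := hf.decay_at hz
  simp only [hf.eq_tsum hz]
  exact hasDerivAt_fourierSeries hρ h x

theorem dx_eq_tsum (hf : NiceField σ f) {z : ℂ} (hz : z ∈ pencil σ) (x : Torus) :
    dx f x z = ∑' α : ℤ, Complex.I * α * mode f α z * fourier α x :=
  (hf.hasDerivAt_dx hz x).deriv

end NiceField

theorem exists_abs_mul_exp_le {ρ : ℝ} (hρ : 0 < ρ) :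
    ∃ D : ℝ, 0 < D ∧ ∀ a : ℝ, |a| * Real.exp (-ρ * |a|) ≤ D * Real.exp (-(ρ / 2) * |a|) := by
  refine ⟨2 / ρ, by positivity, fun a => ?_⟩
  have h1 := Real.add_one_le_exp (ρ / 2 * |a|)
  have h2 : Real.exp (-(ρ / 2) * |a|) = Real.exp (-ρ * |a|) * Real.exp (ρ / 2 * |a|) := by
    rw [← Real.exp_add]; congr 1; ring
  rw [h2]
  have h3 : |a| ≤ 2 / ρ * Real.exp (ρ / 2 * |a|) := by
    rw [div_mul_eq_mul_div, le_div_iff₀ hρ]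
    nlinarith
  nlinarith [Real.exp_pos (-ρ * |a|)]

theorem NiceField.exists_norm_I_mul_mode_le {σ : ℝ} {f : Torus → ℂ → ℂ} (hf : NiceField σ f)
    {K : Set ℂ} (hK : IsCompact K) (hKs : K ⊆ pencil σ) :
    ∃ B ρ : ℝ, 0 < ρ ∧ ∀ α : ℤ, ∀ z ∈ K,
      ‖Complex.I * α * mode f α z‖ ≤ B * Real.exp (-ρ * |(α : ℝ)|) := by
  obtain ⟨B, ρ, hρ, h⟩ := hf.decay K hK hKs
  obtain ⟨D, hD, hD'⟩ := exists_abs_mul_exp_le hρ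
  refine ⟨|B| * D, ρ / 2, by positivity, fun α z hz => ?_⟩
  rw [norm_mul, norm_mul, Complex.norm_I, Complex.norm_intCast, one_mul]
  calc |(α : ℝ)| * ‖mode f α z‖ ≤ |(α : ℝ)| * (B * Real.exp (-ρ * |(α : ℝ)|)) := by
        gcongr; exact h α z hz
    _ ≤ |(α : ℝ)| * (|B| * Real.exp (-ρ * |(α : ℝ)|)) := by gcongr; exact le_abs_self B
    _ = |B| * (|(α : ℝ)| * Real.exp (-ρ * |(α : ℝ)|)) := by ring
    _ ≤ |B| * (D * Real.exp (-(ρ / 2) * |(α : ℝ)|)) :=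
        mul_le_mul_of_nonneg_left (hD' _) (abs_nonneg B)
    _ = _ := by ring

theorem NiceField.mode_dx {σ : ℝ} {f : Torus → ℂ → ℂ} (hf : NiceField σ f) (α : ℤ) :
    EqOn (mode (dx f) α) (fun z => Complex.I * α * mode f α z) (pencil σ) := by
  intro z hz
  obtain ⟨B, ρ, hρ, h⟩ := hf.exists_norm_I_mul_mode_le isCompact_singleton
    (singleton_subset_iff.2 hz)
  have : (fun x => dx f x z) = fun x => ∑' α : ℤ, Complex.I * α * mode f α z * fourier α x :=
    funext fun x => hf.dx_eq_tsum hz x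
  simp only [mode] at this ⊢
  rw [this]
  exact fourierCoeff_fourierSeries hρ (fun α => h α z rfl) α

/-- A sum of a Fourier series with locally uniformly decaying holomorphic coefficients is an
analytic field. -/
theorem isAnalyticField_of_eq_tsum {σ : ℝ} {f : Torus → ℂ → ℂ} {c : ℤ → ℂ → ℂ}
    (hc : ∀ α, DifferentiableOn ℂ (c α) (pencil σ))
    (hd : ∀ K, IsCompact K → K ⊆ pencil σ → ∃ B ρ : ℝ, 0 < ρ ∧ ∀ α : ℤ, ∀ z ∈ K,
      ‖c α z‖ ≤ B * Real.exp (-ρ * |(α : ℝ)|))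
    (hf : ∀ z ∈ pencil σ, ∀ x, f x z = ∑' α : ℤ, c α z * fourier α x) : IsAnalyticField σ f := by
  have key : ∀ z₀ ∈ pencil σ, ∃ V ∈ 𝓝 z₀, IsOpen V ∧ V ⊆ pencil σ ∧
      ∃ B ρ : ℝ, 0 < ρ ∧ ∀ α : ℤ, ∀ z ∈ V, ‖c α z‖ ≤ B * Real.exp (-ρ * |(α : ℝ)|) := by
    intro z₀ hz₀
    obtain ⟨r, hr, hB⟩ := Metric.nhds_basis_closedBall.mem_iff.1 ((isOpen_pencil σ).mem_nhds hz₀)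
    obtain ⟨B, ρ, hρ, h⟩ := hd _ (isCompact_closedBall z₀ r) hB
    exact ⟨Metric.ball z₀ r, Metric.ball_mem_nhds z₀ hr, Metric.isOpen_ball,
      Metric.ball_subset_closedBall.trans hB, B, ρ, hρ,
      fun α z hz => h α z (Metric.ball_subset_closedBall hz)⟩
  constructor
  · rintro ⟨x₀, z₀⟩ ⟨-, hz₀⟩
    obtain ⟨V, hV, hVo, hVs, B, ρ, hρ, h⟩ := key z₀ hz₀
    have h1 : ContinuousOn (fun p : Torus × ℂ => ∑' α : ℤ, c α p.2 * fourier α p.1)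
        (univ ×ˢ V) := by
      refine continuousOn_tsum (u := fun α : ℤ => B * Real.exp (-ρ * |(α : ℝ)|)) (fun α => ?_)
        (summable_exp_neg_abs hρ B) fun α p hp => ?_
      · exact (((hc α).continuousOn.mono hVs).comp continuousOn_snd fun p hp => hp.2).mul
          ((map_continuous (fourier α)).comp continuous_fst).continuousOn
      · rw [norm_mul, norm_fourier_apply, mul_one]
        exact h α _ hp.2
    have h2 : ContinuousOn (fun p : Torus × ℂ => f p.1 p.2) (univ ×ˢ V) :=
      h1.congr fun p hp => hf _ (hVs hp.2) _
    exact (h2.continuousAt (prod_mem_nhds univ_mem hV)).continuousWithinAt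
  · intro x z₀ hz₀
    obtain ⟨V, hV, hVo, hVs, B, ρ, hρ, h⟩ := key z₀ hz₀
    have h1 : DifferentiableOn ℂ (fun z => ∑' α : ℤ, c α z * fourier α x) V := by
      refine Complex.differentiableOn_tsum_of_summable_norm (summable_exp_neg_abs hρ B)
        (fun α => ((hc α).mono hVs).mul_const _) hVo fun α z hz => ?_
      rw [norm_mul, norm_fourier_apply, mul_one]
      exact h α _ hz
    have h2 : DifferentiableOn ℂ (f x) V := h1.congr fun z hz => hf z (hVs hz) x
    exact (h2.differentiableAt hV).differentiableWithinAt

theorem NiceField.dx {σ : ℝ} {f : Torus → ℂ → ℂ} (hf : NiceField σ f) :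
    NiceField σ (StokesSlip.dx f) where
  analytic := isAnalyticField_of_eq_tsum
    (fun α => (hf.analytic.differentiableOn_mode α).const_mul (Complex.I * α))
    (fun _ hK hKs => hf.exists_norm_I_mul_mode_le hK hKs)
    (fun _ hz x => hf.dx_eq_tsum hz x)
  decay K hK hKs := by
    obtain ⟨B, ρ, hρ, h⟩ := hf.exists_norm_I_mul_mode_le hK hKs
    exact ⟨B, ρ, hρ, fun α z hz => by rw [hf.mode_dx α (hKs hz)]; exact h α z hz⟩

theorem NiceField.psiDz {σ : ℝ} {f : Torus → ℂ → ℂ} (hf : NiceField σ f) :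
    NiceField σ (StokesSlip.psiDz f) where
  analytic := hf.analytic.psiDz
  decay K hK hKs := by
    obtain ⟨R, hR, hRs⟩ := hK.exists_cthickening_subset_open (isOpen_pencil σ) hKs
    have hK' : IsCompact (Metric.cthickening R K) := hK.cthickening
    obtain ⟨B, ρ, hρ, h⟩ := hf.decay _ hK' hRs
    obtain ⟨D, hD⟩ := hK.exists_bound_of_continuousOn (f := fun z : ℂ => z / (1 + z))
      (continuousOn_id.div (by fun_prop) fun z hz =>
        one_add_ne_zero_of_re_pos (re_pos_of_mem_pencil (hKs hz)))
    refine ⟨|D| * (B / R), ρ, hρ, fun α z hz => ?_⟩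
    rw [mode_psiDz hf.analytic α (hKs hz), pd, norm_mul]
    have hB : Metric.closedBall z R ⊆ Metric.cthickening R K :=
      Metric.closedBall_subset_cthickening hz R
    have h1 : ‖deriv (mode f α) z‖ ≤ B * Real.exp (-ρ * |(α : ℝ)|) / R := by
      refine Complex.norm_deriv_le_of_forall_mem_sphere_norm_le hR ?_ fun w hw =>
        h α w (hB (Metric.sphere_subset_closedBall hw))
      refine DifferentiableOn.diffContOnCl ?_
      rw [closure_ball z hR.ne']
      exact (hf.analytic.differentiableOn_mode α).mono (hB.trans hRs)
    calc _ ≤ |D| * (B * Real.exp (-ρ * |(α : ℝ)|) / R) :=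
          mul_le_mul ((hD z hz).trans (le_abs_self D)) h1 (norm_nonneg _) (abs_nonneg _)
      _ = _ := by ring

theorem NiceField.psiDz_iter {σ : ℝ} {f : Torus → ℂ → ℂ} (hf : NiceField σ f) (l : ℕ) :
    NiceField σ (StokesSlip.psiDz^[l] f) := by
  induction l with
  | zero => exact hf
  | succ l ih => rw [Function.iterate_succ_apply']; exact ih.psiDz

theorem NiceField.dx_iter {σ : ℝ} {f : Torus → ℂ → ℂ} (hf : NiceField σ f) (j : ℕ) :
    NiceField σ (StokesSlip.dx^[j] f) := by
  induction j with
  | zero => exact hf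
  | succ l ih => rw [Function.iterate_succ_apply']; exact ih.dx

theorem NiceField.mode_dx_iter {σ : ℝ} {f : Torus → ℂ → ℂ} (hf : NiceField σ f) (j : ℕ) (α : ℤ) :
    EqOn (mode (StokesSlip.dx^[j] f) α) (fun z => (Complex.I * α) ^ j * mode f α z) (pencil σ) := by
  induction j with
  | zero => intro z _; simp
  | succ j ih =>
    intro z hz
    rw [Function.iterate_succ_apply', (hf.dx_iter j).mode_dx α hz]
    simp only [ih hz]
    ring

/-- Mixed conormal derivatives of a nice field, mode by mode. -/
theorem NiceField.mode_dx_psiDz {σ : ℝ} {f : Torus → ℂ → ℂ} (hf : NiceField σ f) (j l : ℕ) (α : ℤ) :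
    EqOn (mode (StokesSlip.dx^[j] (StokesSlip.psiDz^[l] f)) α)
      (fun z => (Complex.I * α) ^ j * pd^[l] (mode f α) z) (pencil σ) := by
  intro z hz
  rw [(hf.psiDz_iter l).mode_dx_iter j α hz]
  simp only
  rw [mode_psiDz_iter hf.analytic α l hz]

/-! ### The reflected datum -/

theorem intervalIntegrable_indicator_of_integrableOn {w : ℝ → ℂ}
    (h : ∀ b, IntegrableOn w (Ioc 0 b)) (a b : ℝ) :
    IntervalIntegrable ((Ioi 0).indicator w) volume a b := by
  have h1 : IntegrableOn ((Ioi 0).indicator w) (Iic (max a b)) := by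
    rw [IntegrableOn, integrable_indicator_iff measurableSet_Ioi, IntegrableOn,
      Measure.restrict_restrict measurableSet_Ioi]
    exact h _
  rw [intervalIntegrable_iff]
  exact h1.mono_set fun x hx => hx.2

/-- The primitive vanishing at `0` of a function continuous on `(0,∞)` and integrable at `0`. -/
theorem intervalIntegral_primitive {w : ℝ → ℂ} (h : ∀ b, IntegrableOn w (Ioc 0 b))
    (hc : ContinuousOn w (Ioi 0)) :
    ContinuousOn (fun r => ∫ y in (0 : ℝ)..r, w y) (Ici 0) ∧
      ∀ r, 0 < r → HasDerivAt (fun r => ∫ y in (0 : ℝ)..r, w y) (w r) r := by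
  have hi := intervalIntegrable_indicator_of_integrableOn h
  have heq : ∀ r, 0 ≤ r → ∫ y in (0 : ℝ)..r, w y = ∫ y in (0 : ℝ)..r, (Ioi 0).indicator w y := by
    intro r hr
    refine intervalIntegral.integral_congr_ae (Eventually.of_forall fun y hy => ?_)
    rw [uIoc_of_le hr] at hy
    rw [indicator_of_mem (show y ∈ Ioi (0 : ℝ) from hy.1)]
  constructor
  · exact (intervalIntegral.continuous_primitive hi 0).continuousOn.congr heq
  · intro r hr
    have hmem : Ioi (0 : ℝ) ∈ 𝓝 r := Ioi_mem_nhds hr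
    have hwi : IntervalIntegrable w volume 0 r := by
      rw [intervalIntegrable_iff, uIoc_of_le hr.le]; exact h r
    exact intervalIntegral.integral_hasDerivAt_right hwi
      ⟨Ioi 0, hmem, hc.aestronglyMeasurable measurableSet_Ioi⟩ (hc.continuousAt hmem)

/-- `∫_r^∞ e^{-a(y-r)} u(y) dy`. -/
noncomputable def tail (a : ℝ) (u : ℝ → ℂ) (r : ℝ) : ℂ :=
  ∫ y in Ioi r, (Real.exp (-a * (y - r)) : ℂ) * u y

/-- The solution `m` of `m' = -κ m - (u - a g)`, `m(0) = g(0)`, with `g = tail a u` and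
`κ = 1/ν + a`. For an extension `F` of `u` and `g₋(p) = ∫_0^∞ e^{-ay} F(-p + y) dy`, one has
`g₋' = F(-p) - a g₋`, and oddness of `ν F + ∫ e^{-ay} F(· + y) dy` means
`ν F(-p) + g₋(p) = -(ν u(p) + g(p))`. Elimination of `F(-p)` gives this equation for
`m = (g + g₋) / 2`. -/
noncomputable def mcor (ν a : ℝ) (u : ℝ → ℂ) (p : ℝ) : ℂ :=
  (Real.exp (-(1 / ν + a) * p) : ℂ) * (tail a u 0 -
    ∫ r in (0 : ℝ)..p, (Real.exp ((1 / ν + a) * r) : ℂ) * (u r - a * tail a u r))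

/-- The reflection of `u` across the wall dictated by the slip condition: the value at `-p` of the
extension. -/
noncomputable def reflDatum (ν a : ℝ) (u : ℝ → ℂ) (p : ℝ) : ℂ := -u p - (2 / ν : ℝ) * mcor ν a u p

/-- The extension of `u` to the whole line by its reflection. -/
noncomputable def extDatum (ν a : ℝ) (u : ℝ → ℂ) (x : ℝ) : ℂ :=
  if 0 < x then u x else reflDatum ν a u (-x)

section
variable {ν a : ℝ} {u : ℝ → ℂ}

theorem exp_neg_mul_le_one (ha : 0 ≤ a) {x : ℝ} (hx : 0 ≤ x) : Real.exp (-a * x) ≤ 1 := by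
  rw [Real.exp_le_one_iff]; nlinarith

theorem integrableOn_exp_mul (ha : 0 ≤ a) (hu : IntegrableOn u (Ioi 0)) {r : ℝ} (hr : 0 ≤ r) :
    IntegrableOn (fun y => (Real.exp (-a * (y - r)) : ℂ) * u y) (Ioi r) := by
  refine (hu.mono_set (Ioi_subset_Ioi hr)).bdd_mul (c := 1)
    (Continuous.aestronglyMeasurable (by fun_prop)) ?_
  refine (ae_restrict_iff' measurableSet_Ioi).2 (Eventually.of_forall fun y hy => ?_)
  rw [Complex.norm_real, Real.norm_of_nonneg (Real.exp_pos _).le]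
  exact exp_neg_mul_le_one ha (sub_nonneg.2 (le_of_lt hy))

theorem tail_eq (ha : 0 ≤ a) (hu : IntegrableOn u (Ioi 0)) {r : ℝ} (hr : 0 ≤ r) :
    tail a u r = (Real.exp (a * r) : ℂ) *
      (tail a u 0 - ∫ y in (0 : ℝ)..r, (Real.exp (-a * y) : ℂ) * u y) := by
  have h0 : IntegrableOn (fun y => (Real.exp (-a * y) : ℂ) * u y) (Ioi 0) := by
    simpa using integrableOn_exp_mul ha hu le_rfl
  have h1 : tail a u 0 = ∫ y in Ioi (0 : ℝ), (Real.exp (-a * y) : ℂ) * u y := by simp [tail]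
  rw [h1, ← intervalIntegral.integral_Ioi_sub_Ioi h0 hr, sub_sub_cancel, ← integral_const_mul, tail]
  congr 1; ext y
  rw [← mul_assoc, ← Complex.ofReal_mul, ← Real.exp_add]
  congr 3; ring

theorem tail_primitive (ha : 0 ≤ a) (hu : IntegrableOn u (Ioi 0)) (hc : ContinuousOn u (Ioi 0)) :
    ContinuousOn (tail a u) (Ici 0) ∧
      ∀ r, 0 < r → HasDerivAt (tail a u) (a * tail a u r - u r) r := by
  have h0 : IntegrableOn (fun y => (Real.exp (-a * y) : ℂ) * u y) (Ioi 0) := by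
    simpa using integrableOn_exp_mul ha hu le_rfl
  obtain ⟨h1, h2⟩ := intervalIntegral_primitive (fun b => h0.mono_set Ioc_subset_Ioi_self)
    (ContinuousOn.mul (by fun_prop) hc)
  constructor
  · refine ContinuousOn.congr (f := fun r => (Real.exp (a * r) : ℂ) *
      (tail a u 0 - ∫ y in (0 : ℝ)..r, (Real.exp (-a * y) : ℂ) * u y)) ?_
      fun r hr => tail_eq ha hu hr
    exact ContinuousOn.mul (by fun_prop) (continuousOn_const.sub h1)
  · intro r hr
    have hE : HasDerivAt (fun r : ℝ => (Real.exp (a * r) : ℂ)) ((Real.exp (a * r) : ℂ) * a) r := by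
      have := (((hasDerivAt_id r).const_mul a).exp).ofReal_comp
      simpa using this
    have h3 := hE.mul ((h2 r hr).const_sub (tail a u 0))
    have h4 := h3.congr_of_eventuallyEq (f₁ := tail a u) (by
      filter_upwards [Ioi_mem_nhds hr] with r hr using tail_eq ha hu (le_of_lt hr))
    refine h4.congr_deriv ?_
    rw [tail_eq ha hu hr.le]
    have : (Real.exp (a * r) : ℂ) * (Real.exp (-a * r) : ℂ) = 1 := by
      rw [← Complex.ofReal_mul, ← Real.exp_add]; simp
    linear_combination (-u r) * this

theorem norm_tail_le (ha : 0 ≤ a) (hu : IntegrableOn u (Ioi 0)) {r : ℝ} (hr : 0 ≤ r) :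
    ‖tail a u r‖ ≤ ∫ y in Ioi (0 : ℝ), ‖u y‖ := by
  calc ‖tail a u r‖ ≤ ∫ y in Ioi r, ‖(Real.exp (-a * (y - r)) : ℂ) * u y‖ :=
        norm_integral_le_integral_norm _
    _ ≤ ∫ y in Ioi r, ‖u y‖ := by
        refine setIntegral_mono_on (integrableOn_exp_mul ha hu hr).norm
          (hu.mono_set (Ioi_subset_Ioi hr)).norm measurableSet_Ioi fun y hy => ?_
        rw [norm_mul, Complex.norm_real, Real.norm_of_nonneg (Real.exp_pos _).le]
        exact mul_le_of_le_one_left (norm_nonneg _)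
          (exp_neg_mul_le_one ha (sub_nonneg.2 (le_of_lt hy)))
    _ ≤ ∫ y in Ioi (0 : ℝ), ‖u y‖ :=
        setIntegral_mono_set hu.norm (Eventually.of_forall fun _ => norm_nonneg _)
          (Ioi_subset_Ioi hr).eventuallyLE

theorem integrableOn_source (ha : 0 ≤ a) (hu : IntegrableOn u (Ioi 0)) (hc : ContinuousOn u (Ioi 0))
    (b : ℝ) : IntegrableOn (fun r => u r - a * tail a u r) (Ioc 0 b) := by
  refine (hu.mono_set Ioc_subset_Ioi_self).sub (Integrable.const_mul ?_ _)
  exact (((tail_primitive ha hu hc).1.mono Icc_subset_Ici_self).integrableOn_Icc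
    (b := b)).mono_set Ioc_subset_Icc_self

theorem mcor_primitive (ha : 0 ≤ a) (hu : IntegrableOn u (Ioi 0)) (hc : ContinuousOn u (Ioi 0)) :
    ContinuousOn (mcor ν a u) (Ici 0) ∧ ∀ p, 0 < p → HasDerivAt (mcor ν a u)
      (-(1 / ν + a : ℝ) * mcor ν a u p - (u p - a * tail a u p)) p := by
  obtain ⟨t1, t2⟩ := tail_primitive ha hu hc
  obtain ⟨h1, h2⟩ := intervalIntegral_primitive
    (w := fun r => (Real.exp ((1 / ν + a) * r) : ℂ) * (u r - a * tail a u r))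
    (fun b => by
      have h3 := integrableOn_source ha hu hc b
      rw [← integrableOn_Icc_iff_integrableOn_Ioc] at h3 ⊢
      exact IntegrableOn.continuousOn_mul (by fun_prop) h3 isCompact_Icc)
    (ContinuousOn.mul (by fun_prop) (hc.sub (continuousOn_const.mul
      (t1.mono Ioi_subset_Ici_self))))
  constructor
  · exact ContinuousOn.mul (by fun_prop) (continuousOn_const.sub h1)
  · intro r hr
    have hE : HasDerivAt (fun r : ℝ => (Real.exp (-(1 / ν + a) * r) : ℂ))
        ((Real.exp (-(1 / ν + a) * r) : ℂ) * (-(1 / ν + a) : ℝ)) r := by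
      have := (((hasDerivAt_id r).const_mul (-(1 / ν + a))).exp).ofReal_comp
      simpa using this
    have h3 := hE.mul ((h2 r hr).const_sub (tail a u 0))
    refine HasDerivAt.congr_deriv (f := mcor ν a u) h3 ?_
    rw [mcor]
    have : (Real.exp (-(1 / ν + a) * r) : ℂ) * (Real.exp ((1 / ν + a) * r) : ℂ) = 1 := by
      rw [← Complex.ofReal_mul, ← Real.exp_add, neg_mul, neg_add_cancel, Real.exp_zero,
        Complex.ofReal_one]
    push_cast at this ⊢
    linear_combination (-(u r - a * tail a u r)) * this

theorem mcor_zero : mcor ν a u 0 = tail a u 0 := by simp [mcor]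

theorem continuousOn_reflDatum (ha : 0 ≤ a) (hu : IntegrableOn u (Ioi 0))
    (hc : ContinuousOn u (Ioi 0)) : ContinuousOn (reflDatum ν a u) (Ioi 0) :=
  hc.neg.sub (continuousOn_const.mul ((mcor_primitive ha hu hc).1.mono Ioi_subset_Ici_self))

/-- The density of the exponential distribution, with the convention that it vanishes for `a = 0`. -/
noncomputable def expDensity (a x : ℝ) : ℝ≥0∞ :=
  if 0 ≤ x then ENNReal.ofReal (a * Real.exp (-(a * x))) else 0

theorem measurable_expDensity (a : ℝ) : Measurable (expDensity a) := by
  unfold expDensity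
  exact Measurable.ite measurableSet_Ici (by fun_prop) measurable_const

theorem lintegral_expDensity_le (ha : 0 ≤ a) : ∫⁻ x, expDensity a x ≤ 1 := by
  rcases ha.eq_or_lt with h | h
  · subst h
    have : ∀ x, expDensity 0 x = 0 := fun x => by simp [expDensity]
    simp [this]
  · rw [← ProbabilityTheory.lintegral_exponentialPDF_eq_one h]
    refine lintegral_mono fun x => ?_
    rw [ProbabilityTheory.exponentialPDF_eq, expDensity]
    split_ifs <;> simp

theorem lintegral_conv_le {Φ w : ℝ → ℝ≥0∞} (hΦ : Measurable Φ) (h1 : ∫⁻ x, Φ x ≤ 1)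
    (hw : AEMeasurable w (volume.restrict (Ioi 0))) :
    ∫⁻ p in Ioi (0 : ℝ), ∫⁻ r in Ioi (0 : ℝ), Φ (p - r) * w r ≤ ∫⁻ r in Ioi (0 : ℝ), w r := by
  calc ∫⁻ p in Ioi (0 : ℝ), ∫⁻ r in Ioi (0 : ℝ), Φ (p - r) * w r
      ≤ ∫⁻ p, ∫⁻ r in Ioi (0 : ℝ), Φ (p - r) * w r := setLIntegral_le_lintegral _ _
    _ = ∫⁻ r in Ioi (0 : ℝ), ∫⁻ p, Φ (p - r) * w r := by
        refine lintegral_lintegral_swap (f := fun p r => Φ (p - r) * w r) ?_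
        exact (hΦ.comp (measurable_fst.sub measurable_snd)).aemeasurable.mul
          (hw.comp_quasiMeasurePreserving Measure.quasiMeasurePreserving_snd)
    _ ≤ ∫⁻ r in Ioi (0 : ℝ), w r := by
        refine lintegral_mono fun r => ?_
        have hm : Measurable fun p => Φ (p - r) := hΦ.comp (measurable_id.sub_const r)
        rw [lintegral_mul_const _ hm, lintegral_sub_right_eq_self Φ r]
        exact mul_le_of_le_one_left bot_le h1

theorem aemeasurable_enorm_Ioi {w : ℝ → ℂ} (hc : ContinuousOn w (Ioi 0)) :
    AEMeasurable (fun r => ‖w r‖ₑ) (volume.restrict (Ioi 0)) :=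
  (hc.aestronglyMeasurable measurableSet_Ioi).enorm

theorem lintegral_enorm_mul_tail_le (ha : 0 ≤ a) (hc : ContinuousOn u (Ioi 0)) :
    ∫⁻ r in Ioi (0 : ℝ), ‖a * tail a u r‖ₑ ≤ ∫⁻ r in Ioi (0 : ℝ), ‖u r‖ₑ := by
  refine le_trans ?_ (lintegral_conv_le (Φ := fun x => expDensity a (-x))
    ((measurable_expDensity a).comp measurable_neg) ?_ (aemeasurable_enorm_Ioi hc))
  · refine setLIntegral_mono' measurableSet_Ioi fun r hr => ?_
    have hr : 0 < r := hr
    rw [tail, ← integral_const_mul]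
    refine (enorm_integral_le_lintegral_enorm _).trans ?_
    have hs : Ioi r ⊆ Ioi (0 : ℝ) := Ioi_subset_Ioi hr.le
    refine le_trans (setLIntegral_mono' measurableSet_Ioi fun y hy => ?_) (lintegral_mono_set hs)
    have hy : r < y := hy
    rw [expDensity, if_pos (by linarith), ← mul_assoc, enorm_mul, ← Complex.ofReal_mul]
    refine mul_le_mul_left (le_of_eq ?_) _
    rw [← ofReal_norm, Complex.norm_real, Real.norm_of_nonneg (by positivity)]
    congr 3; ring
  · rw [lintegral_neg_eq_self]; exact lintegral_expDensity_le ha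

theorem lintegral_enorm_source_le (ha : 0 ≤ a) (hc : ContinuousOn u (Ioi 0)) :
    ∫⁻ r in Ioi (0 : ℝ), ‖u r - a * tail a u r‖ₑ ≤ 2 * ∫⁻ r in Ioi (0 : ℝ), ‖u r‖ₑ := by
  calc _ ≤ ∫⁻ r in Ioi (0 : ℝ), (‖u r‖ₑ + ‖a * tail a u r‖ₑ) :=
        lintegral_mono fun r => enorm_sub_le
    _ = (∫⁻ r in Ioi (0 : ℝ), ‖u r‖ₑ) + ∫⁻ r in Ioi (0 : ℝ), ‖a * tail a u r‖ₑ :=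
        lintegral_add_left' (aemeasurable_enorm_Ioi hc) _
    _ ≤ _ := by rw [two_mul]; exact add_le_add le_rfl (lintegral_enorm_mul_tail_le ha hc)

theorem enorm_tail_zero_le (ha : 0 ≤ a) : ‖tail a u 0‖ₑ ≤ ∫⁻ r in Ioi (0 : ℝ), ‖u r‖ₑ := by
  refine (enorm_integral_le_lintegral_enorm _).trans
    (setLIntegral_mono' measurableSet_Ioi fun y hy => ?_)
  rw [enorm_mul]
  refine mul_le_of_le_one_left bot_le ?_
  rw [← ofReal_norm, Complex.norm_real, Real.norm_of_nonneg (Real.exp_pos _).le, sub_zero]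
  exact ENNReal.ofReal_le_one.2 (exp_neg_mul_le_one ha (le_of_lt hy))

theorem lintegral_enorm_mcor_le (hν : 0 < ν) (ha : 0 ≤ a) (hu : IntegrableOn u (Ioi 0))
    (hc : ContinuousOn u (Ioi 0)) :
    ∫⁻ p in Ioi (0 : ℝ), ‖((1 / ν + a : ℝ) : ℂ) * mcor ν a u p‖ₑ ≤
      3 * ∫⁻ r in Ioi (0 : ℝ), ‖u r‖ₑ := by
  set κ := 1 / ν + a with hκ
  have hκ0 : 0 ≤ κ := by positivity
  have hkc : ContinuousOn (fun r => u r - a * tail a u r) (Ioi 0) :=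
    hc.sub (continuousOn_const.mul ((tail_primitive ha hu hc).1.mono Ioi_subset_Ici_self))
  have hpt : ∀ p ∈ Ioi (0 : ℝ), ‖(κ : ℂ) * mcor ν a u p‖ₑ ≤ expDensity κ p * ‖tail a u 0‖ₑ +
      ∫⁻ r in Ioi (0 : ℝ), expDensity κ (p - r) * ‖u r - a * tail a u r‖ₑ := by
    intro p hp
    have hp : 0 < p := hp
    have h1 : (κ : ℂ) * mcor ν a u p = ((κ * Real.exp (-(κ * p)) : ℝ) : ℂ) * tail a u 0 -
        ∫ r in Ioc 0 p, ((κ * Real.exp (-(κ * (p - r))) : ℝ) : ℂ) * (u r - a * tail a u r) := by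
      rw [mcor, mul_sub, mul_sub, ← hκ, intervalIntegral.integral_of_le hp.le, ← integral_const_mul,
        ← integral_const_mul]
      congr 1
      · rw [Complex.ofReal_mul, mul_assoc, neg_mul]
      · congr 1; ext r
        rw [show -(κ * (p - r)) = -κ * p + κ * r by ring, Real.exp_add]
        push_cast; ring
    rw [h1]
    refine enorm_sub_le.trans (add_le_add ?_ ?_)
    · rw [enorm_mul, expDensity, if_pos hp.le, ← ofReal_norm, Complex.norm_real,
        Real.norm_of_nonneg (by positivity)]
    · refine (enorm_integral_le_lintegral_enorm _).trans ?_
      refine le_trans (setLIntegral_mono' measurableSet_Ioc fun r hr => ?_)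
        (lintegral_mono_set Ioc_subset_Ioi_self)
      rw [enorm_mul, expDensity, if_pos (sub_nonneg.2 hr.2), ← ofReal_norm, Complex.norm_real,
        Real.norm_of_nonneg (by positivity)]
  refine (setLIntegral_mono' measurableSet_Ioi hpt).trans ?_
  rw [lintegral_add_left ((measurable_expDensity κ).mul_const _)]
  calc _ ≤ (∫⁻ r in Ioi (0 : ℝ), ‖u r‖ₑ) + 2 * ∫⁻ r in Ioi (0 : ℝ), ‖u r‖ₑ := by
        refine add_le_add ?_ ?_
        · rw [lintegral_mul_const _ (measurable_expDensity κ)]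
          calc _ ≤ 1 * ‖tail a u 0‖ₑ := by
                gcongr
                exact (setLIntegral_le_lintegral _ _).trans (lintegral_expDensity_le hκ0)
            _ ≤ _ := by rw [one_mul]; exact enorm_tail_zero_le ha
        · exact (lintegral_conv_le (measurable_expDensity κ) (lintegral_expDensity_le hκ0)
            (aemeasurable_enorm_Ioi hkc)).trans (lintegral_enorm_source_le ha hc)
    _ = _ := by ring

/-- The reflection is bounded on `L¹`, uniformly in the viscosity and the frequency. -/
theorem lintegral_enorm_reflDatum_le (hν : 0 < ν) (ha : 0 ≤ a) (hu : IntegrableOn u (Ioi 0))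
    (hc : ContinuousOn u (Ioi 0)) :
    ∫⁻ p in Ioi (0 : ℝ), ‖reflDatum ν a u p‖ₑ ≤ 7 * ∫⁻ r in Ioi (0 : ℝ), ‖u r‖ₑ := by
  have hpt : ∀ p, ‖reflDatum ν a u p‖ₑ ≤ ‖u p‖ₑ + 2 * ‖((1 / ν + a : ℝ) : ℂ) * mcor ν a u p‖ₑ := by
    intro p
    refine enorm_sub_le.trans (add_le_add (by rw [enorm_neg]) ?_)
    rw [enorm_mul, enorm_mul, ← mul_assoc]
    refine mul_le_mul_left ?_ _
    rw [← ofReal_norm, ← ofReal_norm, Complex.norm_real, Complex.norm_real,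
      Real.norm_of_nonneg (by positivity), Real.norm_of_nonneg (by positivity),
      show (2 : ℝ≥0∞) = ENNReal.ofReal 2 by simp, ← ENNReal.ofReal_mul (by norm_num)]
    refine ENNReal.ofReal_le_ofReal ?_
    rw [mul_add, mul_one_div]
    linarith
  calc _ ≤ ∫⁻ p in Ioi (0 : ℝ), (‖u p‖ₑ + 2 * ‖((1 / ν + a : ℝ) : ℂ) * mcor ν a u p‖ₑ) :=
        lintegral_mono hpt
    _ = (∫⁻ r in Ioi (0 : ℝ), ‖u r‖ₑ) +
        2 * ∫⁻ p in Ioi (0 : ℝ), ‖((1 / ν + a : ℝ) : ℂ) * mcor ν a u p‖ₑ := by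
        rw [lintegral_add_left' (aemeasurable_enorm_Ioi hc), lintegral_const_mul' _ _ (by simp)]
    _ ≤ (∫⁻ r in Ioi (0 : ℝ), ‖u r‖ₑ) + 2 * (3 * ∫⁻ r in Ioi (0 : ℝ), ‖u r‖ₑ) := by
        gcongr; exact lintegral_enorm_mcor_le hν ha hu hc
    _ = _ := by ring

theorem integrableOn_reflDatum (hν : 0 < ν) (ha : 0 ≤ a) (hu : IntegrableOn u (Ioi 0))
    (hc : ContinuousOn u (Ioi 0)) : IntegrableOn (reflDatum ν a u) (Ioi 0) :=
  ⟨(continuousOn_reflDatum ha hu hc).aestronglyMeasurable measurableSet_Ioi,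
    (lintegral_enorm_reflDatum_le hν ha hu hc).trans_lt (ENNReal.mul_lt_top (by simp) hu.2)⟩

theorem extDatum_of_pos {x : ℝ} (hx : 0 < x) : extDatum ν a u x = u x := if_pos hx

theorem extDatum_neg {x : ℝ} (hx : 0 < x) : extDatum ν a u (-x) = reflDatum ν a u x := by
  rw [extDatum, if_neg (by linarith), neg_neg]

theorem integrableOn_extDatum_Iio (hν : 0 < ν) (ha : 0 ≤ a) (hu : IntegrableOn u (Ioi 0))
    (hc : ContinuousOn u (Ioi 0)) : IntegrableOn (extDatum ν a u) (Iio 0) := by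
  have h := (integrableOn_reflDatum hν ha hu hc)
  have h2 : IntegrableOn (fun x => reflDatum ν a u (-x)) (Iio 0) := by
    exact IntegrableOn.comp_neg_Iio (c := 0) (by rw [neg_zero]; exact h)
  refine h2.congr_fun (fun x hx => ?_) measurableSet_Iio
  simp only [extDatum]
  rw [if_neg (not_lt.2 (le_of_lt hx))]

theorem integrable_extDatum (hν : 0 < ν) (ha : 0 ≤ a) (hu : IntegrableOn u (Ioi 0))
    (hc : ContinuousOn u (Ioi 0)) : Integrable (extDatum ν a u) := by
  have h1 := integrableOn_extDatum_Iio hν ha hu hc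
  have h2 : IntegrableOn (extDatum ν a u) (Ioi 0) :=
    hu.congr_fun (fun x hx => (extDatum_of_pos hx).symm) measurableSet_Ioi
  rw [← integrableOn_univ, ← Iio_union_Ici (a := (0 : ℝ))]
  exact h1.union ((integrableOn_Ici_iff_integrableOn_Ioi (by simp)).2 h2)

/-- The contribution of the reflected values to `∫_0^∞ e^{-ay} F(-p + y) dy`: the integrand is the
derivative of `e^{ar} (2 m - g)`, with `m = mcor ν a u` and `g = tail a u`. -/
theorem integral_exp_mul_reflDatum (hν : 0 < ν) (ha : 0 ≤ a) (hu : IntegrableOn u (Ioi 0))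
    (hc : ContinuousOn u (Ioi 0)) {p : ℝ} (hp : 0 < p) :
    ∫ r in (0 : ℝ)..p, (Real.exp (a * r) : ℂ) * reflDatum ν a u r =
      (Real.exp (a * p) : ℂ) * (2 * mcor ν a u p - tail a u p) - tail a u 0 := by
  obtain ⟨t1, t2⟩ := tail_primitive ha hu hc
  obtain ⟨m1, m2⟩ := mcor_primitive (ν := ν) ha hu hc
  have hνc : (ν : ℂ) ≠ 0 := by exact_mod_cast hν.ne'
  have h := intervalIntegral.integral_eq_sub_of_hasDerivAt_of_le (a := 0) (b := p) hp.le
    (f := fun r => (Real.exp (a * r) : ℂ) * (2 * mcor ν a u r - tail a u r))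
    (f' := fun r => (Real.exp (a * r) : ℂ) * reflDatum ν a u r) ?_ ?_ ?_
  · rw [h]; simp [mcor_zero]; ring
  · exact ContinuousOn.mul (by fun_prop) ((continuousOn_const.mul
      (m1.mono Icc_subset_Ici_self)).sub (t1.mono Icc_subset_Ici_self))
  · intro r hr
    have hE : HasDerivAt (fun r : ℝ => (Real.exp (a * r) : ℂ)) ((Real.exp (a * r) : ℂ) * a) r := by
      have := (((hasDerivAt_id r).const_mul a).exp).ofReal_comp
      simpa using this
    have h3 := hE.mul (((m2 r hr.1).const_mul 2).sub (t2 r hr.1))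
    refine h3.congr_deriv ?_
    simp only [reflDatum, Pi.sub_apply]
    push_cast
    field_simp
    ring
  · rw [intervalIntegrable_iff_integrableOn_Icc_of_le hp.le]
    refine IntegrableOn.continuousOn_mul (by fun_prop) ?_ isCompact_Icc
    rw [integrableOn_Icc_iff_integrableOn_Ioc]
    exact (integrableOn_reflDatum hν ha hu hc).mono_set Ioc_subset_Ioi_self

theorem integral_exp_mul_extDatum_pos {v : ℝ} (hv : 0 < v) :
    ∫ y in Ioi (0 : ℝ), (Real.exp (-a * y) : ℂ) * extDatum ν a u (v + y) = tail a u v := by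
  have h := (measurePreserving_add_left (volume : Measure ℝ) v).setIntegral_preimage_emb
    (measurableEmbedding_addLeft v) (fun y => (Real.exp (-a * (y - v)) : ℂ) * u y) (Ioi v)
  have hpre : (fun y => v + y) ⁻¹' Ioi v = Ioi 0 := by ext y; simp
  rw [hpre] at h
  rw [tail, ← h]
  refine setIntegral_congr_fun measurableSet_Ioi fun y hy => ?_
  have hy : 0 < y := hy
  simp only [extDatum_of_pos (show 0 < v + y by linarith), add_sub_cancel_left]

theorem integral_exp_mul_extDatum_neg (hν : 0 < ν) (ha : 0 ≤ a) (hu : IntegrableOn u (Ioi 0))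
    (hc : ContinuousOn u (Ioi 0)) {p : ℝ} (hp : 0 < p) :
    ∫ y in Ioi (0 : ℝ), (Real.exp (-a * y) : ℂ) * extDatum ν a u (-p + y) =
      2 * mcor ν a u p - tail a u p := by
  have hint : IntegrableOn (fun y => (Real.exp (-a * y) : ℂ) * extDatum ν a u (-p + y))
      (Ioi 0) := by
    refine ((integrable_extDatum hν ha hu hc).comp_add_left (-p)).integrableOn.bdd_mul (c := 1)
      (Continuous.aestronglyMeasurable (by fun_prop)) ?_
    refine (ae_restrict_iff' measurableSet_Ioi).2 (Eventually.of_forall fun y hy => ?_)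
    rw [Complex.norm_real, Real.norm_of_nonneg (Real.exp_pos _).le]
    exact exp_neg_mul_le_one ha (le_of_lt hy)
  rw [← intervalIntegral.integral_interval_add_Ioi hint (hint.mono_set (Ioi_subset_Ioi hp.le))]
  have h1 : ∫ y in (0 : ℝ)..p, (Real.exp (-a * y) : ℂ) * extDatum ν a u (-p + y) =
      (Real.exp (-a * p) : ℂ) * ∫ r in (0 : ℝ)..p, (Real.exp (a * r) : ℂ) * reflDatum ν a u r := by
    have h2 := intervalIntegral.integral_comp_sub_left (a := 0) (b := p)
      (fun r => (Real.exp (-a * (p - r)) : ℂ) * reflDatum ν a u r) p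
    simp only [sub_sub_cancel, sub_zero, sub_self] at h2
    rw [← intervalIntegral.integral_const_mul]
    calc _ = ∫ y in (0 : ℝ)..p, (Real.exp (-a * y) : ℂ) * reflDatum ν a u (p - y) := by
          refine intervalIntegral.integral_congr_ae (Eventually.of_forall fun y hy => ?_)
          rw [uIoc_of_le hp.le] at hy
          rw [extDatum, if_neg (by linarith [hy.2])]
          congr 2; ring
      _ = _ := h2
      _ = _ := by
          refine intervalIntegral.integral_congr fun r _ => ?_
          rw [← mul_assoc, ← Complex.ofReal_mul, ← Real.exp_add]
          congr 3; ring
  have h3 : ∫ y in Ioi p, (Real.exp (-a * y) : ℂ) * extDatum ν a u (-p + y) =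
      (Real.exp (-a * p) : ℂ) * tail a u 0 := by
    have h := (measurePreserving_add_left (volume : Measure ℝ) (-p)).setIntegral_preimage_emb
      (measurableEmbedding_addLeft (-p)) (fun y => (Real.exp (-a * (y + p)) : ℂ) * u y) (Ioi 0)
    have hpre : (fun y => -p + y) ⁻¹' Ioi 0 = Ioi p := by ext y; simp
    rw [hpre] at h
    rw [tail, ← integral_const_mul]
    calc _ = _ := ?_
      _ = _ := h
      _ = _ := ?_
    · refine setIntegral_congr_fun measurableSet_Ioi fun y hy => ?_
      have hy : p < y := hy
      simp only [extDatum_of_pos (show 0 < -p + y by linarith), neg_add_cancel_comm]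
    · congr 1; ext y
      rw [← mul_assoc, ← Complex.ofReal_mul, ← Real.exp_add]
      congr 3; ring
  rw [h1, h3, integral_exp_mul_reflDatum hν ha hu hc hp]
  have : (Real.exp (-a * p) : ℂ) * (Real.exp (a * p) : ℂ) = 1 := by
    rw [← Complex.ofReal_mul, ← Real.exp_add]; simp
  linear_combination (2 * mcor ν a u p - tail a u p) * this

/-- The combination `ν F + ∫ e^{-ay} F(· + y) dy` formed with the extended datum `F` is odd. This is
what makes the heat evolution of `F` satisfy the slip condition at every later time. -/
theorem slip_combination_odd (hν : 0 < ν) (ha : 0 ≤ a) (hu : IntegrableOn u (Ioi 0))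
    (hc : ContinuousOn u (Ioi 0)) {p : ℝ} (hp : p ≠ 0) :
    (ν * extDatum ν a u (-p) +
        ∫ y in Ioi (0 : ℝ), (Real.exp (-a * y) : ℂ) * extDatum ν a u (-p + y)) =
      -(ν * extDatum ν a u p +
        ∫ y in Ioi (0 : ℝ), (Real.exp (-a * y) : ℂ) * extDatum ν a u (p + y)) := by
  have hνc : (ν : ℂ) ≠ 0 := by exact_mod_cast hν.ne'
  have key : ∀ p, 0 < p → (ν * extDatum ν a u (-p) +
        ∫ y in Ioi (0 : ℝ), (Real.exp (-a * y) : ℂ) * extDatum ν a u (-p + y)) =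
      -(ν * extDatum ν a u p +
        ∫ y in Ioi (0 : ℝ), (Real.exp (-a * y) : ℂ) * extDatum ν a u (p + y)) := by
    intro p hp
    rw [integral_exp_mul_extDatum_neg hν ha hu hc hp, integral_exp_mul_extDatum_pos hp,
      extDatum_of_pos hp, extDatum_neg hp, reflDatum]
    push_cast
    field_simp
    ring
  rcases lt_or_gt_of_ne hp with h | h
  · have := key (-p) (by linarith)
    rw [neg_neg] at this
    rw [this, neg_neg]
  · exact key p h

end

/-! ### Heat evolution on the line -/

/-- Convolution of `F` on the real line with the kernel of prefactor `q` at scale `s`, evaluated at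
complex points. -/
noncomputable def gconv (q : ℂ[X]) (s : ℝ) (F : ℝ → ℂ) (z : ℂ) : ℂ := ∫ x : ℝ, gker q s (z - x) * F x

theorem continuous_gker (q : ℂ[X]) (s : ℝ) : Continuous (gker q s) :=
  (differentiable_gker q s).continuous

/-- A bound on the kernels that is uniform for scales and imaginary parts in compact sets. -/
theorem exists_norm_gker_le_unif (q : ℂ[X]) {s₀ M : ℝ} (hs₀ : 0 < s₀) :
    ∃ B : ℝ, 0 < B ∧ ∀ s, s₀ ≤ s → ∀ z : ℂ, |z.im| ≤ M → ‖gker q s z‖ ≤ B := by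
  obtain ⟨C, hC, h⟩ := exists_norm_gker_le_genv_strip q
  refine ⟨C * Real.exp ((M / s₀) ^ 2) * s₀⁻¹, by positivity, fun s hs z hz => ?_⟩
  have hs0 : 0 < s := hs₀.trans_le hs
  refine (h s hs0 z).trans ?_
  have h1 : (z.im / s) ^ 2 ≤ (M / s₀) ^ 2 := by
    rw [sq_le_sq, abs_div, abs_div, abs_of_pos hs0, abs_of_pos hs₀]
    have : |z.im| ≤ |M| := hz.trans (le_abs_self M)
    gcongr
  have h2 : genv (1 / 8) s z.re ≤ s₀⁻¹ :=
    (genv_le _ (by norm_num) hs0 _).trans (inv_anti₀ hs₀ hs)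
  have := genv_nonneg (1 / 8) hs0 z.re
  gcongr

theorem integrable_gker_mul (q : ℂ[X]) {s : ℝ} (hs : 0 < s) {F : ℝ → ℂ} {μ : Measure ℝ}
    (hF : Integrable F μ) (z : ℂ) : Integrable (fun x : ℝ => gker q s (z - x) * F x) μ := by
  obtain ⟨B, hB, h⟩ := exists_norm_gker_le_unif q (M := |z.im|) hs
  refine hF.bdd_mul (c := B) ?_ (Eventually.of_forall fun x => h s le_rfl _ (by simp))
  exact ((continuous_gker q s).comp (by fun_prop)).aestronglyMeasurable

theorem aestronglyMeasurable_gker_mul (q : ℂ[X]) (s : ℝ) {F : ℝ → ℂ} {μ : Measure ℝ}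
    (hF : AEStronglyMeasurable F μ) (z : ℂ) :
    AEStronglyMeasurable (fun x : ℝ => gker q s (z - x) * F x) μ :=
  ((continuous_gker q s).comp (by fun_prop : Continuous fun x : ℝ => z - x)).aestronglyMeasurable.mul
    hF

/-- Differentiation in `z` of the integral of a kernel against an integrable function. -/
theorem hasDerivAt_integral_gker (q : ℂ[X]) {s : ℝ} (hs : 0 < s) {F : ℝ → ℂ} {μ : Measure ℝ}
    (hF : Integrable F μ) (z : ℂ) :
    HasDerivAt (fun z : ℂ => ∫ x : ℝ, gker q s (z - x) * F x ∂μ)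
      ((s : ℂ)⁻¹ * ∫ x : ℝ, gker (dq q) s (z - x) * F x ∂μ) z := by
  obtain ⟨B, hB, h⟩ := exists_norm_gker_le_unif (dq q) (M := |z.im| + 1) hs
  rw [← integral_const_mul]
  refine (hasDerivAt_integral_of_dominated_loc_of_deriv_le (Metric.ball_mem_nhds z one_pos)
    (F' := fun z x => (s : ℂ)⁻¹ * (gker (dq q) s (z - x) * F x))
    (bound := fun x => s⁻¹ * (B * ‖F x‖))
    (Eventually.of_forall fun w => aestronglyMeasurable_gker_mul q s hF.1 w)
    (integrable_gker_mul q hs hF z)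
    ((aestronglyMeasurable_gker_mul (dq q) s hF.1 z).const_mul _) ?_
    ((hF.norm.const_mul B).const_mul s⁻¹) ?_).2
  · refine Eventually.of_forall fun x w hw => ?_
    rw [norm_mul, norm_mul, norm_inv, Complex.norm_real, Real.norm_of_nonneg hs.le]
    gcongr
    refine h s le_rfl _ ?_
    have h1 : |(w - z).im| < 1 := (Complex.abs_im_le_norm _).trans_lt (by
      rw [← dist_eq_norm]; exact hw)
    have h2 : (w - (x : ℂ)).im = (w - z).im + z.im := by simp
    rw [h2]
    exact (abs_add_le _ _).trans (by linarith)
  · refine Eventually.of_forall fun x w _ => ?_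
    have h1 : HasDerivAt (fun w : ℂ => gker q s (w - x)) ((s : ℂ)⁻¹ * gker (dq q) s (w - x)) w :=
      (hasDerivAt_gker q s (w - x)).comp_sub_const w x
    exact (h1.mul_const (F x)).congr_deriv (by ring)

theorem hasDerivAt_gconv (q : ℂ[X]) {s : ℝ} (hs : 0 < s) {F : ℝ → ℂ} (hF : Integrable F) (z : ℂ) :
    HasDerivAt (gconv q s F) ((s : ℂ)⁻¹ * gconv (dq q) s F z) z :=
  hasDerivAt_integral_gker q hs hF z

theorem hasDerivAt_gconv_scale (q : ℂ[X]) {s : ℝ} (hs : 0 < s) {F : ℝ → ℂ} (hF : Integrable F)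
    (z : ℂ) : HasDerivAt (fun s => gconv q s F z)
      (-(s : ℂ)⁻¹ * gconv (q + X * dq q) s F z) s := by
  obtain ⟨B, hB, h⟩ := exists_norm_gker_le_unif (q + X * dq q) (M := |z.im|) (half_pos hs)
  rw [gconv, ← integral_const_mul]
  have hmem : Ioi (s / 2) ∈ 𝓝 s := Ioi_mem_nhds (by linarith)
  refine (hasDerivAt_integral_of_dominated_loc_of_deriv_le hmem
    (F := fun (s x : ℝ) => gker q s (z - x) * F x)
    (F' := fun (s x : ℝ) => -(s : ℂ)⁻¹ * (gker (q + X * dq q) s (z - x) * F x))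
    (bound := fun x => (s / 2)⁻¹ * (B * ‖F x‖))
    (Eventually.of_forall fun w => aestronglyMeasurable_gker_mul q w hF.1 z)
    (integrable_gker_mul q hs hF z)
    ((aestronglyMeasurable_gker_mul _ s hF.1 z).const_mul _) ?_
    ((hF.norm.const_mul B).const_mul _) ?_).2
  · refine Eventually.of_forall fun x w hw => ?_
    have hw : s / 2 < w := hw
    have hw0 : 0 < w := (half_pos hs).trans hw
    rw [norm_mul, norm_mul, norm_neg, norm_inv, Complex.norm_real, Real.norm_of_nonneg hw0.le]
    have := h w hw.le (z - x) (by simp)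
    gcongr
  · refine Eventually.of_forall fun x w hw => ?_
    have hw : s / 2 < w := hw
    have hw0 : 0 < w := (half_pos hs).trans hw
    exact ((hasDerivAt_gker_scale q hw0.ne' (z - x)).mul_const (F x)).congr_deriv (by ring)

theorem continuousOn_gconv (q : ℂ[X]) {F : ℝ → ℂ} (hF : Integrable F) :
    ContinuousOn (fun p : ℝ × ℂ => gconv q p.1 F p.2) (Ioi 0 ×ˢ univ) := by
  rintro ⟨s, z⟩ ⟨hs, -⟩
  have hs : 0 < s := hs
  obtain ⟨B, hB, h⟩ := exists_norm_gker_le_unif q (M := |z.im| + 1) (half_pos hs)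
  have hmem : Ioi (s / 2) ×ˢ Metric.ball z 1 ∈ 𝓝 (s, z) :=
    prod_mem_nhds (Ioi_mem_nhds (by linarith)) (Metric.ball_mem_nhds z one_pos)
  refine ContinuousAt.continuousWithinAt (continuousAt_of_dominated
    (F := fun (p : ℝ × ℂ) (x : ℝ) => gker q p.1 (p.2 - x) * F x) (bound := fun x => B * ‖F x‖)
    (Eventually.of_forall fun w => aestronglyMeasurable_gker_mul q w.1 hF.1 w.2) ?_
    (hF.norm.const_mul B) (Eventually.of_forall fun x => ?_))
  · filter_upwards [hmem] with w hw
    refine Eventually.of_forall fun x => ?_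
    rw [norm_mul]
    gcongr
    refine h _ (le_of_lt hw.1) _ ?_
    have h1 : |(w.2 - z).im| < 1 := (Complex.abs_im_le_norm _).trans_lt (by
      rw [← dist_eq_norm]; exact hw.2)
    have h2 : (w.2 - (x : ℂ)).im = (w.2 - z).im + z.im := by simp
    rw [h2]
    exact (abs_add_le _ _).trans (by linarith)
  · refine ContinuousAt.mul ?_ continuousAt_const
    have h1 : ContinuousAt (fun p : ℝ × ℂ => gker q p.1 p.2) (s, z - x) :=
      (continuousOn_gker q).continuousAt
        (IsOpen.mem_nhds (isOpen_ne_fun continuous_fst continuous_const) hs.ne')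
    exact ContinuousAt.comp (g := fun p : ℝ × ℂ => gker q p.1 p.2)
      (f := fun p : ℝ × ℂ => (p.1, p.2 - (x : ℂ))) h1 (by fun_prop)

theorem exists_norm_gconv_le (q : ℂ[X]) {s₀ M : ℝ} (hs₀ : 0 < s₀) :
    ∃ B : ℝ, 0 < B ∧ ∀ s, s₀ ≤ s → ∀ z : ℂ, |z.im| ≤ M → ∀ F : ℝ → ℂ, Integrable F →
      ‖gconv q s F z‖ ≤ B * ∫ x : ℝ, ‖F x‖ := by
  obtain ⟨B, hB, h⟩ := exists_norm_gker_le_unif q (M := M) hs₀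
  refine ⟨B, hB, fun s hs z hz F hF => ?_⟩
  rw [gconv, ← integral_const_mul]
  refine norm_integral_le_of_norm_le (hF.norm.const_mul B) (Eventually.of_forall fun x => ?_)
  rw [norm_mul]
  gcongr
  exact h s hs _ (by simpa using hz)

/-! ### The heat kernel -/

/-- The prefactor of the heat kernel. -/
noncomputable def hq : ℂ[X] := C ((2 * Real.sqrt Real.pi : ℝ) : ℂ)⁻¹

theorem dq_hq : dq hq = C (-1 / 2) * X * hq := by
  simp only [dq, hq, derivative_C, zero_sub, ← neg_mul, ← C_neg]
  norm_num

/-- The heat equation `2 s ∂ₓ² G = ∂_s G` for the heat kernel at scale `s`, in terms of prefactors. -/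
theorem two_mul_dq_dq_hq : C 2 * dq (dq hq) = -(hq + X * dq hq) := by
  have h : derivative hq = 0 := by simp [hq]
  have e1 : C (1 / 2 : ℂ) * C 2 = 1 := by rw [← C_mul]; norm_num
  rw [dq_hq, dq, derivative_mul, derivative_mul, derivative_C, derivative_X, h]
  have e2 : C (-1 / 2 : ℂ) = -C (1 / 2) := by rw [← C_neg]; norm_num
  rw [e2]
  linear_combination (-hq + C (1/2) * X ^ 2 * hq) * e1

theorem gker_hq_neg (s : ℝ) (x : ℂ) : gker hq s (-x) = gker hq s x := by
  simp only [gker, hq, eval_C, neg_div, neg_sq]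

theorem integrable_gker (q : ℂ[X]) {s : ℝ} (hs : 0 < s) :
    Integrable fun x : ℝ => gker q s x := by
  obtain ⟨C, hC, h⟩ := exists_norm_gker_le_genv_strip q
  refine ((integrable_genv (c := 1 / 8) (by norm_num) hs).const_mul C).mono'
    ((continuous_gker q s).comp Complex.continuous_ofReal).aestronglyMeasurable
    (Eventually.of_forall fun x => (h s hs x).trans ?_)
  simp

theorem integral_gker_hq : ∫ x : ℝ, gker hq 1 x = 1 := by
  have h : ∀ x : ℝ, gker hq 1 x =
      (((2 * Real.sqrt Real.pi)⁻¹ * Real.exp (-(1 / 4) * x ^ 2) : ℝ) : ℂ) := by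
    intro x
    simp only [gker, hq, eval_C, Complex.ofReal_one, inv_one, one_mul, div_one]
    push_cast
    congr 2; ring
  have hpi : Real.sqrt Real.pi ≠ 0 := (Real.sqrt_pos.2 Real.pi_pos).ne'
  simp only [h]
  rw [integral_complex_ofReal, integral_const_mul, integral_gaussian,
    show Real.pi / (1 / 4) = 2 ^ 2 * Real.pi by ring, Real.sqrt_mul (by positivity),
    Real.sqrt_sq (by norm_num), inv_mul_cancel₀ (by positivity)]
  simp

/-- The convolution after rescaling; the right-hand side makes sense also for `s = 0`. -/
theorem gconv_ofReal (q : ℂ[X]) {s : ℝ} (hs : 0 < s) (F : ℝ → ℂ) (y : ℝ) :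
    gconv q s F y = ∫ v : ℝ, gker q 1 v * F (y - s * v) := by
  have h1 : gconv q s F y = ∫ x : ℝ, gker q s x * F (y - x) := by
    rw [gconv, ← integral_sub_left_eq_self (fun x : ℝ => gker q s x * F (y - x)) volume y]
    congr 1; ext x
    simp
  have h2 := Measure.integral_comp_mul_left (fun x : ℝ => gker q s x * F (y - x)) s
  rw [h1]
  have h3 : ∀ v : ℝ, gker q s ((s * v : ℝ) : ℂ) = (s : ℂ)⁻¹ * gker q 1 v := by
    intro v
    have hs' : (s : ℂ) ≠ 0 := by exact_mod_cast hs.ne'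
    simp only [gker, Complex.ofReal_mul, mul_div_cancel_left₀ (v : ℂ) hs', Complex.ofReal_one,
      inv_one, one_mul, div_one]
    ring
  have h4 : ∫ x : ℝ, gker q s x * F (y - x) =
      s • ∫ v : ℝ, gker q s ((s * v : ℝ) : ℂ) * F (y - s * v) := by
    rw [h2, smul_smul, abs_of_pos (inv_pos.2 hs), mul_inv_cancel₀ hs.ne', one_smul]
  rw [h4, ← integral_smul]
  congr 1; ext v
  rw [h3, Complex.real_smul]
  have hs' : (s : ℂ) ≠ 0 := by exact_mod_cast hs.ne'
  field_simp

theorem gconv_hq_ofReal_add {s : ℝ} (F : ℝ → ℂ) (y : ℝ) :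
    gconv hq s F y = ∫ v : ℝ, gker hq s v * F (v + y) := by
  rw [gconv, ← integral_add_right_eq_self _ y]
  congr 1; ext v
  rw [← gker_hq_neg]
  congr 2
  push_cast; ring

theorem integrable_translate_prod {s a : ℝ} (hs : 0 < s) (ha : 0 ≤ a) {F : ℝ → ℂ}
    (hF : Integrable F) :
    Integrable (fun p : ℝ × ℝ => gker hq s p.1 * ((Real.exp (-a * p.2) : ℂ) * F (p.1 + p.2)))
      (volume.prod (volume.restrict (Ioi 0))) := by
  have h1 : Integrable (fun p : ℝ × ℝ => gker hq s p.1 * F p.2) (volume.prod volume) :=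
    (integrable_gker hq hs).mul_prod hF
  have h2 := (measurePreserving_prod_add (volume : Measure ℝ)
    (volume : Measure ℝ)).integrable_comp_of_integrable h1
  have hle : (volume : Measure ℝ).prod ((volume : Measure ℝ).restrict (Ioi 0)) ≤
      (volume : Measure ℝ).prod volume := by
    have := Measure.prod_restrict (μ := (volume : Measure ℝ)) (ν := (volume : Measure ℝ))
      univ (Ioi 0)
    rw [Measure.restrict_univ] at this
    rw [this]
    exact Measure.restrict_le_self
  have h3 := h2.mono_measure hle
  have h4 : AEStronglyMeasurable (fun p : ℝ × ℝ => (Real.exp (-a * p.2) : ℂ))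
      ((volume : Measure ℝ).prod (volume.restrict (Ioi 0))) :=
    Continuous.aestronglyMeasurable (by fun_prop)
  refine (h3.bdd_mul (c := 1) h4 ?_).congr (Eventually.of_forall fun p => ?_)
  · have h5 : ∀ᵐ p : ℝ × ℝ ∂((volume : Measure ℝ).prod (volume.restrict (Ioi 0))), 0 < p.2 :=
      Measure.quasiMeasurePreserving_snd.ae (ae_restrict_mem measurableSet_Ioi)
    filter_upwards [h5] with p hp
    rw [Complex.norm_real, Real.norm_of_nonneg (Real.exp_pos _).le]
    exact exp_neg_mul_le_one ha hp.le
  · simp only [Function.comp]; ring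

/-- If `ν F + ∫ e^{-ay} F(· + y) dy` is odd, then the heat evolution of `F` satisfies the slip
condition. -/
theorem slip_gconv {s a ν : ℝ} (hs : 0 < s) (ha : 0 ≤ a) {F : ℝ → ℂ} (hF : Integrable F)
    (hodd : ∀ p : ℝ, p ≠ 0 → (ν * F (-p) + ∫ y in Ioi (0 : ℝ), (Real.exp (-a * y) : ℂ) * F (-p + y))
      = -(ν * F p + ∫ y in Ioi (0 : ℝ), (Real.exp (-a * y) : ℂ) * F (p + y))) :
    ν * gconv hq s F 0 = -∫ y in Ioi (0 : ℝ), (Real.exp (-a * y) : ℂ) * gconv hq s F y := by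
  have hint := integrable_translate_prod hs ha hF
  have h1 : ∫ y in Ioi (0 : ℝ), (Real.exp (-a * y) : ℂ) * gconv hq s F y =
      ∫ v : ℝ, gker hq s v * ∫ y in Ioi (0 : ℝ), (Real.exp (-a * y) : ℂ) * F (v + y) := by
    simp only [gconv_hq_ofReal_add, ← integral_const_mul]
    rw [integral_integral_swap]
    · congr 1; ext v; congr 1; ext y; ring
    · refine hint.swap.congr (Eventually.of_forall fun p => ?_)
      simp only [Function.comp, Function.uncurry, Prod.fst_swap, Prod.snd_swap]; ring
  have h2 : gconv hq s F 0 = ∫ v : ℝ, gker hq s v * F v := by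
    have := gconv_hq_ofReal_add (s := s) F 0
    simpa using this
  have hi1 : Integrable fun v : ℝ => gker hq s v * (ν * F v) := by
    have h := (integrable_gker_mul hq hs hF 0).const_mul (ν : ℂ)
    refine h.congr (Eventually.of_forall fun v => ?_)
    simp only [zero_sub, gker_hq_neg]; ring
  have hi2 : Integrable fun v : ℝ =>
      gker hq s v * ∫ y in Ioi (0 : ℝ), (Real.exp (-a * y) : ℂ) * F (v + y) := by
    refine hint.integral_prod_left.congr (Eventually.of_forall fun v => ?_)
    simp only [integral_const_mul]
  have h3 : ∫ v : ℝ, gker hq s v * (ν * F v +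
      ∫ y in Ioi (0 : ℝ), (Real.exp (-a * y) : ℂ) * F (v + y)) = 0 := by
    -- An odd function is integrated against the even heat kernel.
    set V : ℝ → ℂ := fun v => gker hq s v * (ν * F v +
      ∫ y in Ioi (0 : ℝ), (Real.exp (-a * y) : ℂ) * F (v + y)) with hV
    have h4 : ∫ v, V (-v) = ∫ v, V v := integral_neg_eq_self V volume
    have h5 : ∫ v, V (-v) = -∫ v, V v := by
      rw [← integral_neg]
      refine integral_congr_ae ?_
      have : ∀ᵐ v : ℝ, v ≠ 0 := by
        simp [ae_iff]
      filter_upwards [this] with v hv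
      simp only [hV, Complex.ofReal_neg, gker_hq_neg]
      rw [hodd v hv]; ring
    have h6 : ∫ v, V v = -∫ v, V v := h4.symm.trans h5
    linear_combination (1 / 2 : ℂ) * h6
  rw [h1, h2, ← integral_const_mul]
  simp only [mul_add] at h3
  rw [integral_add hi1 hi2] at h3
  rw [eq_neg_iff_add_eq_zero, ← h3]
  congr 2; ext v; ring

/-! ### Continuity in time with values in `L¹` -/

theorem tendsto_lintegral_translate_sub {F : ℝ → ℂ} (hF : Integrable F) (h₀ : ℝ) :
    Tendsto (fun h => ∫⁻ y, ‖F (y + h) - F (y + h₀)‖ₑ) (𝓝 h₀) (𝓝 0) := by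
  have hFm : MemLp F 1 volume := memLp_one_iff_integrable.2 hF
  have hmp : ∀ h : ℝ, MeasurePreserving (fun y : ℝ => y + h) volume volume := fun h =>
    measurePreserving_add_right volume h
  have : Fact ((1 : ℝ≥0∞) ≠ ∞) := ⟨ENNReal.one_ne_top⟩
  have hcont : Continuous fun h : ℝ => (DomAddAct.mk h) +ᵥ (hFm.toLp F) := by
    have : Continuous fun h : ℝ => (DomAddAct.mk h) := DomAddAct.continuous_mk
    exact this.vadd continuous_const
  have h1 : Tendsto (fun h : ℝ => edist ((DomAddAct.mk h) +ᵥ (hFm.toLp F))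
      ((DomAddAct.mk h₀) +ᵥ (hFm.toLp F))) (𝓝 h₀) (𝓝 0) := by
    have := (hcont.tendsto h₀).edist (tendsto_const_nhds
      (x := (DomAddAct.mk h₀) +ᵥ (hFm.toLp F)))
    simpa using this
  refine h1.congr fun h => ?_
  rw [DomAddAct.mk_vadd_toLp, DomAddAct.mk_vadd_toLp, Lp.edist_toLp_toLp, eLpNorm_one_eq_lintegral_enorm]
  simp only [Pi.sub_apply, vadd_eq_add, add_comm]

theorem quasiMeasurePreserving_sub_mul (s : ℝ) :
    Measure.QuasiMeasurePreserving (fun p : ℝ × ℝ => p.2 - s * p.1)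
      ((volume : Measure ℝ).prod volume) volume := by
  have h : MeasurePreserving (fun p : ℝ × ℝ => (p.1, p.2 - s * p.1))
      ((volume : Measure ℝ).prod volume) ((volume : Measure ℝ).prod volume) := by
    refine (MeasurePreserving.id (volume : Measure ℝ)).skew_product
      (g := fun v y => y - s * v) (by fun_prop) (Eventually.of_forall fun v => ?_)
    exact (measurePreserving_sub_right (volume : Measure ℝ) (s * v)).map_eq
  exact Measure.quasiMeasurePreserving_snd.comp h.quasiMeasurePreserving

theorem integrable_gker_mul_comp {F : ℝ → ℂ} (hF : Integrable F) (s y : ℝ) :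
    Integrable fun v : ℝ => gker hq 1 v * F (y - s * v) := by
  rcases eq_or_ne s 0 with h | h
  · subst h
    simp only [zero_mul, sub_zero]
    exact (integrable_gker hq one_pos).mul_const _
  · obtain ⟨B, hB, hb⟩ := exists_norm_gker_le_unif hq (M := 0) one_pos
    have h1 : Integrable fun v : ℝ => F (y - s * v) := (hF.comp_sub_left y).comp_mul_left' h
    exact h1.bdd_mul (c := B) (((continuous_gker hq 1).comp
      Complex.continuous_ofReal).aestronglyMeasurable)
      (Eventually.of_forall fun v => hb 1 le_rfl _ (by simp))

theorem aemeasurable_gker_mul_sub {F : ℝ → ℂ} (hF : Integrable F) (s s₀ : ℝ) :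
    AEMeasurable (fun p : ℝ × ℝ => ‖gker hq 1 p.1 * (F (p.2 - s * p.1) - F (p.2 - s₀ * p.1))‖ₑ)
      ((volume : Measure ℝ).prod volume) := by
  refine AEStronglyMeasurable.enorm (AEStronglyMeasurable.mul ?_ (AEStronglyMeasurable.sub ?_ ?_))
  · exact Continuous.aestronglyMeasurable ((continuous_gker hq 1).comp (by fun_prop))
  · exact hF.1.comp_quasiMeasurePreserving (quasiMeasurePreserving_sub_mul s)
  · exact hF.1.comp_quasiMeasurePreserving (quasiMeasurePreserving_sub_mul s₀)

theorem lintegral_enorm_translate (F : ℝ → ℂ) (h : ℝ) : ∫⁻ y, ‖F (y - h)‖ₑ = ∫⁻ y, ‖F y‖ₑ :=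
  lintegral_sub_right_eq_self (fun y => ‖F y‖ₑ) h

/-- The heat evolution depends continuously on the scale, in `L¹(ℝ)`, down to scale zero. -/
theorem tendsto_lintegral_heat_sub {F : ℝ → ℂ} (hF : Integrable F) (s₀ : ℝ) :
    Tendsto (fun s => ∫⁻ y, ‖(∫ v : ℝ, gker hq 1 v * F (y - s * v)) -
      ∫ v : ℝ, gker hq 1 v * F (y - s₀ * v)‖ₑ) (𝓝 s₀) (𝓝 0) := by
  have hle : ∀ s, ∫⁻ y, ‖(∫ v : ℝ, gker hq 1 v * F (y - s * v)) -
      ∫ v : ℝ, gker hq 1 v * F (y - s₀ * v)‖ₑ ≤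
      ∫⁻ v : ℝ, ∫⁻ y : ℝ, ‖gker hq 1 v * (F (y - s * v) - F (y - s₀ * v))‖ₑ := by
    intro s
    rw [lintegral_lintegral_swap (aemeasurable_gker_mul_sub hF s s₀)]
    refine lintegral_mono fun y => ?_
    rw [← integral_sub (integrable_gker_mul_comp hF s y) (integrable_gker_mul_comp hF s₀ y)]
    simp only [← mul_sub]
    exact enorm_integral_le_lintegral_enorm _
  refine tendsto_of_tendsto_of_tendsto_of_le_of_le tendsto_const_nhds ?_ (fun _ => zero_le)
    hle
  have hz : (∫⁻ _ : ℝ, (0 : ℝ≥0∞)) = 0 := lintegral_zero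
  rw [← hz]
  have hfin : ∫⁻ y, ‖F y‖ₑ ≠ ∞ := hF.2.ne
  have hg := integrable_gker hq one_pos
  refine tendsto_lintegral_filter_of_dominated_convergence'
    (fun v : ℝ => ‖gker hq 1 v‖ₑ * (2 * ∫⁻ y, ‖F y‖ₑ))
    (Eventually.of_forall fun s => (aemeasurable_gker_mul_sub hF s s₀).lintegral_prod_right')
    (Eventually.of_forall fun s => Eventually.of_forall fun v => ?_) ?_
    (Eventually.of_forall fun v => ?_)
  · simp only [enorm_mul]
    rw [lintegral_const_mul' _ _ enorm_ne_top]
    gcongr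
    calc _ ≤ ∫⁻ y, (‖F (y - s * v)‖ₑ + ‖F (y - s₀ * v)‖ₑ) := lintegral_mono fun y => enorm_sub_le
      _ = (∫⁻ y, ‖F (y - s * v)‖ₑ) + ∫⁻ y, ‖F (y - s₀ * v)‖ₑ :=
          lintegral_add_left' (hF.comp_sub_right (s * v)).1.enorm _
      _ = _ := by rw [lintegral_enorm_translate, lintegral_enorm_translate, two_mul]
  · rw [lintegral_mul_const' _ _ (ENNReal.mul_ne_top (by simp) hfin)]
    exact ENNReal.mul_ne_top hg.2.ne (ENNReal.mul_ne_top (by simp) hfin)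
  · have h1 := tendsto_lintegral_translate_sub hF (-(s₀ * v))
    have h2 : Tendsto (fun s : ℝ => -(s * v)) (𝓝 s₀) (𝓝 (-(s₀ * v))) :=
      (continuous_id.mul continuous_const).neg.tendsto s₀
    have h3 := ENNReal.Tendsto.const_mul (a := ‖gker hq 1 v‖ₑ) (h1.comp h2) (Or.inr enorm_ne_top)
    rw [mul_zero] at h3
    refine h3.congr fun s => ?_
    simp only [Function.comp, enorm_mul, ← sub_eq_add_neg]
    rw [lintegral_const_mul' _ _ enorm_ne_top]

theorem lintegral_heat_lt_top {F : ℝ → ℂ} (hF : Integrable F) (s : ℝ) :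
    ∫⁻ y, ‖∫ v : ℝ, gker hq 1 v * F (y - s * v)‖ₑ < ∞ := by
  have hm : AEMeasurable (fun p : ℝ × ℝ => ‖gker hq 1 p.1 * F (p.2 - s * p.1)‖ₑ)
      ((volume : Measure ℝ).prod volume) := by
    refine AEStronglyMeasurable.enorm (AEStronglyMeasurable.mul ?_ ?_)
    · exact Continuous.aestronglyMeasurable ((continuous_gker hq 1).comp (by fun_prop))
    · exact hF.1.comp_quasiMeasurePreserving (quasiMeasurePreserving_sub_mul s)
  calc _ ≤ ∫⁻ y, ∫⁻ v : ℝ, ‖gker hq 1 v * F (y - s * v)‖ₑ :=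
        lintegral_mono fun y => enorm_integral_le_lintegral_enorm _
    _ = ∫⁻ v : ℝ, ∫⁻ y, ‖gker hq 1 v * F (y - s * v)‖ₑ := (lintegral_lintegral_swap hm).symm
    _ = ∫⁻ v : ℝ, ‖gker hq 1 v‖ₑ * ∫⁻ y, ‖F y‖ₑ := by
        refine lintegral_congr fun v => ?_
        simp only [enorm_mul]
        rw [lintegral_const_mul' _ _ enorm_ne_top, lintegral_enorm_translate]
    _ < ∞ := by
        rw [lintegral_mul_const' _ _ hF.2.ne]
        exact ENNReal.mul_lt_top (integrable_gker hq one_pos).2 hF.2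

/-! ### The solution of the mode equations -/

/-- The `α`-th mode (`a = |α|`) of the solution of the Stokes problem with datum `u`, `t > 0`. -/
noncomputable def modeSol (ν a : ℝ) (u : ℝ → ℂ) (t : ℝ) (z : ℂ) : ℂ :=
  (Real.exp (-(ν * a ^ 2) * t) : ℂ) * gconv hq (Real.sqrt (ν * t)) (extDatum ν a u) z

section
variable {ν a : ℝ} {u : ℝ → ℂ}

theorem hasDerivAt_modeSol (hν : 0 < ν) (ha : 0 ≤ a) (hu : IntegrableOn u (Ioi 0))
    (hc : ContinuousOn u (Ioi 0)) {t : ℝ} (ht : 0 < t) (z : ℂ) :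
    HasDerivAt (modeSol ν a u t) ((Real.exp (-(ν * a ^ 2) * t) : ℂ) *
      ((Real.sqrt (ν * t) : ℂ)⁻¹ * gconv (dq hq) (Real.sqrt (ν * t)) (extDatum ν a u) z)) z :=
  (hasDerivAt_gconv hq (Real.sqrt_pos.2 (mul_pos hν ht))
    (integrable_extDatum hν ha hu hc) z).const_mul _

theorem deriv_deriv_modeSol (hν : 0 < ν) (ha : 0 ≤ a) (hu : IntegrableOn u (Ioi 0))
    (hc : ContinuousOn u (Ioi 0)) {t : ℝ} (ht : 0 < t) (z : ℂ) :
    deriv (deriv (modeSol ν a u t)) z = (Real.exp (-(ν * a ^ 2) * t) : ℂ) *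
      ((ν * t : ℂ)⁻¹ * gconv (dq (dq hq)) (Real.sqrt (ν * t)) (extDatum ν a u) z) := by
  have hs := Real.sqrt_pos.2 (mul_pos hν ht)
  have h1 : deriv (modeSol ν a u t) = fun z => (Real.exp (-(ν * a ^ 2) * t) : ℂ) *
      ((Real.sqrt (ν * t) : ℂ)⁻¹ * gconv (dq hq) (Real.sqrt (ν * t)) (extDatum ν a u) z) :=
    funext fun z => (hasDerivAt_modeSol hν ha hu hc ht z).deriv
  rw [h1]
  have h2 := ((hasDerivAt_gconv (dq hq) hs (integrable_extDatum hν ha hu hc) z).const_mul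
    (Real.sqrt (ν * t) : ℂ)⁻¹).const_mul (Real.exp (-(ν * a ^ 2) * t) : ℂ)
  rw [h2.deriv, ← mul_assoc (Real.sqrt (ν * t) : ℂ)⁻¹, ← mul_inv, ← Complex.ofReal_mul,
    Real.mul_self_sqrt (mul_pos hν ht).le, Complex.ofReal_mul]

theorem gconv_C_mul (c : ℂ) (q : ℂ[X]) (s : ℝ) (F : ℝ → ℂ) (z : ℂ) :
    gconv (C c * q) s F z = c * gconv q s F z := by
  simp only [gconv, gker_C_mul, mul_assoc, integral_const_mul]

theorem modeSol_heat (hν : 0 < ν) (ha : 0 ≤ a) (hu : IntegrableOn u (Ioi 0))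
    (hc : ContinuousOn u (Ioi 0)) {t : ℝ} (ht : 0 < t) (z : ℂ) :
    HasDerivAt (fun τ => modeSol ν a u τ z)
      (ν * (deriv (deriv (modeSol ν a u t)) z - a ^ 2 * modeSol ν a u t z)) t := by
  have hνt := mul_pos hν ht
  have hs := Real.sqrt_pos.2 hνt
  have hF := integrable_extDatum hν ha hu hc
  have h1 : HasDerivAt (fun τ => Real.sqrt (ν * τ)) (ν / (2 * Real.sqrt (ν * t))) t := by
    have := ((hasDerivAt_id t).const_mul ν).sqrt hνt.ne'
    simpa using this
  have h2 := HasDerivAt.scomp t (hasDerivAt_gconv_scale hq hs hF z) h1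
  have h3 : HasDerivAt (fun τ : ℝ => (Real.exp (-(ν * a ^ 2) * τ) : ℂ))
      ((Real.exp (-(ν * a ^ 2) * t) : ℂ) * (-(ν * a ^ 2) : ℝ)) t := by
    have := (((hasDerivAt_id t).const_mul (-(ν * a ^ 2))).exp).ofReal_comp
    simpa using this
  have h4 := h3.mul h2
  refine HasDerivAt.congr_deriv (f := fun τ => modeSol ν a u τ z) h4 ?_
  rw [deriv_deriv_modeSol hν ha hu hc ht]
  have e1 : gconv (hq + X * dq hq) (Real.sqrt (ν * t)) (extDatum ν a u) z =
      -(2 * gconv (dq (dq hq)) (Real.sqrt (ν * t)) (extDatum ν a u) z) := by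
    have : hq + X * dq hq = C (-2) * dq (dq hq) := by
      have := two_mul_dq_dq_hq
      have e : (C (-2) : ℂ[X]) = -C 2 := by rw [← C_neg]
      rw [e]; linear_combination this
    rw [this, gconv_C_mul]; ring
  rw [e1]
  simp only [modeSol, Function.comp, Complex.real_smul]
  have e2 : (Real.sqrt (ν * t) : ℂ) * (Real.sqrt (ν * t) : ℂ) = ν * t := by
    rw [← Complex.ofReal_mul, Real.mul_self_sqrt hνt.le, Complex.ofReal_mul]
  have e3 : ((ν / (2 * Real.sqrt (ν * t)) : ℝ) : ℂ) * (-(Real.sqrt (ν * t) : ℂ)⁻¹) =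
      -(ν / 2) * (ν * t : ℂ)⁻¹ := by
    rw [← e2]; push_cast
    have : (Real.sqrt (ν * t) : ℂ) ≠ 0 := by exact_mod_cast hs.ne'
    field_simp
  push_cast at e3 ⊢
  linear_combination (-(2 : ℂ) * Complex.exp (-(ν * a ^ 2) * t) *
    gconv (dq (dq hq)) (Real.sqrt (ν * t)) (extDatum ν a u) z) * e3

theorem modeSol_slip (hν : 0 < ν) (ha : 0 ≤ a) (hu : IntegrableOn u (Ioi 0))
    (hc : ContinuousOn u (Ioi 0)) {t : ℝ} (ht : 0 < t) :
    ν * modeSol ν a u t 0 =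
      -∫ y in Ioi (0 : ℝ), (Real.exp (-a * y) : ℂ) * modeSol ν a u t y := by
  have h := slip_gconv (Real.sqrt_pos.2 (mul_pos hν ht)) ha (integrable_extDatum hν ha hu hc)
    (fun p hp => slip_combination_odd hν ha hu hc hp)
  have e : ∀ y : ℝ, (Real.exp (-a * y) : ℂ) * modeSol ν a u t y =
      (Real.exp (-(ν * a ^ 2) * t) : ℂ) * ((Real.exp (-a * y) : ℂ) *
        gconv hq (Real.sqrt (ν * t)) (extDatum ν a u) y) := fun y => by rw [modeSol]; ring
  simp only [e]
  rw [integral_const_mul, modeSol]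
  linear_combination (Real.exp (-(ν * a ^ 2) * t) : ℂ) * h

/-- The mode solution on the real line, in a form that is meaningful down to `t = 0`, where it
reduces to the datum. -/
noncomputable def realSol (ν a : ℝ) (u : ℝ → ℂ) (t y : ℝ) : ℂ :=
  (Real.exp (-(ν * a ^ 2) * t) : ℂ) *
    ∫ v : ℝ, gker hq 1 v * extDatum ν a u (y - Real.sqrt (ν * t) * v)

theorem realSol_of_pos (hν : 0 < ν) {t : ℝ} (ht : 0 < t) (y : ℝ) :
    realSol ν a u t y = modeSol ν a u t y := by
  rw [realSol, modeSol, gconv_ofReal hq (Real.sqrt_pos.2 (mul_pos hν ht))]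

theorem realSol_zero {y : ℝ} (hy : 0 < y) : realSol ν a u 0 y = u y := by
  simp only [realSol, mul_zero, Real.sqrt_zero, zero_mul, sub_zero, Real.exp_zero,
    Complex.ofReal_one, one_mul]
  rw [integral_mul_const, integral_gker_hq, one_mul, extDatum_of_pos hy]

theorem tendsto_lintegral_realSol (hν : 0 < ν) (ha : 0 ≤ a) (hu : IntegrableOn u (Ioi 0))
    (hc : ContinuousOn u (Ioi 0)) (t : ℝ) :
    Tendsto (fun τ => ∫⁻ y in Ioi (0 : ℝ), ‖realSol ν a u τ y - realSol ν a u t y‖ₑ)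
      (𝓝 t) (𝓝 0) := by
  have hF := integrable_extDatum hν ha hu hc
  set A : ℝ → ℝ → ℂ := fun t y =>
    ∫ v : ℝ, gker hq 1 v * extDatum ν a u (y - Real.sqrt (ν * t) * v) with hA
  have h1 : Tendsto (fun τ => ∫⁻ y, ‖A τ y - A t y‖ₑ) (𝓝 t) (𝓝 0) := by
    have h2 : Tendsto (fun τ => Real.sqrt (ν * τ)) (𝓝 t) (𝓝 (Real.sqrt (ν * t))) :=
      (Real.continuous_sqrt.comp (continuous_const.mul continuous_id)).tendsto t
    exact (tendsto_lintegral_heat_sub hF (Real.sqrt (ν * t))).comp h2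
  have hE : Continuous fun τ : ℝ => (Real.exp (-(ν * a ^ 2) * τ) : ℂ) := by fun_prop
  have h3 : Tendsto (fun τ => ‖(Real.exp (-(ν * a ^ 2) * τ) : ℂ)‖ₑ *
      (∫⁻ y, ‖A τ y - A t y‖ₑ) + ‖(Real.exp (-(ν * a ^ 2) * τ) : ℂ) -
        (Real.exp (-(ν * a ^ 2) * t) : ℂ)‖ₑ * ∫⁻ y, ‖A t y‖ₑ) (𝓝 t) (𝓝 0) := by
    have e1 := ENNReal.Tendsto.mul (hE.enorm.tendsto t) (Or.inr (by simp)) h1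
      (Or.inr enorm_ne_top)
    have e2 : Tendsto (fun τ => ‖(Real.exp (-(ν * a ^ 2) * τ) : ℂ) -
        (Real.exp (-(ν * a ^ 2) * t) : ℂ)‖ₑ) (𝓝 t) (𝓝 0) := by
      have := ((hE.sub (continuous_const (y := (Real.exp (-(ν * a ^ 2) * t) : ℂ)))).enorm).tendsto t
      simpa using this
    have e3 := ENNReal.Tendsto.mul_const e2 (b := ∫⁻ y, ‖A t y‖ₑ)
      (Or.inr (lintegral_heat_lt_top hF _).ne)
    simpa using e1.add e3
  refine tendsto_of_tendsto_of_tendsto_of_le_of_le tendsto_const_nhds h3 (fun _ => zero_le)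
    fun τ => ?_
  refine (setLIntegral_le_lintegral _ _).trans ?_
  have hpt : ∀ y, ‖realSol ν a u τ y - realSol ν a u t y‖ₑ ≤
      ‖(Real.exp (-(ν * a ^ 2) * τ) : ℂ)‖ₑ * ‖A τ y - A t y‖ₑ +
      ‖(Real.exp (-(ν * a ^ 2) * τ) : ℂ) - (Real.exp (-(ν * a ^ 2) * t) : ℂ)‖ₑ * ‖A t y‖ₑ := by
    intro y
    rw [← enorm_mul, ← enorm_mul]
    refine le_trans (le_of_eq ?_) (enorm_add_le _ _)
    simp only [realSol, hA]
    congr 1; ring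
  have hm : AEStronglyMeasurable (A t) volume := by
    have h5 : AEStronglyMeasurable (fun p : ℝ × ℝ =>
        gker hq 1 p.1 * extDatum ν a u (p.2 - Real.sqrt (ν * t) * p.1))
        ((volume : Measure ℝ).prod volume) :=
      (Continuous.aestronglyMeasurable ((continuous_gker hq 1).comp (by fun_prop))).mul
        (hF.1.comp_quasiMeasurePreserving (quasiMeasurePreserving_sub_mul _))
    exact h5.prod_swap.integral_prod_right'
  calc _ ≤ _ := lintegral_mono hpt
    _ = _ := by
      rw [lintegral_add_right' _ (hm.enorm.const_mul _), lintegral_const_mul' _ _ enorm_ne_top,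
        lintegral_const_mul' _ _ enorm_ne_top]

theorem integrableOn_modeSol (hν : 0 < ν) (ha : 0 ≤ a) (hu : IntegrableOn u (Ioi 0))
    (hc : ContinuousOn u (Ioi 0)) {t : ℝ} (ht : 0 < t) :
    IntegrableOn (fun y : ℝ => modeSol ν a u t y) (Ioi 0) := by
  have hF := integrable_extDatum hν ha hu hc
  have hs := Real.sqrt_pos.2 (mul_pos hν ht)
  have h1 : Integrable fun y : ℝ => gconv hq (Real.sqrt (ν * t)) (extDatum ν a u) y := by
    refine ⟨?_, ?_⟩
    · have hd : Continuous (gconv hq (Real.sqrt (ν * t)) (extDatum ν a u)) :=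
        continuous_iff_continuousAt.2 fun z => (hasDerivAt_gconv hq hs hF z).continuousAt
      exact (hd.comp Complex.continuous_ofReal).aestronglyMeasurable
    · have := lintegral_heat_lt_top hF (Real.sqrt (ν * t))
      simpa only [HasFiniteIntegral, gconv_ofReal hq hs] using this
  exact (h1.const_mul _).integrableOn

end

/-! ### Existence for the Stokes problem -/

/-- The restriction of the `α`-th mode of a field to the half-line, extended by zero. -/
noncomputable def datum (f : Torus → ℂ → ℂ) (α : ℤ) (y : ℝ) : ℂ :=
  if 0 < y then mode f α y else 0

theorem datum_of_pos {f : Torus → ℂ → ℂ} {α : ℤ} {y : ℝ} (hy : 0 < y) :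
    datum f α y = mode f α y := if_pos hy

/-- The solution of the Stokes problem with datum `f`: a Fourier series in `x` for `t > 0`, and the
datum itself for `t ≤ 0`. -/
noncomputable def stokesField (ν : ℝ) (f : Torus → ℂ → ℂ) (t : ℝ) (x : Torus) (z : ℂ) : ℂ :=
  if t ≤ 0 then f x z else ∑' α : ℤ, modeSol ν |(α : ℝ)| (datum f α) t z * fourier α x

/-- The properties of the data on the half-line on which the construction of the solution rests. -/
structure HasDecayingData (f : Torus → ℂ → ℂ) : Prop where
  integrableOn : ∀ α, IntegrableOn (datum f α) (Ioi 0)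
  continuousOn : ∀ α, ContinuousOn (datum f α) (Ioi 0)
  decay : ∃ A ρ : ℝ, 0 < ρ ∧ ∀ α : ℤ, ∫ y in Ioi (0 : ℝ), ‖datum f α y‖ ≤
    A * Real.exp (-ρ * |(α : ℝ)|)

theorem continuousOn_datum {σ : ℝ} (hσ : 0 < σ) {f : Torus → ℂ → ℂ} (hf : IsAnalyticField σ f)
    (α : ℤ) : ContinuousOn (datum f α) (Ioi 0) := by
  have h : ContinuousOn (fun y : ℝ => mode f α y) (Ioi 0) :=
    (hf.differentiableOn_mode α).continuousOn.comp Complex.continuous_ofReal.continuousOn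
      fun y hy => ofReal_mem_pencil hσ hy
  exact h.congr fun y hy => datum_of_pos hy

theorem lintegral_datum_le {σ : ℝ} (hσ : 0 < σ) (f : Torus → ℂ → ℂ) (α : ℤ) :
    ∫⁻ y in Ioi (0 : ℝ), ‖datum f α y‖ₑ ≤ modeL1 σ (mode f α) := by
  refine le_trans (le_of_eq ?_) (lintegral_gam_le_modeL1 (θ := 0) (by simpa using hσ) _)
  refine setLIntegral_congr_fun measurableSet_Ioi fun y hy => ?_
  simp only [datum_of_pos (show 0 < y from hy), gam_zero]

theorem ofReal_exp_mul_le_iff {c : ℝ} {x y : ℝ≥0∞} :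
    ENNReal.ofReal (Real.exp c) * x ≤ y ↔ x ≤ ENNReal.ofReal (Real.exp (-c)) * y := by
  have h0 : ENNReal.ofReal (Real.exp c) ≠ 0 := by simp [Real.exp_pos]
  have h2 : ENNReal.ofReal (Real.exp (-c)) = (ENNReal.ofReal (Real.exp c))⁻¹ := by
    rw [Real.exp_neg, ENNReal.ofReal_inv_of_pos (Real.exp_pos c)]
  rw [h2, ENNReal.mul_le_iff_le_inv h0 ENNReal.ofReal_ne_top]

theorem hasDecayingData_of_normL1_lt_top {ρ σ : ℝ} (hρ : 0 < ρ) (hσ : 0 < σ)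
    {f : Torus → ℂ → ℂ} (hf : IsAnalyticField σ f) (h : normL1 ρ σ f < ∞) :
    HasDecayingData f := by
  have h1 : ∀ α : ℤ, ∫⁻ y in Ioi (0 : ℝ), ‖datum f α y‖ₑ ≤
      ENNReal.ofReal ((normL1 ρ σ f).toReal * Real.exp (-ρ * |(α : ℝ)|)) := by
    intro α
    refine (lintegral_datum_le hσ f α).trans ?_
    rw [mul_comm, ENNReal.ofReal_mul (Real.exp_pos _).le, ENNReal.ofReal_toReal h.ne, neg_mul,
      ← ofReal_exp_mul_le_iff]
    exact ENNReal.le_tsum (f := fun α : ℤ =>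
      ENNReal.ofReal (Real.exp (ρ * |(α : ℝ)|)) * modeL1 σ (mode f α)) α
  refine ⟨fun α => ⟨(continuousOn_datum hσ hf α).aestronglyMeasurable measurableSet_Ioi,
    (h1 α).trans_lt ENNReal.ofReal_lt_top⟩, continuousOn_datum hσ hf,
    (normL1 ρ σ f).toReal, ρ, hρ, fun α => ?_⟩
  rw [integral_norm_eq_lintegral_enorm
    ((continuousOn_datum hσ hf α).aestronglyMeasurable measurableSet_Ioi)]
  exact ENNReal.toReal_le_of_le_ofReal (by positivity) (h1 α)

theorem integral_norm_extDatum_le {ν a : ℝ} {u : ℝ → ℂ} (hν : 0 < ν) (ha : 0 ≤ a)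
    (hu : IntegrableOn u (Ioi 0)) (hc : ContinuousOn u (Ioi 0)) :
    ∫ x, ‖extDatum ν a u x‖ ≤ 8 * ∫ y in Ioi (0 : ℝ), ‖u y‖ := by
  have hF := integrable_extDatum hν ha hu hc
  have h1 : ∫ x in Ioi (0 : ℝ), ‖extDatum ν a u x‖ = ∫ y in Ioi (0 : ℝ), ‖u y‖ :=
    setIntegral_congr_fun measurableSet_Ioi fun x hx => by
      simp only [extDatum_of_pos (show 0 < x from hx)]
  have h2 : ∫ x in Iic (0 : ℝ), ‖extDatum ν a u x‖ = ∫ y in Ioi (0 : ℝ), ‖reflDatum ν a u y‖ := by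
    have h := integral_comp_neg_Ioi (0 : ℝ) fun x => ‖extDatum ν a u x‖
    rw [neg_zero] at h
    rw [← h]
    refine setIntegral_congr_fun measurableSet_Ioi fun x hx => ?_
    simp only [extDatum_neg (show 0 < x from hx)]
  have h3 : ∫ y in Ioi (0 : ℝ), ‖reflDatum ν a u y‖ ≤ 7 * ∫ y in Ioi (0 : ℝ), ‖u y‖ := by
    rw [integral_norm_eq_lintegral_enorm (integrableOn_reflDatum hν ha hu hc).1,
      integral_norm_eq_lintegral_enorm hu.1]
    have := ENNReal.toReal_mono (ENNReal.mul_ne_top (by simp) hu.2.ne)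
      (lintegral_enorm_reflDatum_le hν ha hu hc)
    simpa using this
  rw [← intervalIntegral.integral_Iic_add_Ioi hF.norm.integrableOn hF.norm.integrableOn (b := 0),
    h1, h2]
  linarith

theorem norm_exp_neg_le_one {ν a t : ℝ} (hν : 0 < ν) (ht : 0 ≤ t) :
    ‖(Real.exp (-(ν * a ^ 2) * t) : ℂ)‖ ≤ 1 := by
  rw [Complex.norm_real, Real.norm_of_nonneg (Real.exp_pos _).le, Real.exp_le_one_iff]
  have : 0 ≤ ν * a ^ 2 * t := by positivity
  linarith

theorem exists_norm_modeSol_le {ν : ℝ} (hν : 0 < ν) {t₀ M : ℝ} (ht₀ : 0 < t₀) :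
    ∃ B : ℝ, 0 < B ∧ ∀ t, t₀ ≤ t → ∀ z : ℂ, |z.im| ≤ M → ∀ a, 0 ≤ a → ∀ u : ℝ → ℂ,
      IntegrableOn u (Ioi 0) → ContinuousOn u (Ioi 0) →
      ‖modeSol ν a u t z‖ ≤ B * ∫ y in Ioi (0 : ℝ), ‖u y‖ := by
  obtain ⟨B, hB, h⟩ := exists_norm_gconv_le hq (M := M) (Real.sqrt_pos.2 (mul_pos hν ht₀))
  refine ⟨B * 8, by positivity, fun t ht z hz a ha u hu hc => ?_⟩
  have ht0 : 0 < t := ht₀.trans_le ht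
  rw [modeSol, norm_mul, mul_assoc]
  calc _ ≤ 1 * (B * ∫ x, ‖extDatum ν a u x‖) :=
        mul_le_mul (norm_exp_neg_le_one hν ht0.le) (h _ (Real.sqrt_le_sqrt (by gcongr)) z hz _
          (integrable_extDatum hν ha hu hc)) (norm_nonneg _) zero_le_one
    _ ≤ _ := by
        rw [one_mul]
        exact mul_le_mul_of_nonneg_left (integral_norm_extDatum_le hν ha hu hc) hB.le

theorem continuousOn_modeSol {ν a : ℝ} {u : ℝ → ℂ} (hν : 0 < ν) (ha : 0 ≤ a)
    (hu : IntegrableOn u (Ioi 0)) (hc : ContinuousOn u (Ioi 0)) :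
    ContinuousOn (fun p : ℝ × ℂ => modeSol ν a u p.1 p.2) (Ioi 0 ×ˢ univ) := by
  refine ContinuousOn.mul (Continuous.continuousOn (by fun_prop)) ?_
  refine (continuousOn_gconv hq (integrable_extDatum hν ha hu hc)).comp
    (f := fun p : ℝ × ℂ => (Real.sqrt (ν * p.1), p.2)) (by fun_prop) fun p hp => ?_
  exact ⟨Real.sqrt_pos.2 (mul_pos hν hp.1), trivial⟩

namespace HasDecayingData

variable {ν : ℝ} {f : Torus → ℂ → ℂ}

theorem exists_norm_modeSol_le (hf : HasDecayingData f) (hν : 0 < ν) {t₀ : ℝ} (M : ℝ)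
    (ht₀ : 0 < t₀) : ∃ B ρ : ℝ, 0 < ρ ∧ ∀ t, t₀ ≤ t → ∀ z : ℂ, |z.im| ≤ M → ∀ α : ℤ,
      ‖modeSol ν |(α : ℝ)| (datum f α) t z‖ ≤ B * Real.exp (-ρ * |(α : ℝ)|) := by
  obtain ⟨A, ρ, hρ, hA⟩ := hf.decay
  obtain ⟨B, hB, h⟩ := _root_.exists_norm_modeSol_le hν (M := M) ht₀
  refine ⟨B * A, ρ, hρ, fun t ht z hz α => ?_⟩
  refine (h t ht z hz _ (abs_nonneg _) _ (hf.integrableOn α) (hf.continuousOn α)).trans ?_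
  rw [mul_assoc]
  exact mul_le_mul_of_nonneg_left (hA α) hB.le

theorem mode_stokesField (hf : HasDecayingData f) (hν : 0 < ν) {t : ℝ} (ht : 0 < t) (α : ℤ) :
    mode (stokesField ν f t) α = modeSol ν |(α : ℝ)| (datum f α) t := by
  ext z
  obtain ⟨B, ρ, hρ, h⟩ := hf.exists_norm_modeSol_le hν |z.im| ht
  have := fourierCoeff_fourierSeries hρ (h t le_rfl z le_rfl) α
  simp only [mode, stokesField, if_neg ht.not_ge]
  exact this

theorem niceField_stokesField (hf : HasDecayingData f) (hν : 0 < ν) {t σ : ℝ} (ht : 0 < t) :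
    NiceField σ (stokesField ν f t) := by
  have hd : ∀ K, IsCompact K → K ⊆ pencil σ → ∃ B ρ : ℝ, 0 < ρ ∧ ∀ α : ℤ, ∀ z ∈ K,
      ‖modeSol ν |(α : ℝ)| (datum f α) t z‖ ≤ B * Real.exp (-ρ * |(α : ℝ)|) := by
    intro K _ hKs
    obtain ⟨B, ρ, hρ, h⟩ := hf.exists_norm_modeSol_le hν σ ht
    exact ⟨B, ρ, hρ, fun α z hz => h t le_rfl z ((mem_pencil_iff.1 (hKs hz)).2.le) α⟩
  refine ⟨isAnalyticField_of_eq_tsum (fun α z _ => (hasDerivAt_modeSol hν (abs_nonneg _)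
    (hf.integrableOn α) (hf.continuousOn α) ht z).differentiableAt.differentiableWithinAt) hd
    fun z _ x => by simp only [stokesField, if_neg ht.not_ge], ?_⟩
  simpa only [hf.mode_stokesField hν ht] using hd

theorem continuousOn_stokesField (hf : HasDecayingData f) (hν : 0 < ν) (M : ℝ) :
    ContinuousOn (fun p : ℝ × Torus × ℂ => stokesField ν f p.1 p.2.1 p.2.2)
      (Ioi 0 ×ˢ univ ×ˢ {z : ℂ | |z.im| ≤ M}) := by
  have key : ∀ t₀ : ℝ, 0 < t₀ →
      ContinuousOn (fun p : ℝ × Torus × ℂ => stokesField ν f p.1 p.2.1 p.2.2)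
        (Ioi t₀ ×ˢ univ ×ˢ {z : ℂ | |z.im| ≤ M}) := by
    intro t₀ ht₀
    obtain ⟨B, ρ, hρ, h⟩ := hf.exists_norm_modeSol_le hν M ht₀
    have h1 : ContinuousOn (fun p : ℝ × Torus × ℂ =>
        ∑' α : ℤ, modeSol ν |(α : ℝ)| (datum f α) p.1 p.2.2 * fourier α p.2.1)
        (Ioi t₀ ×ˢ univ ×ˢ {z : ℂ | |z.im| ≤ M}) := by
      refine continuousOn_tsum (u := fun α : ℤ => B * Real.exp (-ρ * |(α : ℝ)|)) (fun α => ?_)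
        (summable_exp_neg_abs hρ B) fun α p hp => ?_
      · refine ContinuousOn.mul ?_
          ((map_continuous (fourier α)).comp (by fun_prop)).continuousOn
        exact (continuousOn_modeSol hν (abs_nonneg _) (hf.integrableOn α) (hf.continuousOn α)).comp
          (f := fun p : ℝ × Torus × ℂ => (p.1, p.2.2)) (by fun_prop)
          fun p hp => ⟨ht₀.trans hp.1, trivial⟩
      · rw [norm_mul, norm_fourier_apply, mul_one]
        exact h _ (le_of_lt hp.1) _ hp.2.2 α
    refine h1.congr fun p hp => ?_
    simp only [stokesField, if_neg (not_le.2 (ht₀.trans hp.1))]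
  rintro ⟨t, x, z⟩ ⟨ht, hxz⟩
  have ht : 0 < t := ht
  have h2 := key (t / 2) (half_pos ht) (t, x, z) ⟨show t / 2 < t by linarith, hxz⟩
  refine h2.mono_of_mem_nhdsWithin ?_
  rw [nhdsWithin_prod_eq, nhdsWithin_prod_eq]
  exact prod_mem_prod (mem_nhdsWithin_of_mem_nhds (Ioi_mem_nhds (by linarith)))
    (by rw [← nhdsWithin_prod_eq]; exact self_mem_nhdsWithin)

theorem mode_stokesField_eq_realSol (hf : HasDecayingData f) (hν : 0 < ν) {t y : ℝ} (ht : 0 ≤ t)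
    (hy : 0 < y) (α : ℤ) :
    mode (stokesField ν f t) α y = realSol ν |(α : ℝ)| (datum f α) t y := by
  rcases ht.eq_or_lt with h | h
  · subst h
    have : stokesField ν f 0 = f := by ext x z; simp [stokesField]
    rw [this, realSol_zero hy, datum_of_pos hy]
  · rw [realSol_of_pos hν h, hf.mode_stokesField hν h]

/-- The Fourier series `stokesField` solves the Stokes problem. -/
theorem isStokesSolution (hf : HasDecayingData f) (hν : 0 < ν) {σ : ℝ} (hσ : 0 < σ) :
    IsStokesSolution ν σ f (stokesField ν f) where
  initial x z _ := by simp [stokesField]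
  continuousOn := by
    refine (hf.continuousOn_stokesField hν σ).mono (prod_mono subset_rfl (prod_mono subset_rfl ?_))
    rintro z (rfl | hz)
    · simp [hσ.le]
    · exact (mem_pencil_iff.1 hz).2.le
  holomorphic t ht := (hf.niceField_stokesField hν ht).analytic.holomorphic
  heat t ht α z _ := by
    have h := modeSol_heat hν (abs_nonneg (α : ℝ)) (hf.integrableOn α) (hf.continuousOn α) ht z
    rw [hf.mode_stokesField hν ht]
    refine (h.congr_of_eventuallyEq ?_).congr_deriv ?_
    · filter_upwards [Ioi_mem_nhds ht] with τ hτ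
      rw [hf.mode_stokesField hν hτ]
    · have : ((|(α : ℝ)| : ℝ) : ℂ) ^ 2 = (α : ℂ) ^ 2 := by
        rw [← Complex.ofReal_pow, sq_abs]; push_cast; rfl
      rw [this]
  slip t ht α := by
    rw [wallVelocity, hf.mode_stokesField hν ht]
    exact modeSol_slip hν (abs_nonneg _) (hf.integrableOn α) (hf.continuousOn α) ht
  integrable t ht α := by
    rcases ht.eq_or_lt with h | h
    · subst h
      have : stokesField ν f 0 = f := by ext x z; simp [stokesField]
      rw [this]
      exact (hf.integrableOn α).congr_fun (fun y hy => datum_of_pos hy) measurableSet_Ioi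
    · rw [hf.mode_stokesField hν h]
      exact integrableOn_modeSol hν (abs_nonneg _) (hf.integrableOn α) (hf.continuousOn α) h
  continuousL1 t ht α := by
    refine ((tendsto_lintegral_realSol hν (abs_nonneg (α : ℝ)) (hf.integrableOn α)
      (hf.continuousOn α) t).mono_left nhdsWithin_le_nhds).congr' ?_
    filter_upwards [self_mem_nhdsWithin] with τ hτ
    refine setLIntegral_congr_fun measurableSet_Ioi fun y hy => ?_
    simp only [hf.mode_stokesField_eq_realSol hν hτ hy, hf.mode_stokesField_eq_realSol hν ht hy]

end HasDecayingData

/-! ### The datum `∂ₓ f` -/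

theorem tail_const_mul (c : ℂ) (a : ℝ) (u : ℝ → ℂ) (r : ℝ) :
    tail a (fun y => c * u y) r = c * tail a u r := by
  simp only [tail, ← integral_const_mul]
  congr 1; ext y; ring

theorem extDatum_const_mul (c : ℂ) (ν a : ℝ) (u : ℝ → ℂ) (x : ℝ) :
    extDatum ν a (fun y => c * u y) x = c * extDatum ν a u x := by
  have hm : ∀ p, mcor ν a (fun y => c * u y) p = c * mcor ν a u p := by
    intro p
    simp only [mcor, tail_const_mul]
    have : ∀ r : ℝ, (Real.exp ((1 / ν + a) * r) : ℂ) * (c * u r - a * (c * tail a u r)) =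
        c * ((Real.exp ((1 / ν + a) * r) : ℂ) * (u r - a * tail a u r)) := fun r => by ring
    simp only [this, intervalIntegral.integral_const_mul]
    ring
  simp only [extDatum, reflDatum, hm]
  split_ifs <;> ring

theorem modeSol_const_mul (c : ℂ) (ν a : ℝ) (u : ℝ → ℂ) (t : ℝ) (z : ℂ) :
    modeSol ν a (fun y => c * u y) t z = c * modeSol ν a u t z := by
  simp only [modeSol, gconv, extDatum_const_mul]
  have : ∀ x : ℝ, gker hq (Real.sqrt (ν * t)) (z - x) * (c * extDatum ν a u x) =
      c * (gker hq (Real.sqrt (ν * t)) (z - x) * extDatum ν a u x) := fun x => by ring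
  simp only [this, integral_const_mul]
  ring

theorem datum_dx {σ : ℝ} (hσ : 0 < σ) {f : Torus → ℂ → ℂ} (hf : NiceField σ f) (α : ℤ) :
    datum (dx f) α = fun y => Complex.I * α * datum f α y := by
  ext y
  by_cases hy : 0 < y
  · rw [datum_of_pos hy, datum_of_pos hy, hf.mode_dx α (ofReal_mem_pencil hσ hy)]
  · simp [datum, hy]

theorem hasDecayingData_dx {σ : ℝ} (hσ : 0 < σ) {f : Torus → ℂ → ℂ} (hn : NiceField σ f)
    (hf : HasDecayingData f) : HasDecayingData (dx f) where
  integrableOn α := by rw [datum_dx hσ hn]; exact (hf.integrableOn α).const_mul _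
  continuousOn α := by rw [datum_dx hσ hn]; exact continuousOn_const.mul (hf.continuousOn α)
  decay := by
    obtain ⟨A, ρ, hρ, h⟩ := hf.decay
    obtain ⟨D, hD, hD'⟩ := exists_abs_mul_exp_le hρ
    refine ⟨|A| * D, ρ / 2, by positivity, fun α => ?_⟩
    simp only [datum_dx hσ hn, norm_mul, Complex.norm_I, Complex.norm_intCast, one_mul,
      integral_const_mul]
    calc _ ≤ |(α : ℝ)| * (A * Real.exp (-ρ * |(α : ℝ)|)) :=
          mul_le_mul_of_nonneg_left (h α) (abs_nonneg _)
      _ ≤ |(α : ℝ)| * (|A| * Real.exp (-ρ * |(α : ℝ)|)) := by gcongr; exact le_abs_self A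
      _ = |A| * (|(α : ℝ)| * Real.exp (-ρ * |(α : ℝ)|)) := by ring
      _ ≤ |A| * (D * Real.exp (-(ρ / 2) * |(α : ℝ)|)) :=
          mul_le_mul_of_nonneg_left (hD' _) (abs_nonneg A)
      _ = _ := by ring

/-- `∂ₓ` commutes with the solution operator. -/
theorem hasDerivAt_stokesField {ν σ : ℝ} (hν : 0 < ν) (hσ : 0 < σ) {f : Torus → ℂ → ℂ}
    (hn : NiceField σ f) (hf : HasDecayingData f) {t : ℝ} (ht : 0 ≤ t) (x : Torus) {z : ℂ}
    (hz : z ∈ pencil σ) : HasDerivAt (fun h : ℝ => stokesField ν f t (x + (h : Torus)) z)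
      (stokesField ν (dx f) t x z) 0 := by
  rcases ht.eq_or_lt with h | h
  · subst h
    simp only [stokesField, le_refl, if_true]
    rw [hn.dx_eq_tsum hz]
    exact hn.hasDerivAt_dx hz x
  · simp only [stokesField, if_neg h.not_ge, datum_dx hσ hn, modeSol_const_mul]
    obtain ⟨B, ρ, hρ, hb⟩ := hf.exists_norm_modeSol_le hν |z.im| h
    exact hasDerivAt_fourierSeries hρ (hb t le_rfl z le_rfl) x

/-! ### Uniqueness for the Stokes problem -/

theorem nonneg_of_hasDerivAt_of_le_left {f : ℝ → ℝ} {f' c t : ℝ} (h : HasDerivAt f f' t)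
    (hc : c < t) (hle : ∀ τ ∈ Ioo c t, f τ ≤ f t) : 0 ≤ f' := by
  have h1 := (hasDerivWithinAt_iff_tendsto_slope' (s := Iio t) (by simp)).1 h.hasDerivWithinAt
  refine ge_of_tendsto h1 ?_
  filter_upwards [Ioo_mem_nhdsLT hc] with τ hτ
  rw [slope_def_field]
  exact div_nonneg_of_nonpos (sub_nonpos.2 (hle τ hτ)) (sub_nonpos.2 hτ.2.le)

theorem nonpos_of_hasDerivWithinAt_of_le_right {f : ℝ → ℝ} {f' c x : ℝ}
    (h : HasDerivWithinAt f f' (Ici x) x) (hc : x < c) (hle : ∀ y ∈ Ioo x c, f y ≤ f x) :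
    f' ≤ 0 := by
  have h1 := (hasDerivWithinAt_iff_tendsto_slope' (s := Ioi x) (by simp)).1
    (h.mono Ioi_subset_Ici_self)
  refine le_of_tendsto h1 ?_
  filter_upwards [Ioo_mem_nhdsGT hc] with y hy
  rw [slope_def_field]
  exact div_nonpos_of_nonpos_of_nonneg (sub_nonpos.2 (hle y hy)) (sub_nonneg.2 hy.1.le)

/-- The second derivative is nonpositive at a local maximum. -/
theorem IsLocalMax.nonpos_of_hasDerivAt {f f₁ : ℝ → ℝ} {f₂ x : ℝ} (hmax : IsLocalMax f x)
    (h1 : ∀ᶠ y in 𝓝 x, HasDerivAt f (f₁ y) y) (h2 : HasDerivAt f₁ f₂ x) : f₂ ≤ 0 := by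
  by_contra! hpos
  have e1 : deriv f =ᶠ[𝓝 x] f₁ := h1.mono fun y hy => hy.deriv
  have e2 : deriv (deriv f) x = f₂ := by rw [e1.deriv_eq, h2.deriv]
  have hmin : IsLocalMin f x := isLocalMin_of_deriv_deriv_pos (by rwa [e2]) hmax.deriv_eq_zero
    h1.self_of_nhds.continuousAt
  have e3 : f =ᶠ[𝓝 x] fun _ => f x := by
    filter_upwards [hmax, hmin] with y h h' using le_antisymm h h'
  have e4 : deriv f =ᶠ[𝓝 x] fun _ => 0 := by
    refine e3.deriv.trans (Eventually.of_forall fun y => ?_)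
    simp
  rw [e4.deriv_eq] at e2
  simp at e2
  exact hpos.ne e2

/-- A mode, on the half-line, of the difference of two solutions of the Stokes problem; `w₁` and
`w₂` are its first two spatial derivatives. -/
structure IsHalfLineSolution (ν a : ℝ) (w w₁ w₂ : ℝ → ℝ → ℂ) : Prop where
  cont : ContinuousOn (fun p : ℝ × ℝ => w p.1 p.2) (Ioi 0 ×ˢ Ici 0)
  cont₂ : ContinuousOn (fun p : ℝ × ℝ => w₂ p.1 p.2) (Ioi 0 ×ˢ Ioi 0)
  deriv₁ : ∀ t, 0 < t → ∀ y, 0 < y → HasDerivAt (w t) (w₁ t y) y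
  deriv₂ : ∀ t, 0 < t → ∀ y, 0 < y → HasDerivAt (w₁ t) (w₂ t y) y
  heat : ∀ t, 0 < t → ∀ y, 0 < y →
    HasDerivAt (fun τ => w τ y) (ν * (w₂ t y - a ^ 2 * w t y)) t
  slip : ∀ t, 0 < t → ν * w t 0 = -tail a (w t) 0
  integrable : ∀ t, 0 ≤ t → IntegrableOn (w t) (Ioi 0)
  tendsto : ∀ t, 0 ≤ t → Tendsto (fun τ => ∫⁻ y in Ioi (0 : ℝ), ‖w τ y - w t y‖ₑ)
    (𝓝[Ici 0] t) (𝓝 0)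
  initial : ∀ y, 0 < y → w 0 y = 0

/-- A cutoff of `exp (-a (y - x))` on `[x, x + R]`, with vanishing second-order data at `x + R`. -/
noncomputable def cutExp (a x R y : ℝ) : ℝ :=
  (1 - ((y - x) / R) ^ 2) ^ 2 * Real.exp (-a * (y - x))

/-- The derivative of `cutExp`. -/
noncomputable def cutExp' (a x R y : ℝ) : ℝ :=
  (-4 * ((y - x) / R) * (1 - ((y - x) / R) ^ 2) / R - a * (1 - ((y - x) / R) ^ 2) ^ 2) *
    Real.exp (-a * (y - x))

/-- The defect of `cutExp` in the equation `p'' = a² p`. -/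
noncomputable def cutErr (a x R y : ℝ) : ℝ :=
  ((12 * ((y - x) / R) ^ 2 - 4) / R ^ 2 + 8 * a * ((y - x) / R) * (1 - ((y - x) / R) ^ 2) / R) *
    Real.exp (-a * (y - x))

theorem hasDerivAt_cutExp (a x R y : ℝ) : HasDerivAt (cutExp a x R) (cutExp' a x R y) y := by
  have h0 : HasDerivAt (fun y => (y - x) / R) (1 / R) y := ((hasDerivAt_id y).sub_const x).div_const R
  have h1 := (((h0.fun_pow 2).const_sub 1).fun_pow 2).fun_mul
    (((((hasDerivAt_id y).sub_const x).const_mul (-a))).exp)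
  refine h1.congr_deriv ?_
  simp only [cutExp', id, show 2 - 1 = 1 from rfl, pow_one]
  push_cast
  ring

theorem hasDerivAt_cutExp' (a x R y : ℝ) :
    HasDerivAt (cutExp' a x R) (cutErr a x R y + a ^ 2 * cutExp a x R y) y := by
  have h0 : HasDerivAt (fun y => (y - x) / R) (1 / R) y := ((hasDerivAt_id y).sub_const x).div_const R
  have h2 := (h0.fun_pow 2).const_sub 1
  have h1 := ((((h0.const_mul (-4)).fun_mul h2).div_const R).fun_sub
    ((h2.fun_pow 2).const_mul a)).fun_mul (((((hasDerivAt_id y).sub_const x).const_mul (-a))).exp)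
  refine h1.congr_deriv ?_
  simp only [cutErr, cutExp, id, show 2 - 1 = 1 from rfl, pow_one]
  push_cast
  ring

theorem abs_cutErr_le {a x R y : ℝ} (ha : 0 ≤ a) (hR : 1 ≤ R) (hy : y ∈ Icc x (x + R)) :
    |cutErr a x R y| ≤ (8 + 8 * a) / R := by
  have hR0 : 0 < R := one_pos.trans_le hR
  set s := (y - x) / R with hs
  have hs0 : 0 ≤ s := div_nonneg (sub_nonneg.2 hy.1) hR0.le
  have hs1 : s ≤ 1 := (div_le_one hR0).2 (by linarith [hy.2])
  have he : Real.exp (-a * (y - x)) ≤ 1 := exp_neg_mul_le_one ha (sub_nonneg.2 hy.1)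
  have h1 : |(12 * s ^ 2 - 4) / R ^ 2| ≤ 8 / R := by
    rw [abs_div, abs_of_pos (by positivity : 0 < R ^ 2), div_le_div_iff₀ (by positivity) hR0]
    have : |12 * s ^ 2 - 4| ≤ 8 := abs_le.2 ⟨by nlinarith, by nlinarith⟩
    nlinarith [abs_nonneg (12 * s ^ 2 - 4)]
  have h2 : |8 * a * s * (1 - s ^ 2) / R| ≤ 8 * a / R := by
    have h3 : 0 ≤ 1 - s ^ 2 := by nlinarith
    rw [abs_of_nonneg (by positivity)]
    have h4 : s * (1 - s ^ 2) ≤ 1 := by nlinarith [sq_nonneg s]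
    refine div_le_div_of_nonneg_right ?_ hR0.le
    calc 8 * a * s * (1 - s ^ 2) = 8 * a * (s * (1 - s ^ 2)) := by ring
      _ ≤ 8 * a * 1 := by gcongr
      _ = 8 * a := mul_one _
  rw [cutErr, abs_mul, abs_of_pos (Real.exp_pos _), ← hs]
  calc _ ≤ |(12 * s ^ 2 - 4) / R ^ 2 + 8 * a * s * (1 - s ^ 2) / R| * 1 := by gcongr
    _ ≤ 8 / R + 8 * a / R := by rw [mul_one]; exact (abs_add_le _ _).trans (add_le_add h1 h2)
    _ = _ := by ring

namespace IsHalfLineSolution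

variable {ν a : ℝ} {w w₁ w₂ : ℝ → ℝ → ℂ}

theorem continuousOn_section (h : IsHalfLineSolution ν a w w₁ w₂) {t : ℝ} (ht : 0 < t) :
    ContinuousOn (w t) (Ici 0) :=
  h.cont.comp (f := fun y : ℝ => (t, y)) (by fun_prop) fun _ hy => ⟨ht, hy⟩

theorem tendsto_dist (h : IsHalfLineSolution ν a w w₁ w₂) {t : ℝ} (ht : 0 ≤ t) :
    Tendsto (fun τ => ∫ y in Ioi (0 : ℝ), ‖w τ y - w t y‖) (𝓝[Ici 0] t) (𝓝 0) := by
  have h1 := (ENNReal.tendsto_toReal (ENNReal.zero_ne_top)).comp (h.tendsto t ht)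
  refine h1.congr' ?_
  filter_upwards [self_mem_nhdsWithin] with τ hτ
  exact (integral_norm_eq_lintegral_enorm ((h.integrable τ hτ).sub (h.integrable t ht)).1).symm

theorem norm_tail_sub_le (h : IsHalfLineSolution ν a w w₁ w₂) (ha : 0 ≤ a) {t τ x : ℝ} (ht : 0 ≤ t)
    (hτ : 0 ≤ τ) (hx : 0 ≤ x) :
    ‖tail a (w τ) x - tail a (w t) x‖ ≤ ∫ y in Ioi (0 : ℝ), ‖w τ y - w t y‖ := by
  have hs := (h.integrable τ hτ).sub (h.integrable t ht)
  have h1 : tail a (w τ) x - tail a (w t) x = tail a (fun y => w τ y - w t y) x := by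
    simp only [tail]
    rw [← integral_sub (integrableOn_exp_mul ha (h.integrable τ hτ) hx)
      (integrableOn_exp_mul ha (h.integrable t ht) hx)]
    simp only [mul_sub]
  rw [h1]
  exact norm_tail_le ha hs hx

theorem continuousOn_tail (h : IsHalfLineSolution ν a w w₁ w₂) (ha : 0 ≤ a) :
    ContinuousOn (fun p : ℝ × ℝ => tail a (w p.1) p.2) (Ici 0 ×ˢ Ici 0) := by
  rintro ⟨t, x⟩ ⟨ht, hx⟩
  have hx : 0 ≤ x := hx
  have ht : 0 ≤ t := ht
  have hcx : ContinuousOn (tail a (w t)) (Ici 0) := by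
    rcases ht.eq_or_lt with h0 | h0
    · subst h0
      refine ContinuousOn.congr (f := fun _ => 0) continuousOn_const fun y hy => ?_
      refine setIntegral_eq_zero_of_forall_eq_zero fun y' hy' => ?_
      rw [h.initial y' (lt_of_le_of_lt hy hy'), mul_zero]
    · exact (tail_primitive ha (h.integrable t ht)
        ((h.continuousOn_section h0).mono Ioi_subset_Ici_self)).1
  have h1 : Tendsto (fun p : ℝ × ℝ => tail a (w t) p.2) (𝓝[Ici 0 ×ˢ Ici 0] (t, x))
      (𝓝 (tail a (w t) x)) := by
    have h2 : Tendsto Prod.snd (𝓝[Ici 0 ×ˢ Ici 0] (t, x)) (𝓝[Ici 0] x) := by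
      rw [nhdsWithin_prod_eq]; exact tendsto_snd
    exact (hcx x hx).tendsto.comp h2
  have h3 : Tendsto (fun p : ℝ × ℝ => tail a (w p.1) p.2 - tail a (w t) p.2)
      (𝓝[Ici 0 ×ˢ Ici 0] (t, x)) (𝓝 0) := by
    have h2 : Tendsto Prod.fst (𝓝[Ici 0 ×ˢ Ici 0] (t, x)) (𝓝[Ici 0] t) := by
      rw [nhdsWithin_prod_eq]; exact tendsto_fst
    refine squeeze_zero_norm' ?_ ((h.tendsto_dist ht).comp h2)
    filter_upwards [self_mem_nhdsWithin] with p hp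
    exact h.norm_tail_sub_le ha ht hp.1 hp.2
  have h4 := h3.add h1
  simp only [sub_add_cancel, zero_add] at h4
  exact h4

theorem continuousOn_norm (h : IsHalfLineSolution ν a w w₁ w₂) :
    ContinuousOn (fun t => ∫ y in Ioi (0 : ℝ), ‖w t y‖) (Ici 0) := by
  intro t ht
  have ht : 0 ≤ t := ht
  refine tendsto_iff_dist_tendsto_zero.2 (squeeze_zero' (Eventually.of_forall fun _ => dist_nonneg)
    ?_ (h.tendsto_dist ht))
  filter_upwards [self_mem_nhdsWithin] with τ hτ
  rw [Real.dist_eq, ← integral_sub (h.integrable τ hτ).norm (h.integrable t ht).norm]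
  refine (abs_integral_le_integral_abs).trans (integral_mono
    ((h.integrable τ hτ).norm.sub (h.integrable t ht).norm).abs
    ((h.integrable τ hτ).sub (h.integrable t ht)).norm fun y => ?_)
  exact abs_norm_sub_norm_le _ _

theorem exists_integral_norm_le (h : IsHalfLineSolution ν a w w₁ w₂) (T : ℝ) :
    ∃ A : ℝ, 0 ≤ A ∧ ∀ t ∈ Icc 0 T, ∫ y in Ioi (0 : ℝ), ‖w t y‖ ≤ A := by
  obtain ⟨A, hA⟩ := isCompact_Icc.exists_bound_of_continuousOn
    (h.continuousOn_norm.mono (fun _ ht => ht.1 : Icc 0 T ⊆ Ici 0))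
  exact ⟨|A|, abs_nonneg A, fun t ht => (le_abs_self _).trans ((hA t ht).trans (le_abs_self A))⟩

theorem uIcc_subset {x R : ℝ} (hx : 0 < x) (hR : 0 ≤ R) : uIcc x (x + R) ⊆ Ioi 0 := by
  rw [uIcc_of_le (by linarith)]
  exact fun y hy => hx.trans_le hy.1

theorem continuousOn_section₂ (h : IsHalfLineSolution ν a w w₁ w₂) {t : ℝ} (ht : 0 < t) :
    ContinuousOn (w₂ t) (Ioi 0) :=
  h.cont₂.comp (f := fun y : ℝ => (t, y)) (by fun_prop) fun _ hy => ⟨ht, hy⟩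

theorem continuous_cutExp (a x R : ℝ) : Continuous (cutExp a x R) := by
  unfold cutExp; fun_prop

theorem continuous_cutErr (a x R : ℝ) : Continuous (cutErr a x R) := by
  unfold cutErr; fun_prop

theorem integral_cutExp_mul (h : IsHalfLineSolution ν a w w₁ w₂) {t x R : ℝ} (ht : 0 < t)
    (hx : 0 < x) (hR : 0 < R) :
    ∫ y in x..x + R, (cutExp a x R y : ℂ) * (ν * (w₂ t y - a ^ 2 * w t y)) =
      ν * (-(w₁ t x + a * w t x) + ∫ y in x..x + R, (cutErr a x R y : ℂ) * w t y) := by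
  have hs := uIcc_subset hx hR.le
  have c0 := ((h.continuousOn_section ht).mono Ioi_subset_Ici_self).mono hs
  have c2 := (h.continuousOn_section₂ ht).mono hs
  have hp : Continuous fun y => (cutExp a x R y : ℂ) :=
    Complex.continuous_ofReal.comp (continuous_cutExp a x R)
  have he : Continuous fun y => (cutErr a x R y : ℂ) :=
    Complex.continuous_ofReal.comp (continuous_cutErr a x R)
  have hd : ∀ y ∈ uIcc x (x + R), HasDerivAt (fun y => (cutExp a x R y : ℂ) * w₁ t y -
      (cutExp' a x R y : ℂ) * w t y) ((cutExp a x R y : ℂ) * (w₂ t y - a ^ 2 * w t y) -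
        (cutErr a x R y : ℂ) * w t y) y := by
    intro y hy
    have := ((hasDerivAt_cutExp a x R y).ofReal_comp.mul (h.deriv₂ t ht y (hs hy))).sub
      ((hasDerivAt_cutExp' a x R y).ofReal_comp.mul (h.deriv₁ t ht y (hs hy)))
    refine this.congr_deriv ?_
    push_cast; ring
  have i1 : IntervalIntegrable (fun y => (cutExp a x R y : ℂ) * (w₂ t y - a ^ 2 * w t y))
      volume x (x + R) :=
    (hp.continuousOn.mul (c2.sub (continuousOn_const.mul c0))).intervalIntegrable
  have i2 : IntervalIntegrable (fun y => (cutErr a x R y : ℂ) * w t y) volume x (x + R) :=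
    (he.continuousOn.mul c0).intervalIntegrable
  have h1 := intervalIntegral.integral_eq_sub_of_hasDerivAt hd (i1.sub i2)
  rw [intervalIntegral.integral_sub i1 i2] at h1
  have e1 : ∀ y : ℝ, (cutExp a x R y : ℂ) * (ν * (w₂ t y - a ^ 2 * w t y)) =
      ν * ((cutExp a x R y : ℂ) * (w₂ t y - a ^ 2 * w t y)) := fun y => by ring
  simp only [e1, intervalIntegral.integral_const_mul]
  have v1 : cutExp a x R (x + R) = 0 := by simp [cutExp, hR.ne']
  have v2 : cutExp' a x R (x + R) = 0 := by simp [cutExp', hR.ne']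
  have v3 : cutExp a x R x = 1 := by simp [cutExp]
  have v4 : cutExp' a x R x = -a := by simp [cutExp']
  simp only [v1, v2, v3, v4] at h1
  push_cast at h1
  linear_combination ν * h1

theorem hasDerivAt_integral_cutExp (h : IsHalfLineSolution ν a w w₁ w₂) {t x R : ℝ} (ht : 0 < t)
    (hx : 0 < x) (hR : 0 < R) :
    HasDerivAt (fun τ => ∫ y in x..x + R, (cutExp a x R y : ℂ) * w τ y)
      (∫ y in x..x + R, (cutExp a x R y : ℂ) * (ν * (w₂ t y - a ^ 2 * w t y))) t := by
  have hs := uIcc_subset hx hR.le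
  have hp : Continuous fun y => (cutExp a x R y : ℂ) :=
    Complex.continuous_ofReal.comp (continuous_cutExp a x R)
  have hK : IsCompact (Icc (t / 2) (2 * t) ×ˢ uIcc x (x + R)) := isCompact_Icc.prod isCompact_uIcc
  have hsub : Icc (t / 2) (2 * t) ×ˢ uIcc x (x + R) ⊆ Ioi (0 : ℝ) ×ˢ Ioi (0 : ℝ) :=
    prod_mono (fun τ hτ => (half_pos ht).trans_le hτ.1) hs
  have hsub' : Ioi (0 : ℝ) ×ˢ Ioi (0 : ℝ) ⊆ Ioi (0 : ℝ) ×ˢ Ici (0 : ℝ) :=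
    prod_mono subset_rfl Ioi_subset_Ici_self
  obtain ⟨B, hB⟩ := hK.exists_bound_of_continuousOn
    (f := fun p : ℝ × ℝ => (cutExp a x R p.2 : ℂ) * (ν * (w₂ p.1 p.2 - a ^ 2 * w p.1 p.2)))
    (((hp.comp continuous_snd).continuousOn).mul (continuousOn_const.mul
      ((h.cont₂.mono hsub).sub (continuousOn_const.mul (h.cont.mono (hsub.trans hsub'))))))
  have hmeas : ∀ τ, 0 < τ → ContinuousOn (fun y => (cutExp a x R y : ℂ) * w τ y)
      (uIcc x (x + R)) := fun τ hτ =>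
    hp.continuousOn.mul (((h.continuousOn_section hτ).mono Ioi_subset_Ici_self).mono hs)
  refine (intervalIntegral.hasDerivAt_integral_of_dominated_loc_of_deriv_le
    (F := fun τ y => (cutExp a x R y : ℂ) * w τ y) (bound := fun _ => B)
    (F' := fun τ y => (cutExp a x R y : ℂ) * (ν * (w₂ τ y - a ^ 2 * w τ y)))
    (Icc_mem_nhds (by linarith : t / 2 < t) (by linarith : t < 2 * t)) ?_
    (hmeas t ht).intervalIntegrable ?_ ?_ intervalIntegrable_const ?_).2
  · filter_upwards [Ioi_mem_nhds ht] with τ hτ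
    exact ((hmeas τ hτ).mono uIoc_subset_uIcc).aestronglyMeasurable measurableSet_uIoc
  · refine ContinuousOn.aestronglyMeasurable ?_ measurableSet_uIoc
    exact hp.continuousOn.mul (continuousOn_const.mul
      (((h.continuousOn_section₂ ht).mono (uIoc_subset_uIcc.trans hs)).sub
      (continuousOn_const.mul (((h.continuousOn_section ht).mono Ioi_subset_Ici_self).mono
        (uIoc_subset_uIcc.trans hs)))))
  · exact Eventually.of_forall fun y hy τ hτ => hB (τ, y) ⟨hτ, uIoc_subset_uIcc hy⟩
  · refine Eventually.of_forall fun y hy τ hτ => ?_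
    exact (h.heat τ ((half_pos ht).trans_le hτ.1) y (hs (uIoc_subset_uIcc hy))).const_mul _

theorem tendsto_integral_cutExp (h : IsHalfLineSolution ν a w w₁ w₂) (ha : 0 ≤ a) {t x : ℝ}
    (ht : 0 < t) (hx : 0 < x) :
    Tendsto (fun R => ∫ y in x..x + R, (cutExp a x R y : ℂ) * w t y) atTop
      (𝓝 (tail a (w t) x)) := by
  have hi := (h.integrable t ht.le).mono_set (Ioi_subset_Ioi hx.le)
  have h1 : Tendsto (fun R => ∫ y in Ioi x, (Ioc x (x + R)).indicator
      (fun y => (cutExp a x R y : ℂ) * w t y) y) atTop (𝓝 (tail a (w t) x)) := by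
    refine tendsto_integral_filter_of_dominated_convergence (fun y => ‖w t y‖) ?_ ?_ hi.norm ?_
    · refine Eventually.of_forall fun R => AEStronglyMeasurable.indicator ?_ measurableSet_Ioc
      exact (Complex.continuous_ofReal.comp (continuous_cutExp a x R)).aestronglyMeasurable.mul hi.1
    · filter_upwards [eventually_gt_atTop 0] with R hR
      refine Eventually.of_forall fun y => ?_
      by_cases hy : y ∈ Ioc x (x + R)
      · rw [indicator_of_mem hy, norm_mul, Complex.norm_real, Real.norm_eq_abs, cutExp, abs_mul,
          abs_of_pos (Real.exp_pos _), abs_of_nonneg (sq_nonneg _)]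
        refine mul_le_of_le_one_left (norm_nonneg _) ?_
        have hs0 : 0 ≤ (y - x) / R := div_nonneg (sub_nonneg.2 hy.1.le) hR.le
        have hs1 : (y - x) / R ≤ 1 := (div_le_one hR).2 (by linarith [hy.2])
        have he := exp_neg_mul_le_one ha (sub_nonneg.2 hy.1.le)
        refine mul_le_one₀ ?_ (Real.exp_pos _).le he
        rw [sq_le_one_iff_abs_le_one, abs_le]
        constructor <;> nlinarith
      · rw [indicator_of_notMem hy, norm_zero]; exact norm_nonneg _
    · refine (ae_restrict_iff' measurableSet_Ioi).2 (Eventually.of_forall fun y hy => ?_)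
      have h2 : Tendsto (fun R : ℝ => (cutExp a x R y : ℂ) * w t y) atTop
          (𝓝 ((Real.exp (-a * (y - x)) : ℂ) * w t y)) := by
        refine Tendsto.mul_const _ ((Complex.continuous_ofReal.tendsto _).comp ?_)
        have h3 : Tendsto (fun R : ℝ => (y - x) / R) atTop (𝓝 0) :=
          tendsto_const_nhds.div_atTop tendsto_id
        have h4 := (((h3.pow 2).const_sub 1).pow 2).mul_const (Real.exp (-a * (y - x)))
        simpa [cutExp] using h4
      refine h2.congr' ?_
      filter_upwards [eventually_ge_atTop (y - x)] with R hR
      rw [indicator_of_mem (show y ∈ Ioc x (x + R) from ⟨hy, by linarith⟩)]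
  refine h1.congr' ?_
  filter_upwards [eventually_gt_atTop 0] with R hR
  rw [setIntegral_indicator measurableSet_Ioc, intervalIntegral.integral_of_le (by linarith),
    inter_eq_right.2 Ioc_subset_Ioi_self]

/-- The time derivative of the weighted primitive `tail a (w t)`. As nothing is known about the
integrability of `w₂`, the exponential is replaced by the cutoffs `cutExp`, integrated by parts
twice, and the defect `cutErr` tends to zero as `R → ∞`, locally uniformly in time. -/
theorem hasDerivAt_tail_time (h : IsHalfLineSolution ν a w w₁ w₂) (ha : 0 ≤ a) {t x : ℝ}
    (ht : 0 < t) (hx : 0 < x) :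
    HasDerivAt (fun τ => tail a (w τ) x) (-ν * (w₁ t x + a * w t x)) t := by
  obtain ⟨A, hA0, hA⟩ := h.exists_integral_norm_le (2 * t)
  refine hasDerivAt_of_tendstoLocallyUniformlyOn (l := (atTop : Filter ℝ))
    (s := Ioo (t / 2) (2 * t)) isOpen_Ioo
    (f := fun R τ => ∫ y in x..x + R, (cutExp a x R y : ℂ) * w τ y)
    (f' := fun R τ => ν * (-(w₁ τ x + a * w τ x) + ∫ y in x..x + R, (cutErr a x R y : ℂ) * w τ y))
    (g' := fun τ => -ν * (w₁ τ x + a * w τ x)) ?_ ?_ ?_ ⟨by linarith, by linarith⟩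
  · refine TendstoUniformlyOn.tendstoLocallyUniformlyOn ?_
    rw [Metric.tendstoUniformlyOn_iff]
    intro ε hε
    have h1 : Tendsto (fun R : ℝ => |ν| * ((8 + 8 * a) / R * A)) atTop (𝓝 0) := by
      have : Tendsto (fun R : ℝ => (8 + 8 * a) / R) atTop (𝓝 0) :=
        tendsto_const_nhds.div_atTop tendsto_id
      simpa using (this.mul_const A).const_mul |ν|
    filter_upwards [h1.eventually_lt_const hε, eventually_ge_atTop 1] with R hR hR1 τ hτ
    have hτ0 : 0 < τ := (half_pos ht).trans hτ.1
    refine lt_of_le_of_lt ?_ hR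
    have e1 : -ν * (w₁ τ x + a * w τ x) - ν * (-(w₁ τ x + a * w τ x) +
        ∫ y in x..x + R, (cutErr a x R y : ℂ) * w τ y) =
        -(ν * ∫ y in x..x + R, (cutErr a x R y : ℂ) * w τ y) := by ring
    rw [dist_eq_norm, e1, norm_neg, norm_mul, Complex.norm_real, Real.norm_eq_abs]
    refine mul_le_mul_of_nonneg_left ?_ (abs_nonneg ν)
    rw [intervalIntegral.integral_of_le (by linarith)]
    have hi := (h.integrable τ hτ0.le)
    have hsub : Ioc x (x + R) ⊆ Ioi 0 := fun y hy => hx.trans hy.1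
    calc _ ≤ ∫ y in Ioc x (x + R), (8 + 8 * a) / R * ‖w τ y‖ := by
          refine norm_integral_le_of_norm_le ((hi.mono_set hsub).norm.const_mul _)
            ((ae_restrict_iff' measurableSet_Ioc).2 (Eventually.of_forall fun y hy => ?_))
          rw [norm_mul, Complex.norm_real, Real.norm_eq_abs]
          gcongr
          exact abs_cutErr_le ha hR1 (Ioc_subset_Icc_self hy)
      _ ≤ _ := by
          rw [integral_const_mul]
          refine mul_le_mul_of_nonneg_left ?_ (by positivity)
          exact (setIntegral_mono_set hi.norm (Eventually.of_forall fun y => norm_nonneg _)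
            hsub.eventuallyLE).trans (hA τ ⟨hτ0.le, hτ.2.le⟩)
  · filter_upwards [eventually_gt_atTop 0] with R hR τ hτ
    have hτ0 : 0 < τ := (half_pos ht).trans hτ.1
    rw [← h.integral_cutExp_mul hτ0 hx hR]
    exact h.hasDerivAt_integral_cutExp hτ0 hx hR
  · intro τ hτ
    exact h.tendsto_integral_cutExp ha ((half_pos ht).trans hτ.1) hx

theorem hasDerivAt_tail_space (h : IsHalfLineSolution ν a w w₁ w₂) (ha : 0 ≤ a) {t x : ℝ}
    (ht : 0 < t) (hx : 0 < x) :
    HasDerivAt (tail a (w t)) (a * tail a (w t) x - w t x) x :=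
  (tail_primitive ha (h.integrable t ht.le)
    ((h.continuousOn_section ht).mono Ioi_subset_Ici_self)).2 x hx

/-- The slip condition is a Robin condition for the weighted primitive. -/
theorem hasDerivWithinAt_tail_zero (h : IsHalfLineSolution ν a w w₁ w₂) (hν : 0 < ν) (ha : 0 ≤ a)
    {t : ℝ} (ht : 0 < t) :
    HasDerivWithinAt (tail a (w t)) ((a + 1 / ν : ℝ) * tail a (w t) 0) (Ici 0) 0 := by
  have hc := h.continuousOn_section ht
  have htc := (tail_primitive ha (h.integrable t ht.le) (hc.mono Ioi_subset_Ici_self)).1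
  have e : ((a + 1 / ν : ℝ) : ℂ) * tail a (w t) 0 = a * tail a (w t) 0 - w t 0 := by
    have hν' : (ν : ℂ) ≠ 0 := by exact_mod_cast hν.ne'
    have := h.slip t ht
    push_cast
    field_simp
    linear_combination this
  rw [e]
  refine hasDerivWithinAt_Ici_of_tendsto_deriv (s := Ioi 0)
    (fun x hx => (h.hasDerivAt_tail_space ha ht hx).differentiableAt.differentiableWithinAt)
    ((htc 0 self_mem_Ici).mono Ioi_subset_Ici_self) self_mem_nhdsWithin ?_
  have h1 : Tendsto (fun x => a * tail a (w t) x - w t x) (𝓝[>] 0)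
      (𝓝 (a * tail a (w t) 0 - w t 0)) :=
    (((htc 0 self_mem_Ici).mono Ioi_subset_Ici_self).tendsto.const_mul _).sub
      ((hc 0 self_mem_Ici).mono Ioi_subset_Ici_self).tendsto
  refine h1.congr' ?_
  filter_upwards [self_mem_nhdsWithin] with x hx
  exact (h.hasDerivAt_tail_space ha ht hx).deriv.symm

/-- The maximum principle for the weighted primitive, which solves the heat equation with a Robin
condition and zero datum. A positive value would persist after subtraction of
`ε ((1 + 2ν) t + x²)`, whose time derivative exceeds `ν` times its second spatial derivative, and the
difference would attain a maximum at a positive time. -/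
theorem re_mul_tail_nonpos (h : IsHalfLineSolution ν a w w₁ w₂) (hν : 0 < ν) (ha : 0 ≤ a)
    (ζ : ℂ) {t₀ x₀ : ℝ} (ht₀ : 0 < t₀) (hx₀ : 0 ≤ x₀) : (ζ * tail a (w t₀) x₀).re ≤ 0 := by
  by_contra! hpos
  obtain ⟨A, hA0, hA⟩ := h.exists_integral_norm_le t₀
  obtain ⟨ε, hε, hε'⟩ : ∃ ε : ℝ, 0 < ε ∧
      ε * ((1 + 2 * ν) * t₀ + x₀ ^ 2) < (ζ * tail a (w t₀) x₀).re := by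
    have hd : 0 < (1 + 2 * ν) * t₀ + x₀ ^ 2 := by positivity
    refine ⟨(ζ * tail a (w t₀) x₀).re / (2 * ((1 + 2 * ν) * t₀ + x₀ ^ 2)), by positivity, ?_⟩
    rw [div_mul_eq_mul_div, div_lt_iff₀ (by positivity)]
    nlinarith
  set v : ℝ → ℝ → ℝ := fun t x => (ζ * tail a (w t) x).re - ε * ((1 + 2 * ν) * t + x ^ 2) with hv
  have hv0 : 0 < v t₀ x₀ := sub_pos.2 hε'
  have hbd : ∀ t ∈ Icc 0 t₀, ∀ x, 0 ≤ x → (ζ * tail a (w t) x).re ≤ ‖ζ‖ * A := by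
    intro t ht x hx
    refine (Complex.re_le_norm _).trans ?_
    rw [norm_mul]
    exact mul_le_mul_of_nonneg_left ((norm_tail_le ha (h.integrable t ht.1) hx).trans (hA t ht))
      (norm_nonneg _)
  -- Beyond `L` the penalization makes `v` nonpositive.
  obtain ⟨L, hL0, hL⟩ : ∃ L : ℝ, x₀ ≤ L ∧ ‖ζ‖ * A < ε * L ^ 2 := by
    refine ⟨max (max x₀ 1) (‖ζ‖ * A / ε + 1), (le_max_left _ _).trans (le_max_left _ _), ?_⟩
    set L := max (max x₀ 1) (‖ζ‖ * A / ε + 1)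
    have h1 : 1 ≤ L := (le_max_right _ _).trans (le_max_left _ _)
    have h2 : ‖ζ‖ * A / ε + 1 ≤ L := le_max_right _ _
    have h3 : ‖ζ‖ * A / ε < L ^ 2 := by nlinarith
    rw [div_lt_iff₀ hε] at h3
    linarith
  have hvc : ContinuousOn (fun p : ℝ × ℝ => v p.1 p.2) (Icc 0 t₀ ×ˢ Icc 0 L) := by
    refine ContinuousOn.sub ?_ (Continuous.continuousOn (by fun_prop))
    refine Complex.continuous_re.comp_continuousOn (continuousOn_const.mul ?_)
    exact (h.continuousOn_tail ha).mono (prod_mono (fun _ h => h.1) (fun _ h => h.1))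
  obtain ⟨⟨t, x⟩, ⟨ht, hx⟩, hmax⟩ := (isCompact_Icc.prod isCompact_Icc).exists_isMaxOn
    ⟨(t₀, x₀), ⟨⟨ht₀.le, le_rfl⟩, ⟨hx₀, hL0⟩⟩⟩ hvc
  simp only at ht hx
  have hmax' : ∀ τ ∈ Icc 0 t₀, ∀ y ∈ Icc 0 L, v τ y ≤ v t x := fun τ hτ y hy =>
    hmax (show (τ, y) ∈ Icc 0 t₀ ×ˢ Icc 0 L from ⟨hτ, hy⟩)
  have hvt : 0 < v t x := hv0.trans_le (hmax' _ ⟨ht₀.le, le_rfl⟩ _ ⟨hx₀, hL0⟩)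
  have ht0 : 0 < t := by
    rcases ht.1.eq_or_lt with h0 | h0
    · exfalso
      have : tail a (w t) x = 0 := by
        rw [← h0]
        refine setIntegral_eq_zero_of_forall_eq_zero fun y hy => ?_
        rw [h.initial y (lt_of_le_of_lt hx.1 hy), mul_zero]
      simp only [hv, this, mul_zero, Complex.zero_re] at hvt
      have h3 : 0 ≤ ε * ((1 + 2 * ν) * t + x ^ 2) := by have := ht.1; positivity
      linarith
    · exact h0
  have hpt : 0 < (ζ * tail a (w t) x).re := by
    have h3 : 0 ≤ ε * ((1 + 2 * ν) * t + x ^ 2) := by positivity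
    simp only [hv] at hvt
    linarith
  have hxL : x < L := by
    rcases hx.2.eq_or_lt with h0 | h0
    · exfalso
      have h1 := hbd t ht x hx.1
      simp only [hv] at hvt
      rw [h0] at h1 hvt
      have h3 : 0 ≤ ε * ((1 + 2 * ν) * t) := by positivity
      nlinarith
    · exact h0
  have hre : ∀ {g : ℝ → ℂ} {g' : ℂ} {s : Set ℝ} {y : ℝ}, HasDerivWithinAt g g' s y →
      HasDerivWithinAt (fun y => (ζ * g y).re) (ζ * g').re s y := fun hg =>
    Complex.reCLM.hasFDerivAt.comp_hasDerivWithinAt _ (hg.const_mul ζ)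
  rcases hx.1.eq_or_lt with h0 | h0
  · -- At the wall the Robin condition forces `v` to increase into the domain.
    subst h0
    have h1 := (hre (h.hasDerivWithinAt_tail_zero hν ha ht0)).sub
      ((((hasDerivWithinAt_id (0 : ℝ) (Ici 0)).fun_pow 2).const_add ((1 + 2 * ν) * t)).const_mul ε)
    have h2 := nonpos_of_hasDerivWithinAt_of_le_right h1 hxL fun y hy =>
      hmax' t ht y ⟨hy.1.le, hy.2.le⟩
    have e : ζ * ((a + 1 / ν : ℝ) * tail a (w t) 0) =
        (a + 1 / ν : ℝ) * (ζ * tail a (w t) 0) := by ring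
    rw [e, Complex.re_ofReal_mul] at h2
    have h3 : 0 < (a + 1 / ν) * (ζ * tail a (w t) 0).re := by positivity
    simp at h2
    norm_num at h3
    linarith
  · -- In the interior, `∂ₓ² v ≤ 0 ≤ ∂ₜ v` contradicts the heat equation.
    have d1 : ∀ y, 0 < y → HasDerivAt (v t)
        ((ζ * (a * tail a (w t) y - w t y)).re - ε * (2 * y)) y := by
      intro y hy
      have h1 := ((hre (h.hasDerivAt_tail_space ha ht0 hy).hasDerivWithinAt).hasDerivAt
        univ_mem).sub ((((hasDerivAt_id y).fun_pow 2).const_add ((1 + 2 * ν) * t)).const_mul ε)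
      refine h1.congr_deriv ?_
      simp
    have d2 : HasDerivAt (fun y => (ζ * (a * tail a (w t) y - w t y)).re - ε * (2 * y))
        ((ζ * (a * (a * tail a (w t) x - w t x) - w₁ t x)).re - ε * 2) x := by
      have h1 := ((hre (((h.hasDerivAt_tail_space ha ht0 h0).const_mul (a : ℂ)).sub
        (h.deriv₁ t ht0 x h0)).hasDerivWithinAt).hasDerivAt
        univ_mem).sub (((hasDerivAt_id x).const_mul 2).const_mul ε)
      refine h1.congr_deriv ?_
      simp
    have hlm : IsLocalMax (v t) x := by
      filter_upwards [Icc_mem_nhds h0 hxL] with y hy using hmax' t ht y hy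
    have h2 := hlm.nonpos_of_hasDerivAt
      (by filter_upwards [Ioi_mem_nhds h0] with y hy using d1 y hy) d2
    have d3 : HasDerivAt (fun τ => v τ x)
        ((ζ * (-ν * (w₁ t x + a * w t x))).re - ε * (1 + 2 * ν)) t := by
      have h1 := ((hre (h.hasDerivAt_tail_time ha ht0 h0).hasDerivWithinAt).hasDerivAt
        univ_mem).sub ((((hasDerivAt_id t).const_mul (1 + 2 * ν)).add_const (x ^ 2)).const_mul ε)
      refine h1.congr_deriv ?_
      simp
    have h3 := nonneg_of_hasDerivAt_of_le_left d3 ht0 fun τ hτ =>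
      hmax' τ ⟨hτ.1.le, hτ.2.le.trans ht.2⟩ x hx
    have e : (ζ * (-ν * (w₁ t x + a * w t x))).re =
        ν * ((ζ * (a * (a * tail a (w t) x - w t x) - w₁ t x)).re -
          a ^ 2 * (ζ * tail a (w t) x).re) := by
      rw [← Complex.re_ofReal_mul (a ^ 2), ← Complex.sub_re, ← Complex.re_ofReal_mul]
      congr 1
      push_cast; ring
    rw [e] at h3
    have h4 : 0 ≤ ν * (a ^ 2 * (ζ * tail a (w t) x).re) := by positivity
    nlinarith

theorem eq_zero (h : IsHalfLineSolution ν a w w₁ w₂) (hν : 0 < ν) (ha : 0 ≤ a) {t y : ℝ}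
    (ht : 0 < t) (hy : 0 < y) : w t y = 0 := by
  have h1 : ∀ x, 0 ≤ x → tail a (w t) x = 0 := by
    intro x hx
    -- With the conjugate of the value as the factor `ζ`, the real part is the squared modulus.
    have := h.re_mul_tail_nonpos hν ha ((starRingEnd ℂ) (tail a (w t) x)) ht hx
    rw [← Complex.normSq_eq_conj_mul_self, Complex.ofReal_re] at this
    exact Complex.normSq_eq_zero.1 (le_antisymm this (Complex.normSq_nonneg _))
  have h2 := h.hasDerivAt_tail_space ha ht hy
  have h3 : tail a (w t) =ᶠ[𝓝 y] fun _ => 0 := by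
    filter_upwards [Ioi_mem_nhds hy] with x hx using h1 x (le_of_lt hx)
  have h4 := h2.unique ((hasDerivAt_const y (0 : ℂ)).congr_of_eventuallyEq h3)
  rw [h1 y hy.le, mul_zero, zero_sub, neg_eq_zero] at h4
  exact h4

end IsHalfLineSolution

namespace StokesSlip.IsStokesSolution

variable {ν σ : ℝ} {f : Torus → ℂ → ℂ} {ω ω' : ℝ → Torus → ℂ → ℂ}

theorem isAnalyticField (h : IsStokesSolution ν σ f ω) {t : ℝ} (ht : 0 < t) :
    IsAnalyticField σ (ω t) where
  continuousOn := h.continuousOn.comp (f := fun p : Torus × ℂ => (t, p.1, p.2)) (by fun_prop)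
    fun p hp => ⟨ht, trivial, mem_insert_of_mem _ hp.2⟩
  holomorphic := h.holomorphic t ht

theorem continuousOn_mode (h : IsStokesSolution ν σ f ω) (α : ℤ) :
    ContinuousOn (fun p : ℝ × ℂ => mode (ω p.1) α p.2) (Ioi 0 ×ˢ insert 0 (pencil σ)) :=
  continuousOn_fourierCoeff (F := fun (p : ℝ × ℂ) x => ω p.1 x p.2)
    (h.continuousOn.comp (f := fun p : (ℝ × ℂ) × Torus => (p.1.1, p.2, p.1.2)) (by fun_prop)
      fun p hp => ⟨hp.1.1, trivial, hp.1.2⟩) α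

theorem continuousOn_deriv_deriv_mode (h : IsStokesSolution ν σ f ω) (α : ℤ) :
    ContinuousOn (fun p : ℝ × ℂ => deriv (deriv (mode (ω p.1) α)) p.2) (Ioi 0 ×ˢ pencil σ) := by
  have hd : ∀ t ∈ Ioi (0 : ℝ), DifferentiableOn ℂ (mode (ω t) α) (pencil σ) := fun t ht =>
    (h.isAnalyticField ht).differentiableOn_mode α
  have h1 := continuousOn_deriv_of_continuousOn_prod (isOpen_pencil σ)
    (f := fun t => mode (ω t) α)
    ((h.continuousOn_mode α).mono (prod_mono subset_rfl (subset_insert _ _))) hd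
  exact continuousOn_deriv_of_continuousOn_prod (isOpen_pencil σ) h1
    fun t ht => (hd t ht).deriv (isOpen_pencil σ)

/-- The modes of the difference of two solutions solve the problem on the half-line with zero
datum. -/
theorem isHalfLineSolution_sub (hσ : 0 < σ) (h : IsStokesSolution ν σ f ω)
    (h' : IsStokesSolution ν σ f ω') (α : ℤ) :
    IsHalfLineSolution ν |(α : ℝ)| (fun t y => mode (ω t) α y - mode (ω' t) α y)
      (fun t y => deriv (mode (ω t) α) y - deriv (mode (ω' t) α) y)
      (fun t y => deriv (deriv (mode (ω t) α)) y - deriv (deriv (mode (ω' t) α)) y) := by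
  have hmem : ∀ {y : ℝ}, 0 < y → (y : ℂ) ∈ pencil σ := fun hy => ofReal_mem_pencil hσ hy
  have hop := isOpen_pencil σ
  have hd : ∀ {ω : ℝ → Torus → ℂ → ℂ}, IsStokesSolution ν σ f ω → ∀ t, 0 < t → ∀ y : ℝ, 0 < y →
      HasDerivAt (fun y : ℝ => mode (ω t) α y) (deriv (mode (ω t) α) y) y := fun h t ht y hy =>
    (((h.isAnalyticField ht).differentiableOn_mode α).differentiableAt
      (hop.mem_nhds (hmem hy))).hasDerivAt.comp_ofReal
  have hd₂ : ∀ {ω : ℝ → Torus → ℂ → ℂ}, IsStokesSolution ν σ f ω → ∀ t, 0 < t → ∀ y : ℝ, 0 < y →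
      HasDerivAt (fun y : ℝ => deriv (mode (ω t) α) y) (deriv (deriv (mode (ω t) α)) y) y :=
    fun h t ht y hy => ((((h.isAnalyticField ht).differentiableOn_mode α).deriv
      hop).differentiableAt (hop.mem_nhds (hmem hy))).hasDerivAt.comp_ofReal
  have hm : ContinuousOn (fun p : ℝ × ℝ => (p.1, (p.2 : ℂ))) (Ioi 0 ×ˢ Ici 0) :=
    Continuous.continuousOn (by fun_prop)
  have hms : MapsTo (fun p : ℝ × ℝ => (p.1, (p.2 : ℂ))) (Ioi 0 ×ˢ Ici 0)
      (Ioi 0 ×ˢ insert 0 (pencil σ)) := by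
    rintro ⟨t, y⟩ ⟨ht, hy⟩
    refine ⟨ht, ?_⟩
    have hy : 0 ≤ y := hy
    rcases hy.eq_or_lt with h0 | h0
    · subst h0; simp
    · exact mem_insert_of_mem _ (hmem h0)
  have hm₂ : ContinuousOn (fun p : ℝ × ℝ => (p.1, (p.2 : ℂ))) (Ioi 0 ×ˢ Ioi 0) :=
    Continuous.continuousOn (by fun_prop)
  have hms₂ : MapsTo (fun p : ℝ × ℝ => (p.1, (p.2 : ℂ))) (Ioi 0 ×ˢ Ioi 0)
      (Ioi 0 ×ˢ pencil σ) := fun p hp => ⟨hp.1, hmem hp.2⟩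
  refine ⟨?_, ?_, fun t ht y hy => (hd h t ht y hy).sub (hd h' t ht y hy),
    fun t ht y hy => (hd₂ h t ht y hy).sub (hd₂ h' t ht y hy), fun t ht y hy => ?_,
    fun t ht => ?_, fun t ht => (h.integrable t ht α).sub (h'.integrable t ht α),
    fun t ht => ?_, fun y hy => ?_⟩
  · exact ((h.continuousOn_mode α).comp hm hms).sub ((h'.continuousOn_mode α).comp hm hms)
  · exact ((h.continuousOn_deriv_deriv_mode α).comp hm₂ hms₂).sub
      ((h'.continuousOn_deriv_deriv_mode α).comp hm₂ hms₂)
  · refine ((h.heat t ht α y (hmem hy)).sub (h'.heat t ht α y (hmem hy))).congr_deriv ?_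
    have : ((|(α : ℝ)| : ℝ) : ℂ) ^ 2 = (α : ℂ) ^ 2 := by
      rw [← Complex.ofReal_pow, sq_abs]; push_cast; rfl
    rw [this]; ring
  · have e1 := h.slip t ht α
    have e2 := h'.slip t ht α
    have hi : ∀ {ω : ℝ → Torus → ℂ → ℂ}, IsStokesSolution ν σ f ω → IntegrableOn (fun y : ℝ =>
        (Real.exp (-|(α : ℝ)| * y) : ℂ) * mode (ω t) α y) (Ioi 0) := fun h => by
      simpa using integrableOn_exp_mul (abs_nonneg (α : ℝ)) (h.integrable t ht.le α) le_rfl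
    have e3 : tail |(α : ℝ)| (fun y => mode (ω t) α y - mode (ω' t) α y) 0 =
        wallVelocity (ω' t) α - wallVelocity (ω t) α := by
      simp only [tail, wallVelocity, sub_zero, mul_sub]
      rw [integral_sub (hi h) (hi h')]
      ring
    rw [e3, mul_sub]
    simp only [Complex.ofReal_zero]
    rw [e1, e2]; ring
  · have hs := (h.continuousL1 t ht α).add (h'.continuousL1 t ht α)
    rw [add_zero] at hs
    refine tendsto_of_tendsto_of_tendsto_of_le_of_le' tendsto_const_nhds hs
      (Eventually.of_forall fun _ => zero_le) ?_
    filter_upwards [self_mem_nhdsWithin] with τ hτ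
    have hm : AEMeasurable (fun y : ℝ => ‖mode (ω τ) α y - mode (ω t) α y‖ₑ)
        (volume.restrict (Ioi 0)) := ((h.integrable τ hτ α).sub (h.integrable t ht α)).1.enorm
    rw [← lintegral_add_left' hm]
    refine lintegral_mono fun y => ?_
    have e : mode (ω τ) α y - mode (ω' τ) α y - (mode (ω t) α y - mode (ω' t) α y) =
        (mode (ω τ) α y - mode (ω t) α y) - (mode (ω' τ) α y - mode (ω' t) α y) := by ring
    simp only [e]
    exact enorm_sub_le
  · have e : ∀ {ω : ℝ → Torus → ℂ → ℂ}, IsStokesSolution ν σ f ω →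
        mode (ω 0) α y = mode f α y := fun h => by
      simp only [mode, h.initial _ _ (hmem hy)]
    simp only [e h, e h', sub_self]

/-- Uniqueness for the Stokes problem. -/
theorem eqOn (hν : 0 < ν) (hσ : 0 < σ) (h : IsStokesSolution ν σ f ω)
    (h' : IsStokesSolution ν σ f ω') {t : ℝ} (ht : 0 ≤ t) (x : Torus) :
    EqOn (ω t x) (ω' t x) (pencil σ) := by
  rcases ht.eq_or_lt with h0 | h0
  · subst h0
    exact fun z hz => (h.initial x z hz).trans (h'.initial x z hz).symm
  have hreal : ∀ y : ℝ, 0 < y → ω t x y = ω' t x y := by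
    intro y hy
    have hmem := ofReal_mem_pencil hσ hy
    have hc := continuous_section (h.isAnalyticField h0).continuousOn hmem
    have hc' := continuous_section (h'.isAnalyticField h0).continuousOn hmem
    refine sub_eq_zero.1 (eq_zero_of_fourierCoeff_eq_zero (g := fun x => ω t x y - ω' t x y)
      (hc.sub hc') (fun α => ?_) x)
    have e : fourierCoeff (fun x => ω t x y - ω' t x y) α = mode (ω t) α y - mode (ω' t) α y :=
      map_sub (fcL α) ⟨_, hc⟩ ⟨_, hc'⟩
    rw [e]
    exact (isHalfLineSolution_sub hσ h h' α).eq_zero hν (abs_nonneg _) h0 hy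
  have hpre : IsPreconnected (pencil σ) := (convex_pencil σ).isPreconnected
  refine ((h.holomorphic t h0 x).analyticOnNhd (isOpen_pencil σ)
    ).eqOn_of_preconnected_of_frequently_eq
    ((h'.holomorphic t h0 x).analyticOnNhd (isOpen_pencil σ)) hpre
    (ofReal_mem_pencil hσ one_pos) ?_
  have h2 : Tendsto (fun y : ℝ => (y : ℂ)) (𝓝[>] 1) (𝓝[≠] ((1 : ℝ) : ℂ)) := by
    refine tendsto_nhdsWithin_of_tendsto_nhds_of_eventually_within _
      ((Complex.continuous_ofReal.tendsto 1).mono_left nhdsWithin_le_nhds) ?_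
    filter_upwards [self_mem_nhdsWithin] with y hy
    have hy : (1 : ℝ) < y := hy
    simpa using hy.ne'
  refine h2.frequently (Eventually.frequently ?_)
  filter_upwards [self_mem_nhdsWithin] with y hy
  exact hreal y (one_pos.trans hy)

end StokesSlip.IsStokesSolution

theorem StokesSlip.IsStokesSolution.isStokesSolution_stokesSemigroup {ν σ : ℝ} {f : Torus → ℂ → ℂ}
    {ω : ℝ → Torus → ℂ → ℂ} (h : IsStokesSolution ν σ f ω) :
    IsStokesSolution ν σ f (fun t => stokesSemigroup ν σ t f) := by
  have hex : ∃ ω, IsStokesSolution ν σ f ω := ⟨ω, h⟩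
  have : (fun t => stokesSemigroup ν σ t f) = hex.choose := by
    funext t
    simp only [stokesSemigroup, dif_pos hex]
  rw [this]
  exact hex.choose_spec

theorem stokesSemigroup_eqOn {ν σ : ℝ} {f : Torus → ℂ → ℂ} (hν : 0 < ν) (hσ : 0 < σ)
    (hf : HasDecayingData f) {t : ℝ} (ht : 0 ≤ t) (x : Torus) :
    EqOn (stokesSemigroup ν σ t f x) (stokesField ν f t x) (pencil σ) :=
  (hf.isStokesSolution hν hσ).isStokesSolution_stokesSemigroup.eqOn hν hσ
    (hf.isStokesSolution hν hσ) ht x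

/-- Well-posedness of the Stokes problem, and commutation of the solution operator with `∂ₓ`. -/
theorem stokes_wellPosed {ν ρ σ : ℝ} (hν : 0 < ν) (hρ : 0 < ρ) (hσ : 0 < σ)
    {f : Torus → ℂ → ℂ} (hf : IsAnalyticField σ f) (h : normL1 ρ σ f < ∞) :
    IsStokesSolution ν σ f (fun t => stokesSemigroup ν σ t f) ∧
      (∀ ω : ℝ → Torus → ℂ → ℂ, IsStokesSolution ν σ f ω →
        ∀ t, 0 ≤ t → ∀ x, ∀ z ∈ pencil σ, ω t x z = stokesSemigroup ν σ t f x z) ∧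
      (∀ t, 0 ≤ t → ∀ x, ∀ z ∈ pencil σ,
        HasDerivAt (fun h : ℝ => stokesSemigroup ν σ t f (x + (h : Torus)) z)
          (stokesSemigroup ν σ t (dx f) x z) 0) := by
  have hn := niceField_of_normL1_lt_top hρ hσ hf h
  have hd := hasDecayingData_of_normL1_lt_top hρ hσ hf h
  have hs := (hd.isStokesSolution hν hσ).isStokesSolution_stokesSemigroup
  refine ⟨hs, fun ω hω t ht x z hz => hω.eqOn hν hσ hs ht x hz, fun t ht x z hz => ?_⟩
  have e : (fun h : ℝ => stokesSemigroup ν σ t f (x + (h : Torus)) z) =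
      fun h : ℝ => stokesField ν f t (x + (h : Torus)) z :=
    funext fun h => stokesSemigroup_eqOn hν hσ hd ht _ hz
  rw [e, stokesSemigroup_eqOn hν hσ (hasDecayingData_dx hσ hn hd) ht x hz]
  exact hasDerivAt_stokesField hν hσ hn hd ht x hz

/-! ### Integration on the half-line and shift of contours -/

theorem integral_eq_zero_of_hasDerivAt_off_zero {f f' : ℝ → ℂ} (hc : ContinuousAt f 0)
    (hd : ∀ x, x ≠ 0 → HasDerivAt f (f' x) x) (hf' : Integrable f') (hf : Integrable f) :
    ∫ x, f' x = 0 := by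
  have t1 : Tendsto f atTop (𝓝 0) := tendsto_zero_of_hasDerivAt_of_integrableOn_Ioi (a := 0)
    (fun x hx => hd x (ne_of_gt hx)) hf'.integrableOn hf.integrableOn
  have t2 : Tendsto f atBot (𝓝 0) := tendsto_zero_of_hasDerivAt_of_integrableOn_Iic (a := -1)
    (fun x hx => hd x (ne_of_lt (lt_of_le_of_lt hx (by norm_num)))) hf'.integrableOn
    hf.integrableOn
  have i1 := integral_Ioi_of_hasDerivAt_of_tendsto hc.continuousWithinAt
    (fun x hx => hd x (ne_of_gt hx)) hf'.integrableOn t1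
  have i2 := integral_Iic_of_hasDerivAt_of_tendsto hc.continuousWithinAt
    (fun x hx => hd x (ne_of_lt hx)) hf'.integrableOn t2
  rw [← intervalIntegral.integral_Iic_add_Ioi hf'.integrableOn hf'.integrableOn (b := 0), i1, i2]
  ring

/-- A derivative on `(0, ∞)` has vanishing integral if its primitive `H` is such that `H(y) / y` is
integrable. The point `1`, where contours have a corner, is exempted. -/
theorem integral_Ioi_eq_zero_of_hasDerivAt {H H' : ℝ → ℂ} (hc : ContinuousAt H 1)
    (hd : ∀ y, 0 < y → y ≠ 1 → HasDerivAt H (H' y) y) (hi' : IntegrableOn H' (Ioi 0))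
    (hi : IntegrableOn (fun y => y⁻¹ • H y) (Ioi 0)) : ∫ y in Ioi (0 : ℝ), H' y = 0 := by
  -- After the substitution `y = eˣ` both `H` and its derivative are integrable on the line.
  have himg : Real.exp '' univ = Ioi 0 := by rw [image_univ, Real.range_exp]
  have hex : ∀ x ∈ (univ : Set ℝ), HasDerivWithinAt Real.exp (Real.exp x) univ x := fun x _ =>
    (Real.hasDerivAt_exp x).hasDerivWithinAt
  have hinj : InjOn Real.exp univ := Real.exp_injective.injOn
  have e0 : ∀ x, |Real.exp x| = Real.exp x := fun x => abs_of_pos (Real.exp_pos x)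
  have h1 := integral_image_eq_integral_abs_deriv_smul MeasurableSet.univ hex hinj H'
  have h2 := (integrableOn_image_iff_integrableOn_abs_deriv_smul MeasurableSet.univ hex hinj H').1
    (by rwa [himg])
  have h3 := (integrableOn_image_iff_integrableOn_abs_deriv_smul MeasurableSet.univ hex hinj
    (fun y => y⁻¹ • H y)).1 (by rwa [himg])
  simp only [e0, smul_smul, mul_inv_cancel₀ (Real.exp_pos _).ne', one_smul, himg,
    integrableOn_univ, setIntegral_univ] at h1 h2 h3
  rw [h1]
  refine integral_eq_zero_of_hasDerivAt_off_zero (f := fun x => H (Real.exp x)) ?_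
    (fun x hx => ?_) h2 h3
  · refine ContinuousAt.comp (g := H) ?_ Real.continuous_exp.continuousAt
    rw [Real.exp_zero]; exact hc
  · exact HasDerivAt.scomp x (hd _ (Real.exp_pos x) (by simpa using hx)) (Real.hasDerivAt_exp x)

/-- The derivative of the curve `gam θ`, off its corner `r = 1`. -/
noncomputable def gamDeriv (θ r : ℝ) : ℂ := 1 + (if r < 1 then θ else 0 : ℝ) * Complex.I

theorem hasDerivAt_gam (θ : ℝ) {r : ℝ} (hr : r ≠ 1) : HasDerivAt (gam θ) (gamDeriv θ r) r := by
  have h0 : HasDerivAt (fun r : ℝ => min r 1) (if r < 1 then 1 else 0) r := by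
    rcases hr.lt_or_gt with h | h
    · rw [if_pos h]
      refine (hasDerivAt_id r).congr_of_eventuallyEq ?_
      filter_upwards [Iio_mem_nhds h] with y hy using min_eq_left (le_of_lt hy)
    · rw [if_neg h.not_gt]
      refine (hasDerivAt_const r (1 : ℝ)).congr_of_eventuallyEq ?_
      filter_upwards [Ioi_mem_nhds h] with y hy using min_eq_right (le_of_lt hy)
  have h1 : HasDerivAt (fun r : ℝ => (r : ℂ) + ((θ * min r 1 : ℝ) : ℂ) * Complex.I)
      (1 + ((θ * (if r < 1 then 1 else 0) : ℝ) : ℂ) * Complex.I) r :=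
    (hasDerivAt_id r).ofReal_comp.add (((h0.const_mul θ).ofReal_comp).mul_const _)
  have e : gam θ = fun r : ℝ => (r : ℂ) + ((θ * min r 1 : ℝ) : ℂ) * Complex.I := by
    funext r; apply Complex.ext <;> simp [gam_re, gam_im]
  rw [e]
  refine h1.congr_deriv ?_
  rw [gamDeriv]; congr 3; split_ifs <;> simp

theorem norm_gamDeriv_le {θ : ℝ} (hθ : |θ| ≤ 1) (r : ℝ) : ‖gamDeriv θ r‖ ≤ 2 := by
  have h : |(if r < 1 then θ else 0 : ℝ)| ≤ 1 := by split_ifs <;> simp [hθ]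
  calc _ ≤ ‖(1 : ℂ)‖ + ‖((if r < 1 then θ else 0 : ℝ) : ℂ) * Complex.I‖ := norm_add_le _ _
    _ ≤ 1 + 1 := by
      rw [norm_mul, Complex.norm_I, Complex.norm_real, Real.norm_eq_abs, norm_one, mul_one]
      gcongr
    _ = 2 := by norm_num

theorem measurable_gamDeriv (θ : ℝ) : Measurable (gamDeriv θ) := by
  unfold gamDeriv
  exact measurable_const.add ((Complex.measurable_ofReal.comp
    (Measurable.ite measurableSet_Iio measurable_const measurable_const)).mul_const _)

theorem hasDerivAt_gam_left (θ r : ℝ) :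
    HasDerivAt (fun θ => gam θ r) ((min r 1 : ℝ) * Complex.I) θ := by
  have e : (fun θ => gam θ r) = fun θ : ℝ => (r : ℂ) + ((θ * min r 1 : ℝ) : ℂ) * Complex.I := by
    funext r; apply Complex.ext <;> simp [gam_re, gam_im]
  rw [e]
  have h := ((((hasDerivAt_id θ).mul_const (min r 1)).ofReal_comp).mul_const Complex.I).const_add
    (r : ℂ)
  refine h.congr_deriv ?_
  simp

theorem continuousOn_comp_gam {σ : ℝ} {Φ : ℂ → ℂ} (hΦ : ContinuousOn Φ (pencil σ)) :
    ContinuousOn (fun p : ℝ × ℝ => Φ (gam p.1 p.2)) ({θ | |θ| < σ} ×ˢ Ioi 0) :=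
  hΦ.comp continuous_gam.continuousOn fun _ hp => gam_mem_pencil hp.1 hp.2

theorem continuousOn_comp_gam_right {σ θ : ℝ} (hθ : |θ| < σ) {Φ : ℂ → ℂ}
    (hΦ : ContinuousOn Φ (pencil σ)) : ContinuousOn (fun r : ℝ => Φ (gam θ r)) (Ioi 0) :=
  (continuousOn_comp_gam hΦ).comp (f := fun r : ℝ => (θ, r)) (by fun_prop) fun _ hr => ⟨hθ, hr⟩

theorem integrableOn_comp_gam {σ θ : ℝ} (hθ : |θ| < σ) {Φ : ℂ → ℂ}
    (hΦ : ContinuousOn Φ (pencil σ)) (hfin : modeL1 σ Φ < ∞) :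
    IntegrableOn (fun r : ℝ => Φ (gam θ r)) (Ioi 0) :=
  ⟨(continuousOn_comp_gam_right hθ hΦ).aestronglyMeasurable measurableSet_Ioi,
    (lintegral_gam_le_modeL1 hθ Φ).trans_lt hfin⟩

theorem abs_lt_of_mem_uIcc {σ θ θ' : ℝ} (hθ : |θ| < σ) (h : θ' ∈ uIcc 0 θ) : |θ'| < σ := by
  rcases le_total 0 θ with h0 | h0
  · rw [uIcc_of_le h0] at h
    rw [abs_of_nonneg h.1]
    exact h.2.trans_lt ((le_abs_self θ).trans_lt hθ)
  · rw [uIcc_of_ge h0] at h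
    rw [abs_of_nonpos h.2]
    exact (neg_le_neg h.1).trans_lt ((neg_le_abs θ).trans_lt hθ)

/-- Cauchy's theorem: the integral of a holomorphic function over the half-line may be shifted to
the curves `gam θ`. For a primitive `Q` of `Φ`, the difference `H(r) = Q(gam θ r) - Q(r)` is an
integral of `Φ` over a vertical segment of length at most `|θ| r`, so `H(r) / r` is integrable because
`Φ` is integrable along all curves in between. -/
theorem integral_Ioi_eq_integral_gam {σ θ : ℝ} (hθ : |θ| < σ) {Φ : ℂ → ℂ}
    (hΦ : DifferentiableOn ℂ Φ (pencil σ)) (hfin : modeL1 σ Φ < ∞) :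
    ∫ r in Ioi (0 : ℝ), Φ r = ∫ r in Ioi (0 : ℝ), Φ (gam θ r) * gamDeriv θ r := by
  have hσ : 0 < σ := (abs_nonneg θ).trans_lt hθ
  have h0 : |(0 : ℝ)| < σ := by simpa using hσ
  obtain ⟨Q, hQ⟩ := (convex_pencil σ).exists_forall_hasDerivWithinAt hΦ
  have hQ' : ∀ z ∈ pencil σ, HasDerivAt Q (Φ z) z := fun z hz =>
    (hQ z hz).hasDerivAt ((isOpen_pencil σ).mem_nhds hz)
  have hQc : ContinuousOn Q (pencil σ) := fun z hz => (hQ' z hz).continuousAt.continuousWithinAt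
  have i1 := integrableOn_comp_gam hθ hΦ.continuousOn hfin
  have i0 : IntegrableOn (fun r : ℝ => Φ r) (Ioi 0) := by
    have h := integrableOn_comp_gam h0 hΦ.continuousOn hfin
    simp only [gam_zero] at h
    exact h
  have i2 : IntegrableOn (fun r : ℝ => Φ (gam θ r) * gamDeriv θ r) (Ioi 0) := by
    refine Integrable.mul_bdd (c := 1 + |θ|) i1 (measurable_gamDeriv θ).aestronglyMeasurable
      (Eventually.of_forall fun r => ?_)
    refine (norm_add_le _ _).trans ?_
    rw [norm_mul, Complex.norm_I, Complex.norm_real, Real.norm_eq_abs, norm_one, mul_one]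
    refine add_le_add le_rfl ?_
    split_ifs <;> simp
  set H : ℝ → ℂ := fun r => Q (gam θ r) - Q (gam 0 r) with hH
  have hHc : ContinuousOn H (Ioi 0) :=
    (continuousOn_comp_gam_right hθ hQc).sub (continuousOn_comp_gam_right h0 hQc)
  have key := integral_Ioi_eq_zero_of_hasDerivAt (H := H)
    (H' := fun r => Φ (gam θ r) * gamDeriv θ r - Φ r)
    (hHc.continuousAt (Ioi_mem_nhds one_pos)) ?_ (i2.sub i0) ?_
  · rw [integral_sub i2 i0] at key
    exact (sub_eq_zero.1 key).symm
  · intro r hr hr1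
    have d1 := HasDerivAt.comp r (hQ' _ (gam_mem_pencil hθ hr)) (hasDerivAt_gam θ hr1)
    have d0 := HasDerivAt.comp r (hQ' _ (gam_mem_pencil h0 hr)) (hasDerivAt_gam 0 hr1)
    refine (d1.sub d0).congr_deriv ?_
    simp [gamDeriv, gam_zero]
  · -- Along vertical segments `H(r) = ∫ Φ(gam θ' r) min(r, 1) i dθ'`.
    refine ⟨(continuousOn_inv₀.mono fun r (hr : 0 < r) => hr.ne').smul hHc |>.aestronglyMeasurable
      measurableSet_Ioi, ?_⟩
    have hpt : ∀ r ∈ Ioi (0 : ℝ), ‖r⁻¹ • H r‖ₑ ≤ ∫⁻ θ' in uIoc 0 θ, ‖Φ (gam θ' r)‖ₑ := by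
      intro r hr
      have hr : 0 < r := hr
      have hm : 0 < min r 1 := lt_min hr one_pos
      have hcont : ContinuousOn (fun θ' => Φ (gam θ' r)) (uIcc 0 θ) :=
        (continuousOn_comp_gam hΦ.continuousOn).comp (f := fun θ' : ℝ => (θ', r)) (by fun_prop)
          fun θ' h => ⟨abs_lt_of_mem_uIcc hθ h, hr⟩
      have e := intervalIntegral.integral_eq_sub_of_hasDerivAt (a := 0) (b := θ)
        (f := fun θ' => Q (gam θ' r)) (f' := fun θ' => Φ (gam θ' r) * ((min r 1 : ℝ) * Complex.I))
        (fun θ' h => HasDerivAt.comp θ' (hQ' _ (gam_mem_pencil (abs_lt_of_mem_uIcc hθ h) hr))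
          (hasDerivAt_gam_left θ' r)) (hcont.mul continuousOn_const).intervalIntegrable
      have hn : ‖H r‖ₑ ≤ (∫⁻ θ' in uIoc 0 θ, ‖Φ (gam θ' r)‖ₑ) * ENNReal.ofReal (min r 1) := by
        rw [hH]
        simp only
        rw [← e, intervalIntegral.integral_mul_const, enorm_mul, enorm_mul,
          ← ofReal_norm Complex.I, Complex.norm_I, ENNReal.ofReal_one, mul_one,
          ← ofReal_norm ((min r 1 : ℝ) : ℂ), Complex.norm_real, Real.norm_of_nonneg hm.le]
        refine mul_le_mul_left ?_ _
        rw [← ofReal_norm, intervalIntegral.norm_intervalIntegral_eq, ofReal_norm]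
        exact enorm_integral_le_lintegral_enorm _
      rw [enorm_smul, Real.enorm_of_nonneg (inv_nonneg.2 hr.le)]
      calc _ ≤ ENNReal.ofReal r⁻¹ *
            ((∫⁻ θ' in uIoc 0 θ, ‖Φ (gam θ' r)‖ₑ) * ENNReal.ofReal (min r 1)) :=
            mul_le_mul_right hn _
        _ = (∫⁻ θ' in uIoc 0 θ, ‖Φ (gam θ' r)‖ₑ) * ENNReal.ofReal (r⁻¹ * min r 1) := by
            rw [ENNReal.ofReal_mul (inv_nonneg.2 hr.le)]; ring
        _ ≤ (∫⁻ θ' in uIoc 0 θ, ‖Φ (gam θ' r)‖ₑ) * 1 := by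
            refine mul_le_mul_right ?_ _
            refine ENNReal.ofReal_le_one.2 ?_
            rw [inv_mul_le_iff₀ hr, mul_one]
            exact min_le_left _ _
        _ = _ := mul_one _
    refine (setLIntegral_mono' measurableSet_Ioi hpt).trans_lt ?_
    have hm : AEMeasurable (Function.uncurry fun r θ' : ℝ => ‖Φ (gam θ' r)‖ₑ)
        ((volume.restrict (Ioi 0)).prod (volume.restrict (uIoc 0 θ))) := by
      rw [Measure.prod_restrict]
      refine AEStronglyMeasurable.enorm (ContinuousOn.aestronglyMeasurable ?_
        (measurableSet_Ioi.prod measurableSet_uIoc))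
      exact (continuousOn_comp_gam hΦ.continuousOn).comp (f := fun p : ℝ × ℝ => (p.2, p.1))
        (by fun_prop) fun p hp => ⟨abs_lt_of_mem_uIcc hθ (uIoc_subset_uIcc hp.2), hp.1⟩
    rw [lintegral_lintegral_swap hm]
    calc _ ≤ ∫⁻ θ' in uIoc 0 θ, modeL1 σ Φ := setLIntegral_mono' measurableSet_uIoc fun θ' h =>
          lintegral_gam_le_modeL1 (abs_lt_of_mem_uIcc hθ (uIoc_subset_uIcc h)) Φ
      _ < ∞ := by
          rw [setLIntegral_const, uIoc, Real.volume_Ioc]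
          exact ENNReal.mul_lt_top hfin ENNReal.ofReal_lt_top

/-! ### Convolution with kernels on the half-line -/

/-- The integral over the half-line of a kernel against a function defined near the half-line. -/
noncomputable def halfConv (q : ℂ[X]) (s : ℝ) (v : ℂ → ℂ) (z : ℂ) : ℂ :=
  ∫ y in Ioi (0 : ℝ), gker q s (z - y) * v y

/-- The multiplier `1 / (1 + z)`; the weight of the conormal derivative is `ψ(z) = 1 - 1 / (1 + z)`,
and `ψ' = (1 + z)⁻²`. -/
noncomputable def invAdd (z : ℂ) : ℂ := (1 + z)⁻¹

theorem norm_invAdd_le {z : ℂ} (hz : 0 < z.re) : ‖invAdd z‖ ≤ 1 := norm_one_add_inv_le_one hz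

theorem differentiableOn_invAdd (σ : ℝ) : DifferentiableOn ℂ invAdd (pencil σ) := by
  unfold invAdd
  exact DifferentiableOn.inv (by fun_prop) fun z hz =>
    one_add_ne_zero_of_re_pos (re_pos_of_mem_pencil hz)

theorem integrableOn_invAdd_mul {F : ℝ → ℂ} (hF : IntegrableOn F (Ioi 0)) :
    IntegrableOn (fun y : ℝ => invAdd y * F y) (Ioi 0) := by
  refine Integrable.bdd_mul (c := 1) hF ?_ ?_
  · unfold invAdd
    exact (by fun_prop : Measurable fun y : ℝ => ((1 : ℂ) + y)⁻¹).aestronglyMeasurable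
  · refine (ae_restrict_iff' measurableSet_Ioi).2 (Eventually.of_forall fun y hy => ?_)
    exact norm_invAdd_le (by simpa using hy)

theorem hasDerivAt_halfConv (q : ℂ[X]) {s : ℝ} (hs : 0 < s) {v : ℂ → ℂ}
    (hv : IntegrableOn (fun y : ℝ => v y) (Ioi 0)) (z : ℂ) :
    HasDerivAt (halfConv q s v) ((s : ℂ)⁻¹ * halfConv (dq q) s v z) z :=
  hasDerivAt_integral_gker q hs hv z

/-- The conormal derivative of a convolution on the half-line. It rests on
`ψ(z) - ψ(y) = (z - y) / ((1 + z) (1 + y))` and an integration by parts, of `H = ψ v G(z - ·)`; the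
boundary terms vanish because `H(y) / y` is integrable. -/
theorem pd_halfConv (q : ℂ[X]) {s σ : ℝ} (hs : 0 < s) (hσ : 0 < σ) {v : ℂ → ℂ}
    (hv : DifferentiableOn ℂ v (pencil σ)) (h1 : IntegrableOn (fun y : ℝ => v y) (Ioi 0))
    (h2 : IntegrableOn (fun y : ℝ => pd v y) (Ioi 0)) {z : ℂ} (hz : 1 + z ≠ 0) :
    pd (halfConv q s v) z = invAdd z * halfConv (X * dq q) s (fun w => invAdd w * v w) z +
      (halfConv q s (fun w => invAdd w * (invAdd w * v w)) z + halfConv q s (pd v) z) := by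
  have hs' : (s : ℂ) ≠ 0 := by exact_mod_cast hs.ne'
  have hb := integrableOn_invAdd_mul h1
  have hbb := integrableOn_invAdd_mul hb
  have hb' : IntegrableOn (fun y : ℝ => v y - invAdd y * v y) (Ioi 0) := h1.sub hb
  have hne : ∀ y : ℝ, 0 < y → (1 : ℂ) + y ≠ 0 := fun y hy =>
    one_add_ne_zero_of_re_pos (by simpa using hy)
  have hpsi : ∀ y : ℝ, 0 < y → (y : ℂ) / (1 + y) = 1 - invAdd y := fun y hy => by
    have := hne y hy
    rw [invAdd]; field_simp; ring
  set H : ℝ → ℂ := fun y => (1 - invAdd y) * v y * gker q s (z - y) with hH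
  set H' : ℝ → ℂ := fun y => (gker q s (z - y) * (invAdd y * (invAdd y * v y)) +
    gker q s (z - y) * pd v y) - (s : ℂ)⁻¹ * (gker (dq q) s (z - y) * (v y - invAdd y * v y))
    with hH'
  have i1 := integrable_gker_mul q hs hbb z
  have i2 := integrable_gker_mul q hs h2 z
  have i3 := (integrable_gker_mul (dq q) hs hb' z).const_mul (s : ℂ)⁻¹
  have hd : ∀ y : ℝ, 0 < y → HasDerivAt H (H' y) y := by
    intro y hy
    have hmem := ofReal_mem_pencil hσ hy
    have d0 : HasDerivAt (fun y : ℂ => 1 - invAdd y) (invAdd y * invAdd y) (y : ℂ) := by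
      have := (((hasDerivAt_id (y : ℂ)).const_add 1).inv (hne y hy)).const_sub 1
      refine this.congr_deriv ?_
      simp only [invAdd, id]
      have := hne y hy
      field_simp
    have d1 := (hv.differentiableAt ((isOpen_pencil σ).mem_nhds hmem)).hasDerivAt
    have d2 : HasDerivAt (fun w : ℂ => gker q s (z - w)) (-((s : ℂ)⁻¹ * gker (dq q) s (z - y)))
        (y : ℂ) := by
      have := (hasDerivAt_gker q s (z - y)).comp_const_sub z (y : ℂ)
      exact this
    have d3 := ((d0.mul d1).mul d2).comp_ofReal
    refine d3.congr_deriv ?_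
    simp only [hH', pd, hpsi y hy, Pi.mul_apply]
    ring
  have key : ∫ y in Ioi (0 : ℝ), H' y = 0 := by
    refine integral_Ioi_eq_zero_of_hasDerivAt (H := H) (hd 1 one_pos).continuousAt
      (fun y hy _ => hd y hy) ((i1.add i2).sub i3) ?_
    refine (integrable_gker_mul q hs hb z).congr ?_
    refine (ae_restrict_iff' measurableSet_Ioi).2 (Eventually.of_forall fun y hy => ?_)
    have hy : 0 < y := hy
    have hy' : (y : ℂ) ≠ 0 := by exact_mod_cast hy.ne'
    simp only [hH, Complex.real_smul, invAdd]
    have := hne y hy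
    push_cast
    field_simp
    ring
  have i12 : Integrable (fun y : ℝ => gker q s (z - y) * (invAdd y * (invAdd y * v y)) +
      gker q s (z - y) * pd v y) (volume.restrict (Ioi 0)) := i1.add i2
  rw [hH', integral_sub i12 i3, integral_add i1 i2] at key
  have hD : pd (halfConv q s v) z = z / (1 + z) * ((s : ℂ)⁻¹ * halfConv (dq q) s v z) := by
    rw [pd, (hasDerivAt_halfConv q hs h1 z).deriv]
  have e : z / (1 + z) * ((s : ℂ)⁻¹ * halfConv (dq q) s v z) =
      invAdd z * halfConv (X * dq q) s (fun w => invAdd w * v w) z +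
        ∫ y in Ioi (0 : ℝ), (s : ℂ)⁻¹ * (gker (dq q) s (z - y) * (v y - invAdd y * v y)) := by
    simp only [halfConv]
    rw [← integral_const_mul, ← integral_const_mul, ← integral_const_mul, ← integral_add]
    · refine setIntegral_congr_fun measurableSet_Ioi fun y hy => ?_
      have := hne y hy
      simp only [gker_X_mul, invAdd]
      field_simp
      ring
    · exact (integrable_gker_mul (X * dq q) hs hb z).const_mul _
    · exact i3
  rw [hD, e]
  simp only [halfConv]
  linear_combination -key

/-! ### Convolution along shifted contours -/

theorem modeL1_le_of_le {σ : ℝ} {c : ℝ≥0∞} (hc : c ≠ ∞) {g h : ℂ → ℂ}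
    (H : ∀ z ∈ pencil σ, ‖g z‖ₑ ≤ c * ‖h z‖ₑ) : modeL1 σ g ≤ c * modeL1 σ h := by
  refine iSup₂_le fun θ hθ => ?_
  refine le_trans ?_ (mul_le_mul_right
    (le_iSup₂ (f := fun θ (_ : θ ∈ Ico 0 σ) => contourL1 θ h) θ hθ) c)
  unfold contourL1
  rw [← lintegral_const_mul' _ _ hc]
  refine setLIntegral_mono' measurableSet_Ioi fun r hr => ?_
  have hθ' : |θ| < σ := by rw [abs_of_nonneg hθ.1]; exact hθ.2
  have m1 := H _ (gam_mem_pencil hθ' hr)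
  have m2 := H _ (gam_mem_pencil (θ := -θ) (by rwa [abs_neg]) hr)
  rw [conj_contour_eq_gam hθ.1, contour_eq_gam hθ.1, ← mul_assoc, mul_add]
  exact mul_le_mul_left (add_le_add m1 m2) _

/-- After a shift of the contour to `gam θ`, the convolution on the half-line is dominated by the
convolution with a Gaussian. -/
theorem exists_enorm_halfConv_gam_le (q : ℂ[X]) {σ₁ : ℝ} (h0 : 0 ≤ σ₁) (h1 : σ₁ < 1) :
    ∃ C : ℝ, 0 < C ∧ ∀ s : ℝ, 0 < s → ∀ σ, σ ≤ σ₁ → ∀ v : ℂ → ℂ, DifferentiableOn ℂ v (pencil σ) →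
      modeL1 σ v < ∞ → ∀ θ, |θ| < σ → ∀ r, 0 < r →
      ‖halfConv q s v (gam θ r)‖ₑ ≤ ENNReal.ofReal C * ∫⁻ r' in Ioi (0 : ℝ),
        ENNReal.ofReal (genv ((1 - σ₁ ^ 2) / 8) s (r - r')) * ‖v (gam θ r')‖ₑ := by
  obtain ⟨C, hC, hb⟩ := exists_norm_gker_le_genv q h0 h1
  refine ⟨C * 2, by positivity, fun s hs σ hσ v hv hfin θ hθ r hr => ?_⟩
  obtain ⟨B, hB, hu⟩ := exists_norm_gker_le_unif q (M := |(gam θ r).im| + σ) hs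
  set Φ : ℂ → ℂ := fun w => gker q s (gam θ r - w) * v w with hΦ
  have hΦd : DifferentiableOn ℂ Φ (pencil σ) := by
    refine DifferentiableOn.mul (Differentiable.differentiableOn ?_) hv
    exact (differentiable_gker q s).comp (by fun_prop : Differentiable ℂ fun w => gam θ r - w)
  have hΦf : modeL1 σ Φ < ∞ := by
    refine (modeL1_le_of_le (c := ENNReal.ofReal B) ENNReal.ofReal_ne_top fun w hw => ?_).trans_lt
      (ENNReal.mul_lt_top ENNReal.ofReal_lt_top hfin)
    rw [hΦ, enorm_mul]
    refine mul_le_mul_left ?_ _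
    rw [← ofReal_norm]
    refine ENNReal.ofReal_le_ofReal (hu s le_rfl _ ?_)
    rw [Complex.sub_im]
    exact (abs_sub _ _).trans (by linarith [(mem_pencil_iff.1 hw).2])
  have e : halfConv q s v (gam θ r) = ∫ r' in Ioi (0 : ℝ), Φ (gam θ r') * gamDeriv θ r' :=
    integral_Ioi_eq_integral_gam hθ hΦd hΦf
  rw [e, ← lintegral_const_mul' _ _ ENNReal.ofReal_ne_top]
  refine (enorm_integral_le_lintegral_enorm _).trans (lintegral_mono fun r' => ?_)
  have hθ1 : |θ| ≤ 1 := by linarith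
  have hk : ‖gker q s (gam θ r - gam θ r')‖ ≤ C * genv ((1 - σ₁ ^ 2) / 8) s (r - r') := by
    have := hb s hs (gam θ r - gam θ r') ((abs_im_gam_sub_gam_le θ r r').trans
      (mul_le_mul_of_nonneg_right (by linarith) (abs_nonneg _)))
    simpa [gam_re] using this
  rw [hΦ, enorm_mul, enorm_mul]
  calc _ ≤ ENNReal.ofReal (C * genv ((1 - σ₁ ^ 2) / 8) s (r - r')) * ‖v (gam θ r')‖ₑ *
        ENNReal.ofReal 2 := by
        refine mul_le_mul' (mul_le_mul_left ?_ _) ?_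
        · rw [← ofReal_norm]; exact ENNReal.ofReal_le_ofReal hk
        · rw [← ofReal_norm]; exact ENNReal.ofReal_le_ofReal (norm_gamDeriv_le hθ1 r')
    _ = _ := by
        rw [ENNReal.ofReal_mul hC.le, ENNReal.ofReal_mul hC.le]
        ring

/-! ### Conormal derivatives of convolutions -/

/-- Monotone, subadditive size functionals for functions on the pencil-like domain. The common
feature of `modeL1` and `modeBL`, by which both are treated at once. -/
structure SolidNorm (σ : ℝ) (N : (ℂ → ℂ) → ℝ≥0∞) : Prop where
  mono : ∀ c : ℝ≥0∞, c ≠ ∞ → ∀ g h : ℂ → ℂ, (∀ z ∈ pencil σ, ‖g z‖ₑ ≤ c * ‖h z‖ₑ) → N g ≤ c * N h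
  add_le : ∀ g h : ℂ → ℂ, ContinuousOn g (pencil σ) → ContinuousOn h (pencil σ) →
    N (fun z => g z + h z) ≤ N g + N h

/-- The sum of the sizes of the conormal derivatives of order at most `l`. -/
noncomputable def conSum (N : (ℂ → ℂ) → ℝ≥0∞) (l : ℕ) (g : ℂ → ℂ) : ℝ≥0∞ :=
  ∑ i ∈ Finset.range (l + 1), N (pd^[i] g)

section
variable {σ : ℝ} {N : (ℂ → ℂ) → ℝ≥0∞} {g h : ℂ → ℂ}

theorem conSum_zero : conSum N 0 g = N g := by simp [conSum]

theorem conSum_succ (l : ℕ) : conSum N (l + 1) g = N g + conSum N l (pd g) := by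
  rw [conSum, Finset.sum_range_succ', add_comm]
  rfl

theorem le_conSum (l : ℕ) : N g ≤ conSum N l g := by
  cases l with
  | zero => rw [conSum_zero]
  | succ l => rw [conSum_succ]; exact le_self_add

theorem conSum_le_succ (l : ℕ) : conSum N l g ≤ conSum N (l + 1) g :=
  Finset.sum_le_sum_of_subset (Finset.range_mono (by omega))

theorem conSum_pd_le (l : ℕ) : conSum N l (pd g) ≤ conSum N (l + 1) g := by
  rw [conSum_succ]; exact le_add_self

theorem SolidNorm.congr (hN : SolidNorm σ N) (H : EqOn g h (pencil σ)) : N g = N h := by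
  refine le_antisymm ?_ ?_
  · simpa using hN.mono 1 ENNReal.one_ne_top g h fun z hz => by rw [H hz, one_mul]
  · simpa using hN.mono 1 ENNReal.one_ne_top h g fun z hz => by rw [H hz, one_mul]

theorem SolidNorm.conSum_congr (hN : SolidNorm σ N) (H : EqOn g h (pencil σ)) (l : ℕ) :
    conSum N l g = conSum N l h :=
  Finset.sum_congr rfl fun i _ => hN.congr (pd_iter_congr H i)

theorem pd_add (hg : DifferentiableOn ℂ g (pencil σ)) (hh : DifferentiableOn ℂ h (pencil σ)) :
    EqOn (pd fun z => g z + h z) (fun z => pd g z + pd h z) (pencil σ) := by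
  intro z hz
  have hn := (isOpen_pencil σ).mem_nhds hz
  have := ((hg.differentiableAt hn).hasDerivAt.fun_add (hh.differentiableAt hn).hasDerivAt).deriv
  simp only [pd, this]
  ring

theorem SolidNorm.conSum_add_le (hN : SolidNorm σ N) (l : ℕ) :
    ∀ {g h : ℂ → ℂ}, DifferentiableOn ℂ g (pencil σ) → DifferentiableOn ℂ h (pencil σ) →
      conSum N l (fun z => g z + h z) ≤ conSum N l g + conSum N l h := by
  induction l with
  | zero =>
    intro g h hg hh
    simp only [conSum_zero]
    exact hN.add_le g h hg.continuousOn hh.continuousOn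
  | succ l ih =>
    intro g h hg hh
    simp only [conSum_succ]
    rw [hN.conSum_congr (pd_add hg hh) l]
    calc _ ≤ (N g + N h) + (conSum N l (pd g) + conSum N l (pd h)) :=
          add_le_add (hN.add_le g h hg.continuousOn hh.continuousOn)
            (ih (differentiableOn_pd hg) (differentiableOn_pd hh))
      _ = _ := by ring

theorem pd_const_mul (c : ℂ) (g : ℂ → ℂ) : (pd fun z => c * g z) = fun z => c * pd g z := by
  funext z
  simp only [pd, deriv_const_mul_field]
  ring

theorem SolidNorm.conSum_const_mul_le (hN : SolidNorm σ N) {c : ℂ} (hc : ‖c‖ ≤ 1) (l : ℕ) :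
    ∀ g : ℂ → ℂ, conSum N l (fun z => c * g z) ≤ conSum N l g := by
  have h0 : ∀ g : ℂ → ℂ, N (fun z => c * g z) ≤ N g := fun g => by
    have hc' : ‖c‖ₑ ≤ 1 := by
      rw [← ofReal_norm]; exact ENNReal.ofReal_le_one.2 hc
    simpa using hN.mono 1 ENNReal.one_ne_top (fun z => c * g z) g fun z _ => by
      rw [enorm_mul]; exact mul_le_mul_left hc' _
  induction l with
  | zero => intro g; simpa only [conSum_zero] using h0 g
  | succ l ih =>
    intro g
    simp only [conSum_succ, pd_const_mul]
    exact add_le_add (h0 g) (ih _)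

end

theorem hasDerivAt_eval_invAdd (p : ℂ[X]) {z : ℂ} (hz : 1 + z ≠ 0) :
    HasDerivAt (fun z => p.eval (invAdd z)) ((derivative p).eval (invAdd z) * (-(invAdd z) ^ 2)) z := by
  have h0 : HasDerivAt invAdd (-(invAdd z) ^ 2) z := by
    have := ((hasDerivAt_id z).const_add 1).inv hz
    refine this.congr_deriv ?_
    simp only [invAdd, id]
    field_simp
  exact (p.hasDerivAt (invAdd z)).comp z h0

theorem pd_eval_invAdd_mul {σ : ℝ} (p : ℂ[X]) {g : ℂ → ℂ} (hg : DifferentiableOn ℂ g (pencil σ)) :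
    EqOn (pd fun z => p.eval (invAdd z) * g z)
      (fun z => (derivative p * (X ^ 3 - X ^ 2)).eval (invAdd z) * g z +
        p.eval (invAdd z) * pd g z) (pencil σ) := by
  intro z hz
  have hne := one_add_ne_zero_of_re_pos (re_pos_of_mem_pencil hz)
  have hn := (isOpen_pencil σ).mem_nhds hz
  have := ((hasDerivAt_eval_invAdd p hne).fun_mul (hg.differentiableAt hn).hasDerivAt).deriv
  simp only [pd, this, eval_mul, eval_sub, eval_pow, eval_X]
  have e : z / (1 + z) = 1 - invAdd z := by rw [invAdd]; field_simp; ring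
  rw [e]
  ring

theorem differentiableOn_eval_invAdd (p : ℂ[X]) (σ : ℝ) :
    DifferentiableOn ℂ (fun z => p.eval (invAdd z)) (pencil σ) := fun _ hz =>
  (hasDerivAt_eval_invAdd p (one_add_ne_zero_of_re_pos
    (re_pos_of_mem_pencil hz))).differentiableAt.differentiableWithinAt

/-- Polynomials in `1 / (1 + z)` are multipliers for the conormal sums. -/
theorem exists_conSum_mul_le (l : ℕ) : ∀ p : ℂ[X], ∃ C : ℝ, 0 < C ∧ ∀ (σ : ℝ)
    (N : (ℂ → ℂ) → ℝ≥0∞), SolidNorm σ N → ∀ g : ℂ → ℂ, DifferentiableOn ℂ g (pencil σ) →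
      conSum N l (fun z => p.eval (invAdd z) * g z) ≤ ENNReal.ofReal C * conSum N l g := by
  have base : ∀ p : ℂ[X], ∃ C : ℝ, 0 < C ∧ ∀ (σ : ℝ) (N : (ℂ → ℂ) → ℝ≥0∞), SolidNorm σ N →
      ∀ g : ℂ → ℂ, N (fun z => p.eval (invAdd z) * g z) ≤ ENNReal.ofReal C * N g := by
    intro p
    obtain ⟨B, hB⟩ := (isCompact_closedBall (0 : ℂ) 1).exists_bound_of_continuousOn
      p.continuous.continuousOn
    refine ⟨|B| + 1, by positivity, fun σ N hN g => hN.mono _ ENNReal.ofReal_ne_top _ _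
      fun z hz => ?_⟩
    rw [enorm_mul]
    refine mul_le_mul_left ?_ _
    rw [← ofReal_norm]
    refine ENNReal.ofReal_le_ofReal ?_
    have := hB (invAdd z) (by simpa using norm_invAdd_le (re_pos_of_mem_pencil hz))
    linarith [le_abs_self B]
  induction l with
  | zero =>
    intro p
    obtain ⟨C, hC, h⟩ := base p
    exact ⟨C, hC, fun σ N hN g _ => by simpa only [conSum_zero] using h σ N hN g⟩
  | succ l ih =>
    intro p
    obtain ⟨C₀, hC₀, h₀⟩ := base p
    obtain ⟨C₁, hC₁, h₁⟩ := ih (derivative p * (X ^ 3 - X ^ 2))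
    obtain ⟨C₂, hC₂, h₂⟩ := ih p
    refine ⟨C₀ + C₁ + C₂, by positivity, fun σ N hN g hg => ?_⟩
    have hpd := differentiableOn_pd hg
    rw [conSum_succ, hN.conSum_congr (pd_eval_invAdd_mul p hg)]
    calc _ ≤ ENNReal.ofReal C₀ * N g +
          (ENNReal.ofReal C₁ * conSum N l g + ENNReal.ofReal C₂ * conSum N l (pd g)) :=
          add_le_add (h₀ σ N hN g) ((hN.conSum_add_le l
            ((differentiableOn_eval_invAdd _ σ).mul hg)
            ((differentiableOn_eval_invAdd p σ).mul hpd)).trans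
            (add_le_add (h₁ σ N hN g hg) (h₂ σ N hN _ hpd)))
      _ ≤ ENNReal.ofReal C₀ * conSum N (l + 1) g + (ENNReal.ofReal C₁ * conSum N (l + 1) g +
          ENNReal.ofReal C₂ * conSum N (l + 1) g) :=
          add_le_add (mul_le_mul_right (le_conSum _) _) (add_le_add
            (mul_le_mul_right (conSum_le_succ l) _) (mul_le_mul_right (conSum_pd_le l) _))
      _ = _ := by
          rw [ENNReal.ofReal_add (by positivity) hC₂.le, ENNReal.ofReal_add hC₀.le hC₁.le]
          ring

theorem exists_conSum_invAdd_mul_le (l : ℕ) : ∃ C : ℝ, 0 < C ∧ ∀ (σ : ℝ)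
    (N : (ℂ → ℂ) → ℝ≥0∞), SolidNorm σ N → ∀ g : ℂ → ℂ, DifferentiableOn ℂ g (pencil σ) →
      conSum N l (fun z => invAdd z * g z) ≤ ENNReal.ofReal C * conSum N l g := by
  simpa using exists_conSum_mul_le l X

section
variable {ι : Type*} {σ s : ι → ℝ} {U V : ι → (ℂ → ℂ) → ℝ≥0∞}

theorem differentiable_halfConv (q : ℂ[X]) {s : ℝ} (hs : 0 < s) {v : ℂ → ℂ}
    (hv : IntegrableOn (fun y : ℝ => v y) (Ioi 0)) : Differentiable ℂ (halfConv q s v) :=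
  fun z => (hasDerivAt_halfConv q hs hv z).differentiableAt

theorem integrableOn_ofReal {σ : ℝ} (hσ : 0 < σ) {v : ℂ → ℂ}
    (hv : DifferentiableOn ℂ v (pencil σ)) (hfin : modeL1 σ v < ∞) :
    IntegrableOn (fun y : ℝ => v y) (Ioi 0) := by
  have h := integrableOn_comp_gam (θ := 0) (by simpa using hσ) hv.continuousOn hfin
  simp only [gam_zero] at h
  exact h

/-- Bounds for the convolutions on the half-line propagate to conormal derivatives of any order.
The constants are uniform in the parameter `i`. -/
theorem exists_conSum_halfConv_le (hσ : ∀ i, 0 < σ i) (hs : ∀ i, 0 < s i)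
    (hU : ∀ i, SolidNorm (σ i) (U i)) (hV : ∀ i, SolidNorm (σ i) (V i))
    (hfin : ∀ i v, DifferentiableOn ℂ v (pencil (σ i)) → U i v < ∞ → modeL1 (σ i) v < ∞)
    (base : ∀ q : ℂ[X], ∃ C : ℝ, 0 < C ∧ ∀ i v, DifferentiableOn ℂ v (pencil (σ i)) → U i v < ∞ →
      V i (halfConv q (s i) v) ≤ ENNReal.ofReal C * U i v) (l : ℕ) :
    ∀ q : ℂ[X], ∃ C : ℝ, 0 < C ∧ ∀ i v, DifferentiableOn ℂ v (pencil (σ i)) →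
      conSum (U i) l v < ∞ →
      conSum (V i) l (halfConv q (s i) v) ≤ ENNReal.ofReal C * conSum (U i) l v := by
  induction l with
  | zero => simpa only [conSum_zero] using base
  | succ l ih =>
    intro q
    obtain ⟨C₀, hC₀, h₀⟩ := base q
    obtain ⟨C₁, hC₁, h₁⟩ := ih (X * dq q)
    obtain ⟨C₂, hC₂, h₂⟩ := ih q
    obtain ⟨C₃, hC₃, h₃⟩ := exists_conSum_invAdd_mul_le l
    refine ⟨C₀ + C₃ * C₁ * C₃ + C₂ * (C₃ * C₃) + C₂, by positivity, fun i v hv hlt => ?_⟩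
    have hv' := differentiableOn_pd hv
    have hb : DifferentiableOn ℂ (fun w => invAdd w * v w) (pencil (σ i)) :=
      (differentiableOn_invAdd _).mul hv
    have hbb : DifferentiableOn ℂ (fun w => invAdd w * (invAdd w * v w)) (pencil (σ i)) :=
      (differentiableOn_invAdd _).mul hb
    have l0 : U i v < ∞ := (le_conSum (l + 1)).trans_lt hlt
    have l1 : conSum (U i) l v < ∞ := (conSum_le_succ l).trans_lt hlt
    have l2 : conSum (U i) l (pd v) < ∞ := (conSum_pd_le l).trans_lt hlt
    have b1 := h₃ _ _ (hU i) _ hv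
    have b2 : conSum (U i) l (fun w => invAdd w * (invAdd w * v w)) ≤
        ENNReal.ofReal (C₃ * C₃) * conSum (U i) l v := by
      rw [ENNReal.ofReal_mul hC₃.le, mul_assoc]
      exact (h₃ _ _ (hU i) _ hb).trans (mul_le_mul_right b1 _)
    have l3 := b1.trans_lt (ENNReal.mul_lt_top ENNReal.ofReal_lt_top l1)
    have l4 := b2.trans_lt (ENNReal.mul_lt_top ENNReal.ofReal_lt_top l1)
    have i1 := integrableOn_ofReal (hσ i) hv (hfin i v hv l0)
    have i2 := integrableOn_ofReal (hσ i) hv' (hfin i _ hv' ((le_conSum l).trans_lt l2))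
    have i3 := integrableOn_ofReal (hσ i) hb (hfin i _ hb ((le_conSum l).trans_lt l3))
    have i4 := integrableOn_ofReal (hσ i) hbb (hfin i _ hbb ((le_conSum l).trans_lt l4))
    have d1 := (differentiable_halfConv (X * dq q) (hs i)
      (v := fun w => invAdd w * v w) i3).differentiableOn (s := pencil (σ i))
    have d2 := (differentiable_halfConv q (hs i)
      (v := fun w => invAdd w * (invAdd w * v w)) i4).differentiableOn (s := pencil (σ i))
    have d3 := (differentiable_halfConv q (hs i) i2).differentiableOn (s := pencil (σ i))
    have e : EqOn (pd (halfConv q (s i) v)) (fun z =>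
        invAdd z * halfConv (X * dq q) (s i) (fun w => invAdd w * v w) z +
        (halfConv q (s i) (fun w => invAdd w * (invAdd w * v w)) z + halfConv q (s i) (pd v) z))
        (pencil (σ i)) := fun z hz =>
      pd_halfConv q (hs i) (hσ i) hv i1 i2 (one_add_ne_zero_of_re_pos (re_pos_of_mem_pencil hz))
    have t1 : conSum (V i) l (fun z => invAdd z *
        halfConv (X * dq q) (s i) (fun w => invAdd w * v w) z) ≤
        ENNReal.ofReal (C₃ * C₁ * C₃) * conSum (U i) l v := by
      calc _ ≤ ENNReal.ofReal C₃ * (ENNReal.ofReal C₁ * (ENNReal.ofReal C₃ * conSum (U i) l v)) :=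
            (h₃ _ _ (hV i) _ d1).trans (mul_le_mul_right ((h₁ i _ hb l3).trans
              (mul_le_mul_right b1 _)) _)
        _ = _ := by
            rw [ENNReal.ofReal_mul (by positivity), ENNReal.ofReal_mul hC₃.le]; ring
    have t2 : conSum (V i) l (halfConv q (s i) (fun w => invAdd w * (invAdd w * v w))) ≤
        ENNReal.ofReal (C₂ * (C₃ * C₃)) * conSum (U i) l v := by
      rw [ENNReal.ofReal_mul hC₂.le, mul_assoc]
      exact (h₂ i _ hbb l4).trans (mul_le_mul_right b2 _)
    rw [conSum_succ, (hV i).conSum_congr e]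
    calc _ ≤ ENNReal.ofReal C₀ * U i v + (ENNReal.ofReal (C₃ * C₁ * C₃) * conSum (U i) l v +
          (ENNReal.ofReal (C₂ * (C₃ * C₃)) * conSum (U i) l v +
            ENNReal.ofReal C₂ * conSum (U i) l (pd v))) :=
          add_le_add (h₀ i v hv l0) (((hV i).conSum_add_le l ((differentiableOn_invAdd _).mul d1)
            (d2.add d3)).trans (add_le_add t1 (((hV i).conSum_add_le l d2 d3).trans
              (add_le_add t2 (h₂ i _ hv' l2)))))
      _ ≤ ENNReal.ofReal C₀ * conSum (U i) (l + 1) v +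
          (ENNReal.ofReal (C₃ * C₁ * C₃) * conSum (U i) (l + 1) v +
          (ENNReal.ofReal (C₂ * (C₃ * C₃)) * conSum (U i) (l + 1) v +
            ENNReal.ofReal C₂ * conSum (U i) (l + 1) v)) :=
          add_le_add (mul_le_mul_right (le_conSum _) _) (add_le_add
            (mul_le_mul_right (conSum_le_succ l) _) (add_le_add
            (mul_le_mul_right (conSum_le_succ l) _) (mul_le_mul_right (conSum_pd_le l) _)))
      _ = _ := by
          rw [ENNReal.ofReal_add (by positivity) hC₂.le,
            ENNReal.ofReal_add (by positivity) (by positivity),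
            ENNReal.ofReal_add hC₀.le (by positivity)]
          ring

/-! ### The reflected part -/

/-- The contribution to the convolution of the values of `F` on the negative half-line, with a
polynomial weight which makes the family stable under the conormal derivative. -/
noncomputable def reflConv (j : ℕ) (q : ℂ[X]) (s : ℝ) (F : ℝ → ℂ) (z : ℂ) : ℂ :=
  (z / s) ^ j * ∫ x in Iic (0 : ℝ), gker q s (z - x) * F x

theorem hasDerivAt_reflConv (j : ℕ) (q : ℂ[X]) {s : ℝ} (hs : 0 < s) {F : ℝ → ℂ}
    (hF : IntegrableOn F (Iic 0)) (z : ℂ) :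
    HasDerivAt (reflConv j q s F) (j * (z / s) ^ (j - 1) * (1 / s) *
      (∫ x in Iic (0 : ℝ), gker q s (z - x) * F x) +
      (z / s) ^ j * ((s : ℂ)⁻¹ * ∫ x in Iic (0 : ℝ), gker (dq q) s (z - x) * F x)) z :=
  (((hasDerivAt_id z).div_const (s : ℂ)).fun_pow j).fun_mul (hasDerivAt_integral_gker q hs hF z)

theorem pd_reflConv (j : ℕ) (q : ℂ[X]) {s : ℝ} (hs : 0 < s) {F : ℝ → ℂ}
    (hF : IntegrableOn F (Iic 0)) {z : ℂ} (hz : 1 + z ≠ 0) :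
    pd (reflConv j q s F) z = (C (j : ℂ) * X).eval (invAdd z) * reflConv j q s F z +
      invAdd z * reflConv (j + 1) (dq q) s F z := by
  have hs' : (s : ℂ) ≠ 0 := by exact_mod_cast hs.ne'
  rw [pd, (hasDerivAt_reflConv j q hs hF z).deriv]
  simp only [reflConv, eval_mul, eval_C, eval_X, invAdd]
  rcases j with _ | j
  · simp only [Nat.cast_zero, zero_mul, zero_add, pow_zero, pow_one]
    field_simp
  · simp only [Nat.add_sub_cancel]
    rw [pow_succ (z / (s : ℂ)) j, pow_succ (z / (s : ℂ)) (j + 1), pow_succ (z / (s : ℂ)) j]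
    field_simp

theorem exists_conSum_reflConv_le {A : ι → ℝ≥0∞} (hs : ∀ i, 0 < s i)
    (hV : ∀ i, SolidNorm (σ i) (V i))
    (base : ∀ (j : ℕ) (q : ℂ[X]), ∃ C : ℝ, 0 < C ∧ ∀ i F, IntegrableOn F (Iic 0) →
      V i (reflConv j q (s i) F) ≤ ENNReal.ofReal C * (A i * ∫⁻ x in Iic (0 : ℝ), ‖F x‖ₑ)) (l : ℕ) :
    ∀ (j : ℕ) (q : ℂ[X]), ∃ C : ℝ, 0 < C ∧ ∀ i F, IntegrableOn F (Iic 0) →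
      conSum (V i) l (reflConv j q (s i) F) ≤
        ENNReal.ofReal C * (A i * ∫⁻ x in Iic (0 : ℝ), ‖F x‖ₑ) := by
  induction l with
  | zero => simpa only [conSum_zero] using base
  | succ l ih =>
    intro j q
    obtain ⟨C₀, hC₀, h₀⟩ := base j q
    obtain ⟨C₁, hC₁, h₁⟩ := ih j q
    obtain ⟨C₂, hC₂, h₂⟩ := ih (j + 1) (dq q)
    obtain ⟨C₃, hC₃, h₃⟩ := exists_conSum_invAdd_mul_le l
    obtain ⟨C₄, hC₄, h₄⟩ := exists_conSum_mul_le l (C (j : ℂ) * X)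
    refine ⟨C₀ + C₄ * C₁ + C₃ * C₂, by positivity, fun i F hF => ?_⟩
    have hd : ∀ j q, DifferentiableOn ℂ (reflConv j q (s i) F) (pencil (σ i)) := fun j q z _ =>
      (hasDerivAt_reflConv j q (hs i) hF z).differentiableAt.differentiableWithinAt
    have e : EqOn (pd (reflConv j q (s i) F)) (fun z =>
        (C (j : ℂ) * X).eval (invAdd z) * reflConv j q (s i) F z +
          invAdd z * reflConv (j + 1) (dq q) (s i) F z) (pencil (σ i)) := fun z hz =>
      pd_reflConv j q (hs i) hF (one_add_ne_zero_of_re_pos (re_pos_of_mem_pencil hz))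
    rw [conSum_succ, (hV i).conSum_congr e]
    calc _ ≤ ENNReal.ofReal C₀ * (A i * ∫⁻ x in Iic (0 : ℝ), ‖F x‖ₑ) +
          (ENNReal.ofReal C₄ * (ENNReal.ofReal C₁ * (A i * ∫⁻ x in Iic (0 : ℝ), ‖F x‖ₑ)) +
          ENNReal.ofReal C₃ * (ENNReal.ofReal C₂ * (A i * ∫⁻ x in Iic (0 : ℝ), ‖F x‖ₑ))) :=
          add_le_add (h₀ i F hF) (((hV i).conSum_add_le l
            ((differentiableOn_eval_invAdd _ _).mul (hd j q))
            ((differentiableOn_invAdd _).mul (hd (j + 1) (dq q)))).trans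
            (add_le_add ((h₄ _ _ (hV i) _ (hd j q)).trans (mul_le_mul_right (h₁ i F hF) _))
              ((h₃ _ _ (hV i) _ (hd _ _)).trans (mul_le_mul_right (h₂ i F hF) _))))
      _ = _ := by
          rw [ENNReal.ofReal_add (by positivity) (by positivity),
            ENNReal.ofReal_add (by positivity) (by positivity), ENNReal.ofReal_mul hC₄.le,
            ENNReal.ofReal_mul hC₃.le]
          ring

/-- The solution of the mode equations as a sum of a convolution on the half-line and a reflected
part. -/
theorem modeSol_eq {ν a t : ℝ} {v : ℂ → ℂ} {u : ℝ → ℂ} (huv : ∀ y : ℝ, 0 < y → u y = v y)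
    (hν : 0 < ν) (ha : 0 ≤ a) (ht : 0 < t) (hu : IntegrableOn u (Ioi 0))
    (hc : ContinuousOn u (Ioi 0)) (z : ℂ) :
    modeSol ν a u t z = (Real.exp (-(ν * a ^ 2) * t) : ℂ) *
      (halfConv hq (Real.sqrt (ν * t)) v z +
        reflConv 0 hq (Real.sqrt (ν * t)) (extDatum ν a u) z) := by
  have hs := Real.sqrt_pos.2 (mul_pos hν ht)
  have hi := integrable_gker_mul hq hs (integrable_extDatum hν ha hu hc) z
  rw [modeSol, gconv, ← intervalIntegral.integral_Iic_add_Ioi hi.integrableOn hi.integrableOn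
    (b := 0), add_comm]
  congr 2
  · refine setIntegral_congr_fun measurableSet_Ioi fun y hy => ?_
    simp only [extDatum_of_pos (show 0 < y from hy), huv y hy]
  · rw [reflConv, pow_zero, one_mul]

theorem lintegral_Iic_extDatum_le {ν a : ℝ} {u : ℝ → ℂ} (hν : 0 < ν) (ha : 0 ≤ a)
    (hu : IntegrableOn u (Ioi 0)) (hc : ContinuousOn u (Ioi 0)) :
    ∫⁻ x in Iic (0 : ℝ), ‖extDatum ν a u x‖ₑ ≤ 7 * ∫⁻ y in Ioi (0 : ℝ), ‖u y‖ₑ := by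
  refine le_trans (le_of_eq ?_) (lintegral_enorm_reflDatum_le hν ha hu hc)
  have h := (Measure.measurePreserving_neg (volume : Measure ℝ)).setLIntegral_comp_preimage_emb
    (Homeomorph.neg ℝ).measurableEmbedding (fun x => ‖extDatum ν a u x‖ₑ) (Iio 0)
  rw [setLIntegral_congr Iio_ae_eq_Iic.symm, ← h]
  have hpre : Neg.neg ⁻¹' Iio (0 : ℝ) = Ioi 0 := by ext y; simp
  rw [hpre]
  refine setLIntegral_congr_fun measurableSet_Ioi fun y hy => ?_
  simp only [extDatum_neg (show 0 < y from hy)]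

/-- Bounds for the convolutions imply bounds for all conormal derivatives of the solutions of the
mode equations, uniformly in the parameter `i` and in the frequency `a`. -/
theorem exists_conSum_modeSol_le {A : ι → ℝ≥0∞} {ν t : ι → ℝ} (hσ : ∀ i, 0 < σ i)
    (hν : ∀ i, 0 < ν i) (ht : ∀ i, 0 < t i)
    (hU : ∀ i, SolidNorm (σ i) (U i)) (hV : ∀ i, SolidNorm (σ i) (V i))
    (hfin : ∀ i v, DifferentiableOn ℂ v (pencil (σ i)) → U i v < ∞ → modeL1 (σ i) v < ∞)
    (hA : ∀ i v, A i * modeL1 (σ i) v ≤ U i v)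
    (baseD : ∀ q : ℂ[X], ∃ C : ℝ, 0 < C ∧ ∀ i v, DifferentiableOn ℂ v (pencil (σ i)) → U i v < ∞ →
      V i (halfConv q (Real.sqrt (ν i * t i)) v) ≤ ENNReal.ofReal C * U i v)
    (baseR : ∀ (j : ℕ) (q : ℂ[X]), ∃ C : ℝ, 0 < C ∧ ∀ i F, IntegrableOn F (Iic 0) →
      V i (reflConv j q (Real.sqrt (ν i * t i)) F) ≤
        ENNReal.ofReal C * (A i * ∫⁻ x in Iic (0 : ℝ), ‖F x‖ₑ)) (l : ℕ) :
    ∃ C : ℝ, 0 < C ∧ ∀ i a, 0 ≤ a → ∀ v u, (∀ y : ℝ, 0 < y → u y = v y) →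
      DifferentiableOn ℂ v (pencil (σ i)) → conSum (U i) l v < ∞ →
      conSum (V i) l (modeSol (ν i) a u (t i)) ≤ ENNReal.ofReal C * conSum (U i) l v := by
  have hs : ∀ i, 0 < Real.sqrt (ν i * t i) := fun i => Real.sqrt_pos.2 (mul_pos (hν i) (ht i))
  obtain ⟨C₁, hC₁, h₁⟩ := exists_conSum_halfConv_le hσ hs hU hV hfin baseD l hq
  obtain ⟨C₂, hC₂, h₂⟩ := exists_conSum_reflConv_le hs hV baseR l 0 hq
  refine ⟨C₁ + C₂ * 7, by positivity, fun i a ha v u huv hv hlt => ?_⟩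
  have hUv : U i v < ∞ := (le_conSum l).trans_lt hlt
  have iv := integrableOn_ofReal (hσ i) hv (hfin i v hv hUv)
  have hu : IntegrableOn u (Ioi 0) := iv.congr_fun (fun y hy => (huv y hy).symm) measurableSet_Ioi
  have hvc : ContinuousOn (fun y : ℝ => v y) (Ioi 0) :=
    hv.continuousOn.comp Complex.continuous_ofReal.continuousOn
      fun y hy => ofReal_mem_pencil (hσ i) hy
  have hc : ContinuousOn u (Ioi 0) := hvc.congr fun y hy => huv y hy
  have hE := (integrable_extDatum (hν i) ha hu hc).integrableOn (s := Iic 0)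
  have e : EqOn (modeSol (ν i) a u (t i)) (fun z => (Real.exp (-(ν i * a ^ 2) * t i) : ℂ) *
      (halfConv hq (Real.sqrt (ν i * t i)) v z +
        reflConv 0 hq (Real.sqrt (ν i * t i)) (extDatum (ν i) a u) z)) (pencil (σ i)) :=
    fun z _ => modeSol_eq huv (hν i) ha (ht i) hu hc z
  have hL : ∫⁻ y in Ioi (0 : ℝ), ‖u y‖ₑ ≤ modeL1 (σ i) v := by
    refine le_trans (le_of_eq ?_) (lintegral_gam_le_modeL1 (θ := 0) (by simpa using hσ i) v)
    refine setLIntegral_congr_fun measurableSet_Ioi fun y hy => ?_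
    simp only [huv y hy, gam_zero]
  rw [(hV i).conSum_congr e]
  refine ((hV i).conSum_const_mul_le (norm_exp_neg_le_one (hν i) (ht i).le) l _).trans ?_
  refine ((hV i).conSum_add_le l (differentiable_halfConv hq (hs i) iv).differentiableOn
    fun z _ => (hasDerivAt_reflConv 0 hq (hs i) hE z).differentiableAt.differentiableWithinAt).trans
    ?_
  have h3 : A i * ∫⁻ x in Iic (0 : ℝ), ‖extDatum (ν i) a u x‖ₑ ≤ 7 * conSum (U i) l v := by
    calc _ ≤ A i * (7 * modeL1 (σ i) v) := mul_le_mul_right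
          ((lintegral_Iic_extDatum_le (hν i) ha hu hc).trans (mul_le_mul_right hL _)) _
      _ = 7 * (A i * modeL1 (σ i) v) := by ring
      _ ≤ _ := mul_le_mul_right ((hA i v).trans (le_conSum l)) _
  calc _ ≤ ENNReal.ofReal C₁ * conSum (U i) l v + ENNReal.ofReal C₂ * (7 * conSum (U i) l v) :=
        add_le_add (h₁ i v hv hlt) ((h₂ i _ hE).trans (mul_le_mul_right h3 _))
    _ = _ := by
        rw [ENNReal.ofReal_add hC₁.le (by positivity), ENNReal.ofReal_mul hC₂.le,
          ENNReal.ofReal_ofNat]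
        ring

end

/-! ### Bounds in `L¹` along contours -/

theorem measurable_contourSpeed (θ : ℝ) : Measurable (contourSpeed θ) := by
  unfold contourSpeed
  exact Measurable.ite measurableSet_Iio measurable_const measurable_const

theorem aemeasurable_enorm_comp_gam {σ θ : ℝ} (hθ : |θ| < σ) {g : ℂ → ℂ}
    (hg : ContinuousOn g (pencil σ)) :
    AEMeasurable (fun r : ℝ => ‖g (gam θ r)‖ₑ) (volume.restrict (Ioi 0)) :=
  ((continuousOn_comp_gam_right hθ hg).aestronglyMeasurable measurableSet_Ioi).enorm

theorem contourL1_eq {θ : ℝ} (hθ : 0 ≤ θ) (g : ℂ → ℂ) :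
    contourL1 θ g = ∫⁻ r in Ioi (0 : ℝ), (‖g (gam θ r)‖ₑ + ‖g (gam (-θ) r)‖ₑ) *
      ENNReal.ofReal (contourSpeed θ r) := by
  simp only [contourL1]
  simp only [conj_contour_eq_gam hθ]
  simp only [contour_eq_gam hθ]

theorem solidNorm_modeL1 (σ : ℝ) : SolidNorm σ (modeL1 σ) where
  mono c hc g h H := modeL1_le_of_le hc H
  add_le g h hg hh := by
    refine iSup₂_le fun θ hθ => ?_
    have h1 : |θ| < σ := by rw [abs_of_nonneg hθ.1]; exact hθ.2
    have h2 : |-θ| < σ := by rwa [abs_neg]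
    refine le_trans ?_ (add_le_add
      (le_iSup₂ (f := fun θ (_ : θ ∈ Ico 0 σ) => contourL1 θ g) θ hθ)
      (le_iSup₂ (f := fun θ (_ : θ ∈ Ico 0 σ) => contourL1 θ h) θ hθ))
    rw [contourL1_eq hθ.1, contourL1_eq hθ.1, contourL1_eq hθ.1, ← lintegral_add_left']
    · refine lintegral_mono fun r => ?_
      rw [← add_mul]
      refine mul_le_mul_left ?_ _
      calc _ ≤ (‖g (gam θ r)‖ₑ + ‖h (gam θ r)‖ₑ) + (‖g (gam (-θ) r)‖ₑ + ‖h (gam (-θ) r)‖ₑ) :=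
            add_le_add (enorm_add_le _ _) (enorm_add_le _ _)
        _ = _ := by ring
    · exact ((aemeasurable_enorm_comp_gam h1 hg).add (aemeasurable_enorm_comp_gam h2 hg)).mul
        (measurable_contourSpeed θ).ennreal_ofReal.aemeasurable

theorem modeL1_le_of_lintegral_gam_le {σ : ℝ} (hσ : σ ≤ 1) {g : ℂ → ℂ}
    (hg : ContinuousOn g (pencil σ)) {B : ℝ≥0∞}
    (h : ∀ θ, |θ| < σ → ∫⁻ r in Ioi (0 : ℝ), ‖g (gam θ r)‖ₑ ≤ B) : modeL1 σ g ≤ 4 * B := by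
  refine iSup₂_le fun θ hθ => ?_
  have h1 : |θ| < σ := by rw [abs_of_nonneg hθ.1]; exact hθ.2
  have h2 : |-θ| < σ := by rwa [abs_neg]
  rw [contourL1_eq hθ.1]
  calc _ ≤ ∫⁻ r in Ioi (0 : ℝ), (‖g (gam θ r)‖ₑ + ‖g (gam (-θ) r)‖ₑ) * 2 := by
        refine lintegral_mono fun r => mul_le_mul_right ?_ _
        rw [← ENNReal.ofReal_ofNat]
        exact ENNReal.ofReal_le_ofReal (contourSpeed_le_two hθ.1 (hθ.2.le.trans hσ) r)
    _ = ((∫⁻ r in Ioi (0 : ℝ), ‖g (gam θ r)‖ₑ) + ∫⁻ r in Ioi (0 : ℝ), ‖g (gam (-θ) r)‖ₑ) * 2 := by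
        rw [lintegral_mul_const' _ _ (by simp),
          lintegral_add_left' (aemeasurable_enorm_comp_gam h1 hg)]
    _ ≤ (B + B) * 2 := mul_le_mul_left (add_le_add (h _ h1) (h _ h2)) _
    _ = _ := by ring

theorem lintegral_genv {c s : ℝ} (hc : 0 < c) (hs : 0 < s) :
    ∫⁻ r, ENNReal.ofReal (genv c s r) = ENNReal.ofReal (Real.sqrt (Real.pi / c)) := by
  rw [← ofReal_integral_eq_lintegral_ofReal (integrable_genv hc hs)
    (Eventually.of_forall fun r => genv_nonneg c hs r), integral_genv hs]

theorem lintegral_genv_conv_le {c s : ℝ} (hc : 0 < c) (hs : 0 < s) {w : ℝ → ℝ≥0∞}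
    (hw : AEMeasurable w (volume.restrict (Ioi 0))) :
    ∫⁻ r in Ioi (0 : ℝ), ∫⁻ r' in Ioi (0 : ℝ), ENNReal.ofReal (genv c s (r - r')) * w r' ≤
      ENNReal.ofReal (Real.sqrt (Real.pi / c)) * ∫⁻ r in Ioi (0 : ℝ), w r := by
  have hI : 0 < Real.sqrt (Real.pi / c) := Real.sqrt_pos.2 (div_pos Real.pi_pos hc)
  set I := Real.sqrt (Real.pi / c)
  have h1 : ∀ x, ENNReal.ofReal (genv c s x) =
      ENNReal.ofReal I * ENNReal.ofReal (I⁻¹ * genv c s x) := fun x => by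
    rw [← ENNReal.ofReal_mul hI.le, ← mul_assoc, mul_inv_cancel₀ hI.ne', one_mul]
  have h2 : ∫⁻ x, ENNReal.ofReal (I⁻¹ * genv c s x) ≤ 1 := by
    simp only [ENNReal.ofReal_mul (inv_pos.2 hI).le]
    rw [lintegral_const_mul' _ _ ENNReal.ofReal_ne_top, lintegral_genv hc hs,
      ← ENNReal.ofReal_mul (inv_pos.2 hI).le]
    change ENNReal.ofReal (I⁻¹ * I) ≤ 1
    rw [inv_mul_cancel₀ hI.ne', ENNReal.ofReal_one]
  have h3 := lintegral_conv_le (Φ := fun x => ENNReal.ofReal (I⁻¹ * genv c s x))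
    (((continuous_genv c s).const_mul I⁻¹).measurable.ennreal_ofReal) h2 hw
  simp only [h1, mul_assoc]
  simp only [lintegral_const_mul' _ _ (ENNReal.ofReal_ne_top (r := I))]
  exact mul_le_mul_right h3 _

theorem one_sub_sq_pos {σ₁ : ℝ} (h0 : 0 ≤ σ₁) (h1 : σ₁ < 1) : 0 < (1 - σ₁ ^ 2) / 8 := by
  have : 0 < 1 - σ₁ ^ 2 := by nlinarith
  positivity

theorem exists_modeL1_halfConv_le (q : ℂ[X]) {σ₁ : ℝ} (h0 : 0 ≤ σ₁) (h1 : σ₁ < 1) :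
    ∃ C : ℝ, 0 < C ∧ ∀ s : ℝ, 0 < s → ∀ σ, 0 < σ → σ ≤ σ₁ → ∀ v : ℂ → ℂ,
      DifferentiableOn ℂ v (pencil σ) → modeL1 σ v < ∞ →
      modeL1 σ (halfConv q s v) ≤ ENNReal.ofReal C * modeL1 σ v := by
  obtain ⟨C, hC, h⟩ := exists_enorm_halfConv_gam_le q h0 h1
  have hc := one_sub_sq_pos h0 h1
  have hI : 0 < Real.sqrt (Real.pi / ((1 - σ₁ ^ 2) / 8)) := Real.sqrt_pos.2 (div_pos Real.pi_pos hc)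
  refine ⟨4 * (C * Real.sqrt (Real.pi / ((1 - σ₁ ^ 2) / 8))), by positivity,
    fun s hs σ hσ hσ1 v hv hfin => ?_⟩
  have hcont : ContinuousOn (halfConv q s v) (pencil σ) :=
    (differentiable_halfConv q hs (integrableOn_ofReal hσ hv hfin)).continuous.continuousOn
  refine (modeL1_le_of_lintegral_gam_le (by linarith) hcont
    (B := ENNReal.ofReal (C * Real.sqrt (Real.pi / ((1 - σ₁ ^ 2) / 8))) * modeL1 σ v)
    fun θ hθ => ?_).trans (le_of_eq ?_)
  · calc _ ≤ ∫⁻ r in Ioi (0 : ℝ), ENNReal.ofReal C * ∫⁻ r' in Ioi (0 : ℝ),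
          ENNReal.ofReal (genv ((1 - σ₁ ^ 2) / 8) s (r - r')) * ‖v (gam θ r')‖ₑ :=
          setLIntegral_mono' measurableSet_Ioi fun r hr => h s hs σ hσ1 v hv hfin θ hθ r hr
      _ ≤ ENNReal.ofReal C * (ENNReal.ofReal (Real.sqrt (Real.pi / ((1 - σ₁ ^ 2) / 8))) *
          modeL1 σ v) := by
          rw [lintegral_const_mul' _ _ ENNReal.ofReal_ne_top]
          exact mul_le_mul_right ((lintegral_genv_conv_le hc hs
            (aemeasurable_enorm_comp_gam hθ hv.continuousOn)).trans
            (mul_le_mul_right (lintegral_gam_le_modeL1 hθ v) _)) _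
      _ = _ := by rw [ENNReal.ofReal_mul hC.le, mul_assoc]
  · rw [ENNReal.ofReal_mul (by norm_num : (0 : ℝ) ≤ 4), ENNReal.ofReal_ofNat, mul_assoc]

theorem gker_X_pow_mul (j : ℕ) (q : ℂ[X]) (s : ℝ) (x : ℂ) :
    gker (X ^ j * q) s x = (x / s) ^ j * gker q s x := by
  simp only [gker, eval_mul, eval_pow, eval_X]; ring

theorem genv_anti {c s : ℝ} (hc : 0 < c) (hs : 0 < s) {x y : ℝ} (hx : 0 ≤ x) (hxy : x ≤ y) :
    genv c s y ≤ genv c s x := by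
  unfold genv
  have : (x / s) ^ 2 ≤ (y / s) ^ 2 := by gcongr
  gcongr s⁻¹ * Real.exp ?_
  nlinarith

/-- The reflected part is bounded pointwise by a Gaussian in the distance to the wall. -/
theorem exists_enorm_reflConv_le (j : ℕ) (q : ℂ[X]) {σ₁ : ℝ} (h0 : 0 ≤ σ₁) (h1 : σ₁ < 1) :
    ∃ C : ℝ, 0 < C ∧ ∀ s : ℝ, 0 < s → ∀ σ, σ ≤ σ₁ → ∀ F : ℝ → ℂ,
      ∀ z ∈ pencil σ, ‖reflConv j q s F z‖ₑ ≤
        ENNReal.ofReal (C * genv ((1 - σ₁ ^ 2) / 8) s z.re) * ∫⁻ x in Iic (0 : ℝ), ‖F x‖ₑ := by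
  obtain ⟨C, hC, h⟩ := exists_norm_gker_le_genv (X ^ j * q) h0 h1
  have hc := one_sub_sq_pos h0 h1
  refine ⟨C, hC, fun s hs σ hσ F z hz => ?_⟩
  have hre := re_pos_of_mem_pencil hz
  have him := (mem_pencil_iff.1 hz).1
  have hpt : ∀ x ∈ Iic (0 : ℝ), ‖(z / s) ^ j * (gker q s (z - x) * F x)‖ₑ ≤
      ENNReal.ofReal (C * genv ((1 - σ₁ ^ 2) / 8) s z.re) * ‖F x‖ₑ := by
    intro x hx
    have hx : x ≤ 0 := hx
    have e1 : (z - x).re = z.re - x := by simp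
    have e2 : (z - x).im = z.im := by simp
    have hk : ‖(z / s) ^ j * gker q s (z - x)‖ ≤ C * genv ((1 - σ₁ ^ 2) / 8) s z.re := by
      have n1 : ‖z‖ ≤ ‖z - x‖ := by
        rw [Complex.norm_eq_sqrt_sq_add_sq, Complex.norm_eq_sqrt_sq_add_sq, e1, e2]
        apply Real.sqrt_le_sqrt
        nlinarith
      calc _ ≤ ‖gker (X ^ j * q) s (z - x)‖ := by
            rw [gker_X_pow_mul, norm_mul, norm_mul, norm_pow, norm_pow, norm_div, norm_div]
            gcongr
        _ ≤ C * genv ((1 - σ₁ ^ 2) / 8) s (z - x).re := by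
            refine h s hs _ ?_
            rw [e1, e2, abs_of_nonneg (by linarith : 0 ≤ z.re - x)]
            nlinarith
        _ ≤ _ := by
            rw [e1]
            exact mul_le_mul_of_nonneg_left (genv_anti hc hs hre.le (by linarith)) hC.le
    rw [← mul_assoc, enorm_mul]
    refine mul_le_mul_left ?_ _
    rw [← ofReal_norm]
    exact ENNReal.ofReal_le_ofReal hk
  rw [reflConv, ← integral_const_mul, ← lintegral_const_mul' _ _ ENNReal.ofReal_ne_top]
  exact (enorm_integral_le_lintegral_enorm _).trans (setLIntegral_mono' measurableSet_Iic hpt)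

theorem exists_modeL1_reflConv_le (j : ℕ) (q : ℂ[X]) {σ₁ : ℝ} (h0 : 0 ≤ σ₁) (h1 : σ₁ < 1) :
    ∃ C : ℝ, 0 < C ∧ ∀ s : ℝ, 0 < s → ∀ σ, σ ≤ σ₁ → ∀ F : ℝ → ℂ, IntegrableOn F (Iic 0) →
      modeL1 σ (reflConv j q s F) ≤ ENNReal.ofReal C * ∫⁻ x in Iic (0 : ℝ), ‖F x‖ₑ := by
  obtain ⟨C, hC, h⟩ := exists_enorm_reflConv_le j q h0 h1
  have hc := one_sub_sq_pos h0 h1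
  have hI : 0 < Real.sqrt (Real.pi / ((1 - σ₁ ^ 2) / 8)) := Real.sqrt_pos.2 (div_pos Real.pi_pos hc)
  refine ⟨4 * (C * Real.sqrt (Real.pi / ((1 - σ₁ ^ 2) / 8))), by positivity,
    fun s hs σ hσ F hF => ?_⟩
  have hcont : ContinuousOn (reflConv j q s F) (pencil σ) := fun z _ =>
    (hasDerivAt_reflConv j q hs hF z).continuousAt.continuousWithinAt
  refine (modeL1_le_of_lintegral_gam_le (by linarith) hcont
    (B := ENNReal.ofReal (C * Real.sqrt (Real.pi / ((1 - σ₁ ^ 2) / 8))) *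
      ∫⁻ x in Iic (0 : ℝ), ‖F x‖ₑ) fun θ hθ => ?_).trans (le_of_eq ?_)
  · calc _ ≤ ∫⁻ r in Ioi (0 : ℝ), ENNReal.ofReal (C * genv ((1 - σ₁ ^ 2) / 8) s r) *
          ∫⁻ x in Iic (0 : ℝ), ‖F x‖ₑ := setLIntegral_mono' measurableSet_Ioi fun r hr => by
            simpa only [gam_re] using h s hs σ hσ F _ (gam_mem_pencil hθ hr)
      _ ≤ ∫⁻ r, ENNReal.ofReal (C * genv ((1 - σ₁ ^ 2) / 8) s r) *
          ∫⁻ x in Iic (0 : ℝ), ‖F x‖ₑ := setLIntegral_le_lintegral _ _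
      _ = _ := by
          simp only [ENNReal.ofReal_mul hC.le, mul_assoc]
          rw [lintegral_const_mul' _ _ ENNReal.ofReal_ne_top, lintegral_mul_const' _ _ hF.2.ne,
            lintegral_genv hc hs]
  · rw [ENNReal.ofReal_mul (by norm_num : (0 : ℝ) ≤ 4), ENNReal.ofReal_ofNat, mul_assoc]

/-! ### Bounds in the boundary layer norms -/

theorem profile_pos (P y : ℝ) : 0 < profile P y := by unfold profile; positivity

theorem layer_nonneg {P d r : ℝ} (hd : 0 ≤ d) : 0 ≤ layer P d r :=
  mul_nonneg (inv_nonneg.2 hd) (profile_pos _ _).le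

theorem one_le_blWeight (ν P t r : ℝ) : 1 ≤ blWeight ν P t r := by
  unfold blWeight
  have h1 : 0 ≤ layer P (Real.sqrt ν) r := layer_nonneg (Real.sqrt_nonneg _)
  have h2 : 0 ≤ (if t = 0 then 0 else layer P (Real.sqrt (ν * t)) r) := by
    split_ifs
    exacts [le_rfl, layer_nonneg (Real.sqrt_nonneg _)]
  linarith

theorem layer_le_blWeight {ν P t : ℝ} (ht : t ≠ 0) (r : ℝ) :
    layer P (Real.sqrt (ν * t)) r ≤ blWeight ν P t r := by
  unfold blWeight
  rw [if_neg ht]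
  have h1 : 0 ≤ layer P (Real.sqrt ν) r := layer_nonneg (Real.sqrt_nonneg _)
  linarith

theorem solidNorm_modeBL (ν β₀ P σ t : ℝ) : SolidNorm σ (modeBL ν β₀ P σ t) where
  mono c hc g h H := by
    refine iSup₂_le fun z hz => ?_
    refine le_trans ?_ (mul_le_mul_right (le_iSup₂ (f := fun z (_ : z ∈ pencil σ) => ‖h z‖ₑ *
      ENNReal.ofReal (Real.exp (β₀ * z.re) * (blWeight ν P t z.re)⁻¹)) z hz) c)
    rw [← mul_assoc]
    exact mul_le_mul_left (H z hz) _
  add_le g h _ _ := by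
    refine iSup₂_le fun z hz => ?_
    refine le_trans ?_ (add_le_add
      (le_iSup₂ (f := fun z (_ : z ∈ pencil σ) => ‖g z‖ₑ *
      ENNReal.ofReal (Real.exp (β₀ * z.re) * (blWeight ν P t z.re)⁻¹)) z hz)
      (le_iSup₂ (f := fun z (_ : z ∈ pencil σ) => ‖h z‖ₑ *
      ENNReal.ofReal (Real.exp (β₀ * z.re) * (blWeight ν P t z.re)⁻¹)) z hz))
    rw [← add_mul]
    exact mul_le_mul_left (enorm_add_le _ _) _

theorem enorm_le_modeBL {ν β₀ P σ t : ℝ} (v : ℂ → ℂ) {z : ℂ} (hz : z ∈ pencil σ) :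
    ‖v z‖ₑ ≤ modeBL ν β₀ P σ t v *
      ENNReal.ofReal (Real.exp (-(β₀ * z.re)) * blWeight ν P t z.re) := by
  have hW : 0 < blWeight ν P t z.re := one_pos.trans_le (one_le_blWeight _ _ _ _)
  have h := le_iSup₂ (f := fun z (_ : z ∈ pencil σ) => ‖v z‖ₑ *
      ENNReal.ofReal (Real.exp (β₀ * z.re) * (blWeight ν P t z.re)⁻¹)) z hz
  refine le_trans (le_of_eq ?_) (mul_le_mul_left h _)
  rw [mul_assoc, ← ENNReal.ofReal_mul (by positivity), Real.exp_neg]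
  have : Real.exp (β₀ * z.re) * (blWeight ν P t z.re)⁻¹ *
      ((Real.exp (β₀ * z.re))⁻¹ * blWeight ν P t z.re) = 1 := by
    have := (Real.exp_pos (β₀ * z.re)).ne'
    field_simp
  rw [this, ENNReal.ofReal_one, mul_one]

theorem profile_le_of_le_two_mul {P y y' : ℝ} (hP : 0 ≤ P) (hy : 0 ≤ y) (hyy : y ≤ 2 * y') :
    profile P y' ≤ 2 ^ P * profile P y := by
  have hy' : 0 ≤ y' := by linarith
  unfold profile
  rw [abs_of_nonneg hy, abs_of_nonneg hy', mul_one_div, div_le_div_iff₀ (by positivity)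
    (by positivity), one_mul]
  have h1 : y ^ P ≤ 2 ^ P * y' ^ P := by
    rw [← Real.mul_rpow (by norm_num) hy']
    exact Real.rpow_le_rpow hy hyy hP
  have h2 : (1 : ℝ) ≤ 2 ^ P := Real.one_le_rpow (by norm_num) hP
  nlinarith

theorem blWeight_le_of_le_two_mul {ν P t r r' : ℝ} (hP : 0 ≤ P) (hr : 0 ≤ r) (hrr : r ≤ 2 * r') :
    blWeight ν P t r' ≤ 2 ^ P * blWeight ν P t r := by
  have hl : ∀ d : ℝ, 0 ≤ d → layer P d r' ≤ 2 ^ P * layer P d r := by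
    intro d hd
    have hd' := inv_nonneg.2 hd
    unfold layer
    have := profile_le_of_le_two_mul (P := P) (y := d⁻¹ * r) (y' := d⁻¹ * r') hP (by positivity)
      (by nlinarith [mul_le_mul_of_nonneg_left hrr hd'])
    calc _ ≤ d⁻¹ * (2 ^ P * profile P (d⁻¹ * r)) := mul_le_mul_of_nonneg_left this hd'
      _ = _ := by ring
  have h1 := hl _ (Real.sqrt_nonneg ν)
  have h2 := hl _ (Real.sqrt_nonneg (ν * t))
  have h3 : (1 : ℝ) ≤ 2 ^ P := Real.one_le_rpow (by norm_num) hP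
  unfold blWeight
  split_ifs <;> nlinarith

theorem layer_le_mul_layer {P s d r : ℝ} (hP : 0 ≤ P) (hs : 0 < s) (hsd : s ≤ d) (hr : 0 ≤ r) :
    layer P s r ≤ d / s * layer P d r := by
  have hd : 0 < d := hs.trans_le hsd
  have h1 : profile P (s⁻¹ * r) ≤ profile P (d⁻¹ * r) := by
    unfold profile
    rw [abs_of_nonneg (by positivity), abs_of_nonneg (by positivity)]
    gcongr
  unfold layer
  calc _ ≤ s⁻¹ * profile P (d⁻¹ * r) := mul_le_mul_of_nonneg_left h1 (inv_nonneg.2 hs.le)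
    _ = _ := by field_simp

/-- An exponential factor is absorbed by a Gaussian, by completion of the square. -/
theorem genv_mul_exp_le {c s β : ℝ} (hc : 0 < c) (hs : 0 < s) (x : ℝ) :
    genv c s x * Real.exp (β * x) ≤ Real.exp (β ^ 2 * s ^ 2 / (2 * c)) * genv (c / 2) s x := by
  unfold genv
  have h : -c * (x / s) ^ 2 + β * x ≤ β ^ 2 * s ^ 2 / (2 * c) + -(c / 2) * (x / s) ^ 2 := by
    have h1 : 0 ≤ (β * s - c * (x / s)) ^ 2 / (2 * c) := by positivity
    have h2 : (β * s - c * (x / s)) ^ 2 / (2 * c) =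
        β ^ 2 * s ^ 2 / (2 * c) - β * x + c / 2 * (x / s) ^ 2 := by field_simp; ring
    linarith
  calc _ = s⁻¹ * Real.exp (-c * (x / s) ^ 2 + β * x) := by rw [Real.exp_add]; ring
    _ ≤ s⁻¹ * Real.exp (β ^ 2 * s ^ 2 / (2 * c) + -(c / 2) * (x / s) ^ 2) := by gcongr
    _ = _ := by rw [Real.exp_add]; ring

theorem exists_genv_le_layer {c P : ℝ} (hc : 0 < c) (hP : 0 ≤ P) :
    ∃ C : ℝ, 0 < C ∧ ∀ s r, 0 < s → 0 ≤ r → genv c s r ≤ C * layer P s r := by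
  obtain ⟨D, hD, h⟩ := exists_norm_eval_le_exp (X ^ ⌈P⌉₊) hc
  refine ⟨2 + D, by positivity, fun s r hs hr => ?_⟩
  unfold genv layer profile
  have hy : 0 ≤ s⁻¹ * r := by positivity
  have e : r / s = s⁻¹ * r := by ring
  rw [e, abs_of_nonneg hy]
  set y := s⁻¹ * r
  have h1 : y ^ P ≤ 1 + y ^ ⌈P⌉₊ := by
    rcases le_total y 1 with h1 | h1
    · have : y ^ P ≤ 1 := Real.rpow_le_one hy h1 hP
      have : 0 ≤ y ^ ⌈P⌉₊ := by positivity
      linarith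
    · have : y ^ P ≤ y ^ (⌈P⌉₊ : ℝ) := Real.rpow_le_rpow_of_exponent_le h1 (Nat.le_ceil P)
      rw [Real.rpow_natCast] at this
      linarith
  have h2 : y ^ ⌈P⌉₊ ≤ D * Real.exp (c * y ^ 2) := by
    have := h (y : ℂ)
    simpa [abs_of_nonneg hy] using this
  have h3 : 1 ≤ Real.exp (c * y ^ 2) := Real.one_le_exp (by positivity)
  have h4 : 1 + y ^ P ≤ (2 + D) * Real.exp (c * y ^ 2) := by nlinarith
  have h5 : Real.exp (-c * y ^ 2) = (Real.exp (c * y ^ 2))⁻¹ := by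
    rw [← Real.exp_neg]; congr 1; ring
  have h6 : (Real.exp (c * y ^ 2))⁻¹ ≤ (2 + D) * (1 / (1 + y ^ P)) := by
    rw [mul_one_div, inv_eq_one_div, div_le_div_iff₀ (by positivity) (by positivity)]
    linarith
  rw [h5]
  calc _ ≤ s⁻¹ * ((2 + D) * (1 / (1 + y ^ P))) := by gcongr
    _ = _ := by ring

/-- A Gaussian of width `s = √(ντ)`, `τ ≤ t`, is dominated by the boundary layer weight of time `t`,
with a loss `√(t / τ)`. -/
theorem exists_genv_le_blWeight {c P β₀ : ℝ} (hc : 0 < c) (hP : 0 ≤ P) (T ν₀ : ℝ) :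
    ∃ C : ℝ, 0 < C ∧ ∀ ν τ t r, 0 < ν → ν ≤ ν₀ → 0 < τ → τ ≤ t → t ≤ T → 0 ≤ r →
      genv c (Real.sqrt (ν * τ)) r * (Real.exp (β₀ * r) * (blWeight ν P t r)⁻¹) ≤
        C * Real.sqrt (t / τ) := by
  obtain ⟨C, hC, h⟩ := exists_genv_le_layer (half_pos hc) hP
  refine ⟨Real.exp (β₀ ^ 2 * (ν₀ * T) / (2 * c)) * C, by positivity,
    fun ν τ t r hν hν₀ hτ hτt htT hr => ?_⟩
  have ht : 0 < t := hτ.trans_le hτt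
  have hs : 0 < Real.sqrt (ν * τ) := Real.sqrt_pos.2 (mul_pos hν hτ)
  have hsd : Real.sqrt (ν * τ) ≤ Real.sqrt (ν * t) := Real.sqrt_le_sqrt (by gcongr)
  have hW : 0 < blWeight ν P t r := one_pos.trans_le (one_le_blWeight _ _ _ _)
  have e1 : Real.sqrt (ν * t) / Real.sqrt (ν * τ) = Real.sqrt (t / τ) := by
    rw [← Real.sqrt_div (by positivity)]; congr 1; field_simp
  have h1 : genv (c / 2) (Real.sqrt (ν * τ)) r ≤ C * (Real.sqrt (t / τ) * blWeight ν P t r) := by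
    refine (h _ r hs hr).trans (mul_le_mul_of_nonneg_left ?_ hC.le)
    refine (layer_le_mul_layer hP hs hsd hr).trans ?_
    rw [e1]
    exact mul_le_mul_of_nonneg_left (layer_le_blWeight ht.ne' r) (Real.sqrt_nonneg _)
  have h2 : Real.exp (β₀ ^ 2 * Real.sqrt (ν * τ) ^ 2 / (2 * c)) ≤
      Real.exp (β₀ ^ 2 * (ν₀ * T) / (2 * c)) := by
    rw [Real.sq_sqrt (by positivity)]
    have : ν * τ ≤ ν₀ * T := by
      have : τ ≤ T := hτt.trans htT
      have : 0 < ν₀ := hν.trans_le hν₀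
      gcongr
    gcongr
  calc _ = genv c (Real.sqrt (ν * τ)) r * Real.exp (β₀ * r) * (blWeight ν P t r)⁻¹ := by ring
    _ ≤ Real.exp (β₀ ^ 2 * (ν₀ * T) / (2 * c)) * (C * (Real.sqrt (t / τ) * blWeight ν P t r)) *
        (blWeight ν P t r)⁻¹ := by
        refine mul_le_mul_of_nonneg_right ?_ (inv_nonneg.2 hW.le)
        refine (genv_mul_exp_le hc hs r).trans ?_
        exact mul_le_mul h2 h1 (genv_nonneg _ hs _) (Real.exp_pos _).le
    _ = _ := by field_simp

theorem exists_modeBL_reflConv_le (j : ℕ) (q : ℂ[X]) {σ₁ P : ℝ} (h0 : 0 ≤ σ₁) (h1 : σ₁ < 1)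
    (hP : 0 ≤ P) (β₀ T ν₀ : ℝ) :
    ∃ C : ℝ, 0 < C ∧ ∀ ν τ t σ, 0 < ν → ν ≤ ν₀ → 0 < τ → τ ≤ t → t ≤ T → σ ≤ σ₁ →
      ∀ F : ℝ → ℂ, modeBL ν β₀ P σ t (reflConv j q (Real.sqrt (ν * τ)) F) ≤
        ENNReal.ofReal C * (ENNReal.ofReal (Real.sqrt (t / τ)) * ∫⁻ x in Iic (0 : ℝ), ‖F x‖ₑ) := by
  obtain ⟨C, hC, h⟩ := exists_enorm_reflConv_le j q h0 h1
  have hc := one_sub_sq_pos h0 h1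
  obtain ⟨D, hD, h'⟩ := exists_genv_le_blWeight (β₀ := β₀) hc hP T ν₀
  refine ⟨C * D, by positivity, fun ν τ t σ hν hν₀ hτ hτt htT hσ F => iSup₂_le fun z hz => ?_⟩
  have hre := re_pos_of_mem_pencil hz
  have hs : 0 < Real.sqrt (ν * τ) := Real.sqrt_pos.2 (mul_pos hν hτ)
  have hg := genv_nonneg ((1 - σ₁ ^ 2) / 8) hs z.re
  have hmain := h' ν τ t z.re hν hν₀ hτ hτt htT hre.le
  calc _ ≤ ENNReal.ofReal (C * genv ((1 - σ₁ ^ 2) / 8) (Real.sqrt (ν * τ)) z.re) *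
        (∫⁻ x in Iic (0 : ℝ), ‖F x‖ₑ) *
        ENNReal.ofReal (Real.exp (β₀ * z.re) * (blWeight ν P t z.re)⁻¹) :=
        mul_le_mul_left (h _ hs σ hσ F z hz) _
    _ = ENNReal.ofReal (C * (genv ((1 - σ₁ ^ 2) / 8) (Real.sqrt (ν * τ)) z.re *
        (Real.exp (β₀ * z.re) * (blWeight ν P t z.re)⁻¹))) * ∫⁻ x in Iic (0 : ℝ), ‖F x‖ₑ := by
        rw [← mul_assoc C, ENNReal.ofReal_mul (by positivity : (0 : ℝ) ≤ C *
          genv ((1 - σ₁ ^ 2) / 8) (Real.sqrt (ν * τ)) z.re)]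
        ring
    _ ≤ ENNReal.ofReal (C * (D * Real.sqrt (t / τ))) * ∫⁻ x in Iic (0 : ℝ), ‖F x‖ₑ :=
        mul_le_mul_left (ENNReal.ofReal_le_ofReal (mul_le_mul_of_nonneg_left hmain hC.le)) _
    _ = _ := by
        rw [← mul_assoc C, ENNReal.ofReal_mul (by positivity), mul_assoc]

/-- The boundary layer bound for the convolution on the half-line. The values of `v` at distance
less than half that of `z` from the wall contribute a Gaussian tail times an `L¹` norm; at the others
the weight of `v` is comparable to that at `z`. -/
theorem exists_modeBL_halfConv_le (q : ℂ[X]) {σ₁ P β₀ : ℝ} (h0 : 0 ≤ σ₁) (h1 : σ₁ < 1)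
    (hP : 0 ≤ P) (T ν₀ : ℝ) :
    ∃ C : ℝ, 0 < C ∧ ∀ ν τ t t' σ K, 0 < ν → ν ≤ ν₀ → 0 < τ → τ ≤ t → t ≤ T → 0 < σ → σ ≤ σ₁ →
      0 ≤ K → (∀ r, 0 < r → blWeight ν P t' r ≤ K * blWeight ν P t r) →
      ∀ v : ℂ → ℂ, DifferentiableOn ℂ v (pencil σ) → modeL1 σ v < ∞ →
      modeBL ν β₀ P σ t (halfConv q (Real.sqrt (ν * τ)) v) ≤
        ENNReal.ofReal C * (ENNReal.ofReal (Real.sqrt (t / τ)) * modeL1 σ v +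
          ENNReal.ofReal K * modeBL ν β₀ P σ t' v) := by
  obtain ⟨C, hC, h⟩ := exists_enorm_halfConv_gam_le q h0 h1
  have hc := one_sub_sq_pos h0 h1
  set c := (1 - σ₁ ^ 2) / 8 with hcdef
  obtain ⟨D, hD, h'⟩ := exists_genv_le_blWeight (β₀ := β₀) (c := c / 4) (by positivity) hP T ν₀
  set E := Real.exp (β₀ ^ 2 * (ν₀ * T) / (2 * c)) with hE
  set I := Real.sqrt (Real.pi / (c / 2)) with hI
  have hI0 : 0 ≤ I := Real.sqrt_nonneg _
  refine ⟨C * (D + 2 ^ P * E * I), by positivity,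
    fun ν τ t t' σ K hν hν₀ hτ hτt htT hσ hσ₁ hK hW v hv hfin => iSup₂_le fun z hz => ?_⟩
  have hre := re_pos_of_mem_pencil hz
  have hs : 0 < Real.sqrt (ν * τ) := Real.sqrt_pos.2 (mul_pos hν hτ)
  set s := Real.sqrt (ν * τ) with hsdef
  obtain ⟨θ, hθ, hzθ⟩ := exists_eq_gam hz
  set r := z.re with hr
  set M := modeBL ν β₀ P σ t' v with hM
  set w := Real.exp (β₀ * r) * (blWeight ν P t r)⁻¹ with hw
  have hWr : 0 < blWeight ν P t r := one_pos.trans_le (one_le_blWeight _ _ _ _)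
  have hw0 : 0 ≤ w := by positivity
  have hpt : ∀ r' ∈ Ioi (0 : ℝ), ENNReal.ofReal (genv c s (r - r')) * ‖v (gam θ r')‖ₑ *
      ENNReal.ofReal w ≤ ENNReal.ofReal (D * Real.sqrt (t / τ)) * ‖v (gam θ r')‖ₑ +
        ENNReal.ofReal (2 ^ P * E * K) * M * ENNReal.ofReal (genv (c / 2) s (r - r')) := by
    intro r' hr'
    have hr' : 0 < r' := hr'
    rcases le_or_gt r' (r / 2) with hle | hgt
    · -- Here `r - r' ≥ r / 2`, and the Gaussian at distance `r / 2` is that of constant `c / 4` at `r`.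
      refine le_add_right ?_
      have e1 : genv c s (r - r') ≤ genv (c / 4) s r := by
        refine (genv_anti hc hs (by linarith : 0 ≤ r / 2) (by linarith)).trans (le_of_eq ?_)
        unfold genv; congr 2; ring
      have e2 : genv c s (r - r') * w ≤ D * Real.sqrt (t / τ) :=
        (mul_le_mul_of_nonneg_right e1 hw0).trans (h' ν τ t r hν hν₀ hτ hτt htT hre.le)
      calc _ = ENNReal.ofReal (genv c s (r - r') * w) * ‖v (gam θ r')‖ₑ := by
            rw [ENNReal.ofReal_mul (genv_nonneg _ hs _)]; ring
        _ ≤ _ := mul_le_mul_left (ENNReal.ofReal_le_ofReal e2) _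
    · -- Here `r < 2 r'`; the growth `e^{β₀ (r - r')}` is absorbed by half of the Gaussian.
      refine le_add_left ?_
      have e1 := enorm_le_modeBL (ν := ν) (β₀ := β₀) (P := P) (t := t') v (gam_mem_pencil hθ hr')
      rw [gam_re, ← hM] at e1
      have e2 : blWeight ν P t' r' ≤ 2 ^ P * (K * blWeight ν P t r) :=
        (blWeight_le_of_le_two_mul hP hre.le (by linarith)).trans
          (mul_le_mul_of_nonneg_left (hW r hre) (by positivity))
      have e3 : genv c s (r - r') * Real.exp (β₀ * (r - r')) ≤ E * genv (c / 2) s (r - r') := by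
        refine (genv_mul_exp_le hc hs _).trans (mul_le_mul_of_nonneg_right ?_ (genv_nonneg _ hs _))
        rw [hsdef, Real.sq_sqrt (by positivity)]
        have h3 : ν * τ ≤ ν₀ * T := by
          have : τ ≤ T := hτt.trans htT
          have : 0 < ν₀ := hν.trans_le hν₀
          gcongr
        exact Real.exp_le_exp.2 (by gcongr)
      have e4 : genv c s (r - r') * (Real.exp (-(β₀ * r')) * blWeight ν P t' r') * w ≤
          2 ^ P * E * K * genv (c / 2) s (r - r') := by
        have hg := genv_nonneg c hs (r - r')
        calc _ = genv c s (r - r') * Real.exp (β₀ * (r - r')) * blWeight ν P t' r' *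
              (blWeight ν P t r)⁻¹ := by
              have : Real.exp (β₀ * (r - r')) = Real.exp (-(β₀ * r')) * Real.exp (β₀ * r) := by
                rw [← Real.exp_add]; congr 1; ring
              rw [this, hw]; ring
          _ ≤ E * genv (c / 2) s (r - r') * (2 ^ P * (K * blWeight ν P t r)) *
              (blWeight ν P t r)⁻¹ := by
              refine mul_le_mul_of_nonneg_right ?_ (inv_nonneg.2 hWr.le)
              refine mul_le_mul e3 e2 ?_ (mul_nonneg (Real.exp_pos _).le (genv_nonneg _ hs _))
              exact zero_le_one.trans (one_le_blWeight _ _ _ _)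
          _ = _ := by field_simp
      have hWp : 0 ≤ blWeight ν P t' r' := zero_le_one.trans (one_le_blWeight _ _ _ _)
      calc _ ≤ ENNReal.ofReal (genv c s (r - r')) * (M *
            ENNReal.ofReal (Real.exp (-(β₀ * r')) * blWeight ν P t' r')) * ENNReal.ofReal w :=
            mul_le_mul_left (mul_le_mul_right e1 _) _
        _ = M * ENNReal.ofReal (genv c s (r - r') *
            (Real.exp (-(β₀ * r')) * blWeight ν P t' r') * w) := by
            rw [ENNReal.ofReal_mul (mul_nonneg (genv_nonneg _ hs _) (by positivity)),
              ENNReal.ofReal_mul (genv_nonneg _ hs _)]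
            ring
        _ ≤ M * ENNReal.ofReal (2 ^ P * E * K * genv (c / 2) s (r - r')) :=
            mul_le_mul_right (ENNReal.ofReal_le_ofReal e4) _
        _ = _ := by rw [ENNReal.ofReal_mul (by positivity)]; ring
  have hmeas : Measurable fun r' : ℝ => ENNReal.ofReal (genv (c / 2) s (r - r')) :=
    ((continuous_genv (c / 2) s).comp (by fun_prop)).measurable.ennreal_ofReal
  have hint : ∫⁻ r' : ℝ in Ioi 0, ENNReal.ofReal (genv (c / 2) s (r - r')) ≤ ENNReal.ofReal I := by
    refine (setLIntegral_le_lintegral _ _).trans (le_of_eq ?_)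
    rw [lintegral_sub_left_eq_self (fun x => ENNReal.ofReal (genv (c / 2) s x)) r,
      lintegral_genv (half_pos hc) hs]
  have hD' : ‖halfConv q s v z‖ₑ ≤ ENNReal.ofReal C * ∫⁻ r' in Ioi (0 : ℝ),
      ENNReal.ofReal (genv c s (r - r')) * ‖v (gam θ r')‖ₑ := by
    rw [hzθ]
    exact h s hs σ hσ₁ v hv hfin θ hθ r hre
  have hKM : ENNReal.ofReal (2 ^ P * E * K) = ENNReal.ofReal (2 ^ P * E) * ENNReal.ofReal K :=
    ENNReal.ofReal_mul (by positivity)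
  calc _ ≤ ENNReal.ofReal C * (∫⁻ r' in Ioi (0 : ℝ),
        ENNReal.ofReal (genv c s (r - r')) * ‖v (gam θ r')‖ₑ) * ENNReal.ofReal w :=
        mul_le_mul_left hD' _
    _ = ENNReal.ofReal C * ∫⁻ r' in Ioi (0 : ℝ),
        ENNReal.ofReal (genv c s (r - r')) * ‖v (gam θ r')‖ₑ * ENNReal.ofReal w := by
        rw [lintegral_mul_const' _ _ ENNReal.ofReal_ne_top, mul_assoc]
    _ ≤ ENNReal.ofReal C * (ENNReal.ofReal (D * Real.sqrt (t / τ)) * modeL1 σ v +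
        (∫⁻ r' in Ioi (0 : ℝ), ENNReal.ofReal (2 ^ P * E * K) * M *
          ENNReal.ofReal (genv (c / 2) s (r - r')))) := by
        refine mul_le_mul_right ((setLIntegral_mono' measurableSet_Ioi hpt).trans ?_) _
        rw [lintegral_add_right _ (hmeas.const_mul _),
          lintegral_const_mul' _ _ ENNReal.ofReal_ne_top]
        exact add_le_add (mul_le_mul_right (lintegral_gam_le_modeL1 hθ v) _) le_rfl
    _ ≤ ENNReal.ofReal C * (ENNReal.ofReal (D * Real.sqrt (t / τ)) * modeL1 σ v +
        ENNReal.ofReal (2 ^ P * E * K) * M * ENNReal.ofReal I) := by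
        refine mul_le_mul_right (add_le_add le_rfl ?_) _
        rw [lintegral_const_mul _ hmeas]
        exact mul_le_mul_right hint _
    _ = ENNReal.ofReal (C * D) * (ENNReal.ofReal (Real.sqrt (t / τ)) * modeL1 σ v) +
        ENNReal.ofReal (C * (2 ^ P * E * I)) * (ENNReal.ofReal K * M) := by
        rw [hKM, ENNReal.ofReal_mul hD.le, ENNReal.ofReal_mul hC.le, ENNReal.ofReal_mul hC.le,
          ENNReal.ofReal_mul (by positivity : (0 : ℝ) ≤ 2 ^ P * E)]
        ring
    _ ≤ ENNReal.ofReal (C * (D + 2 ^ P * E * I)) *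
          (ENNReal.ofReal (Real.sqrt (t / τ)) * modeL1 σ v) +
        ENNReal.ofReal (C * (D + 2 ^ P * E * I)) * (ENNReal.ofReal K * M) := by
        refine add_le_add (mul_le_mul_left (ENNReal.ofReal_le_ofReal ?_) _)
          (mul_le_mul_left (ENNReal.ofReal_le_ofReal ?_) _)
        · exact mul_le_mul_of_nonneg_left (le_add_of_nonneg_right (by positivity)) hC.le
        · exact mul_le_mul_of_nonneg_left (le_add_of_nonneg_left hD.le) hC.le
    _ = _ := (mul_add _ _ _).symm

/-- The weight at time zero is dominated by all later ones, as one layer is absent. -/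
theorem blWeight_zero_le (ν P t r : ℝ) : blWeight ν P 0 r ≤ 1 * blWeight ν P t r := by
  rw [one_mul]
  unfold blWeight
  rw [if_pos rfl]
  have : 0 ≤ (if t = 0 then 0 else layer P (Real.sqrt (ν * t)) r) := by
    split_ifs
    exacts [le_rfl, layer_nonneg (Real.sqrt_nonneg _)]
  linarith

theorem blWeight_le_sqrt_mul {ν P s t r : ℝ} (hν : 0 < ν) (hP : 0 ≤ P) (hs : 0 < s) (hst : s ≤ t)
    (hr : 0 ≤ r) : blWeight ν P s r ≤ Real.sqrt (t / s) * blWeight ν P t r := by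
  have ht : 0 < t := hs.trans_le hst
  have h1 := layer_le_mul_layer (r := r) hP (Real.sqrt_pos.2 (mul_pos hν hs))
    (Real.sqrt_le_sqrt (mul_le_mul_of_nonneg_left hst hν.le)) hr
  have e1 : Real.sqrt (ν * t) / Real.sqrt (ν * s) = Real.sqrt (t / s) := by
    rw [← Real.sqrt_div (by positivity)]; congr 1; field_simp
  rw [e1] at h1
  have h2 : 1 ≤ Real.sqrt (t / s) := Real.one_le_sqrt.2 ((one_le_div hs).2 hst)
  have h3 : 0 ≤ layer P (Real.sqrt ν) r := layer_nonneg (Real.sqrt_nonneg _)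
  unfold blWeight
  rw [if_neg hs.ne', if_neg ht.ne']
  nlinarith

theorem lintegral_profile_lt_top {P : ℝ} (hP : 1 < P) :
    ∫⁻ y in Ioi (0 : ℝ), ENNReal.ofReal (profile P y) < ∞ := by
  have hP0 : 0 ≤ P := by linarith
  have h1 : Integrable fun y : ℝ => 2 ^ P * (1 + ‖y‖) ^ (-P) :=
    (integrable_one_add_norm (by simpa using hP)).const_mul _
  refine lt_of_le_of_lt ((setLIntegral_le_lintegral _ _).trans (lintegral_mono fun y => ?_))
    h1.lintegral_lt_top
  refine ENNReal.ofReal_le_ofReal ?_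
  unfold profile
  rw [Real.rpow_neg (by positivity), ← div_eq_mul_inv, div_le_div_iff₀ (by positivity)
    (by positivity), one_mul, Real.norm_eq_abs]
  have h3 : (1 : ℝ) ≤ 2 ^ P := Real.one_le_rpow (by norm_num) hP0
  have h4 : (1 + |y|) ^ P ≤ 2 ^ P * max 1 (|y|) ^ P := by
    rw [← Real.mul_rpow (by norm_num) (by positivity)]
    refine Real.rpow_le_rpow (by positivity) ?_ hP0
    linarith [le_max_left 1 |y|, le_max_right 1 |y|]
  refine h4.trans (mul_le_mul_of_nonneg_left ?_ (by positivity))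
  rcases le_total 1 |y| with h | h
  · rw [max_eq_right h]; linarith
  · rw [max_eq_left h, Real.one_rpow]
    have : 0 ≤ |y| ^ P := by positivity
    linarith

/-- The boundary layer norm at time zero controls the `L¹` norm, uniformly in the viscosity. -/
theorem exists_modeL1_le_modeBL {P β₀ : ℝ} (hP : 1 < P) (hβ : 0 < β₀) :
    ∃ C : ℝ, 0 < C ∧ ∀ ν σ, 0 < ν → σ ≤ 1 → ∀ v : ℂ → ℂ, ContinuousOn v (pencil σ) →
      modeL1 σ v ≤ ENNReal.ofReal C * modeBL ν β₀ P σ 0 v := by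
  set I := ∫⁻ y in Ioi (0 : ℝ), ENNReal.ofReal (profile P y) with hI
  have hIlt : I < ∞ := lintegral_profile_lt_top hP
  have hexp : ∫⁻ r in Ioi (0 : ℝ), ENNReal.ofReal (Real.exp (-(β₀ * r))) < ∞ := by
    have h := exp_neg_integrableOn_Ioi 0 hβ
    simp only [neg_mul] at h
    exact h.lintegral_lt_top
  set J := ∫⁻ r in Ioi (0 : ℝ), ENNReal.ofReal (Real.exp (-(β₀ * r))) with hJ
  refine ⟨4 * (J.toReal + I.toReal) + 1, by positivity, fun ν σ hν hσ v hv => ?_⟩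
  have hsq : 0 < Real.sqrt ν := Real.sqrt_pos.2 hν
  have hlayer : ∫⁻ r in Ioi (0 : ℝ), ENNReal.ofReal (layer P (Real.sqrt ν) r) = I := by
    have hm : Measurable ((Ioi (0 : ℝ)).indicator fun y => ENNReal.ofReal (profile P y)) := by
      refine Measurable.indicator ?_ measurableSet_Ioi
      unfold profile
      fun_prop
    rw [hI, ← lintegral_indicator measurableSet_Ioi,
      ← lintegral_indicator measurableSet_Ioi (fun y => ENNReal.ofReal (profile P y)),
      lintegral_eq_mul_lintegral_comp_mul hm (inv_pos.2 hsq).ne', abs_of_pos (inv_pos.2 hsq),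
      ← lintegral_const_mul' _ _ ENNReal.ofReal_ne_top]
    refine lintegral_congr fun r => ?_
    by_cases hr : 0 < r
    · rw [indicator_of_mem (show r ∈ Ioi (0 : ℝ) from hr),
        indicator_of_mem (show (Real.sqrt ν)⁻¹ * r ∈ Ioi (0 : ℝ) from by
          simpa using mul_pos (inv_pos.2 hsq) hr), ← ENNReal.ofReal_mul (inv_pos.2 hsq).le]
      rfl
    · rw [indicator_of_notMem (show r ∉ Ioi (0 : ℝ) from hr), indicator_of_notMem, mul_zero]
      intro h
      exact hr (pos_of_mul_pos_right (show 0 < (Real.sqrt ν)⁻¹ * r from h) (inv_pos.2 hsq).le)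
  have hpt : ∀ r ∈ Ioi (0 : ℝ), ENNReal.ofReal (Real.exp (-(β₀ * r)) * blWeight ν P 0 r) ≤
      ENNReal.ofReal (Real.exp (-(β₀ * r))) + ENNReal.ofReal (layer P (Real.sqrt ν) r) := by
    intro r hr
    have hr : 0 < r := hr
    have hl : 0 ≤ layer P (Real.sqrt ν) r := layer_nonneg hsq.le
    rw [← ENNReal.ofReal_add (Real.exp_pos _).le hl]
    refine ENNReal.ofReal_le_ofReal ?_
    have he : Real.exp (-(β₀ * r)) ≤ 1 := Real.exp_le_one_iff.2 (by nlinarith)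
    unfold blWeight
    rw [if_pos rfl]
    nlinarith [Real.exp_pos (-(β₀ * r))]
  refine (modeL1_le_of_lintegral_gam_le hσ hv (B := (J + I) * modeBL ν β₀ P σ 0 v)
    fun θ hθ => ?_).trans ?_
  · calc _ ≤ ∫⁻ r in Ioi (0 : ℝ), (ENNReal.ofReal (Real.exp (-(β₀ * r))) +
          ENNReal.ofReal (layer P (Real.sqrt ν) r)) * modeBL ν β₀ P σ 0 v := by
          refine setLIntegral_mono' measurableSet_Ioi fun r hr => ?_
          have h1 := enorm_le_modeBL (ν := ν) (β₀ := β₀) (P := P) (t := 0) v (gam_mem_pencil hθ hr)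
          rw [gam_re, mul_comm] at h1
          exact h1.trans (mul_le_mul_left (hpt r hr) _)
      _ = _ := by
          have hm1 : Measurable fun r : ℝ => ENNReal.ofReal (Real.exp (-(β₀ * r))) := by fun_prop
          have hm2 : Measurable fun r : ℝ => ENNReal.ofReal (layer P (Real.sqrt ν) r) := by
            unfold layer profile
            fun_prop
          have hm : Measurable fun r : ℝ => ENNReal.ofReal (Real.exp (-(β₀ * r))) +
              ENNReal.ofReal (layer P (Real.sqrt ν) r) := hm1.add hm2
          rw [lintegral_mul_const _ hm, lintegral_add_left hm1, hlayer]
  · rw [← mul_assoc]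
    refine mul_le_mul_left ?_ _
    have e : (4 : ℝ≥0∞) * (J + I) = ENNReal.ofReal (4 * (J.toReal + I.toReal)) := by
      rw [ENNReal.ofReal_mul (by norm_num), ENNReal.ofReal_add ENNReal.toReal_nonneg
        ENNReal.toReal_nonneg, ENNReal.ofReal_toReal hexp.ne, ENNReal.ofReal_toReal hIlt.ne,
        ENNReal.ofReal_ofNat]
    rw [e]
    exact ENNReal.ofReal_le_ofReal (by linarith)

/-! ### From single modes to fields -/

/-- The norm of order `k` of a field built from a size functional `N` of its Fourier modes, with
exponential weight `ρ`. It is `normW` for `N = modeL1` and `normBLk` for `N = modeBL`. -/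
noncomputable def fieldNorm (N : (ℂ → ℂ) → ℝ≥0∞) (ρ : ℝ) (k : ℕ) (f : Torus → ℂ → ℂ) : ℝ≥0∞ :=
  ∑ j ∈ Finset.range (k + 1), ∑ l ∈ Finset.range (k + 1 - j),
    ∑' α : ℤ, ENNReal.ofReal (Real.exp (ρ * |(α : ℝ)|)) * N (mode (dx^[j] (psiDz^[l] f)) α)

theorem SolidNorm.const_mul {σ : ℝ} {N : (ℂ → ℂ) → ℝ≥0∞} (hN : SolidNorm σ N) (c : ℂ)
    (g : ℂ → ℂ) : N (fun z => c * g z) = ‖c‖ₑ * N g := by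
  refine le_antisymm (hN.mono _ enorm_ne_top _ _ fun z _ => (enorm_mul _ _).le) ?_
  rcases eq_or_ne c 0 with rfl | hc
  · simp
  have h := hN.mono ‖c⁻¹‖ₑ enorm_ne_top g (fun z => c * g z) fun z _ => by
    rw [← enorm_mul, inv_mul_cancel_left₀ hc]
  calc ‖c‖ₑ * N g ≤ ‖c‖ₑ * (‖c⁻¹‖ₑ * N fun z => c * g z) := mul_le_mul_right h _
    _ = _ := by rw [← mul_assoc, ← enorm_mul, mul_inv_cancel₀ hc, enorm_one, one_mul]

theorem SolidNorm.mul_add_mul {σ : ℝ} {N₁ N₂ : (ℂ → ℂ) → ℝ≥0∞} (h₁ : SolidNorm σ N₁)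
    (h₂ : SolidNorm σ N₂) (A K : ℝ≥0∞) : SolidNorm σ fun v => A * N₁ v + K * N₂ v where
  mono c hc g h H := by
    calc _ ≤ A * (c * N₁ h) + K * (c * N₂ h) :=
          add_le_add (mul_le_mul_right (h₁.mono c hc g h H) _)
            (mul_le_mul_right (h₂.mono c hc g h H) _)
      _ = _ := by ring
  add_le g h hg hh := by
    calc _ ≤ A * (N₁ g + N₁ h) + K * (N₂ g + N₂ h) :=
          add_le_add (mul_le_mul_right (h₁.add_le g h hg hh) _)
            (mul_le_mul_right (h₂.add_le g h hg hh) _)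
      _ = _ := by ring

theorem fieldNorm_mul_add_mul (N₁ N₂ : (ℂ → ℂ) → ℝ≥0∞) (A K : ℝ≥0∞) (ρ : ℝ) (k : ℕ)
    (f : Torus → ℂ → ℂ) : fieldNorm (fun v => A * N₁ v + K * N₂ v) ρ k f =
      A * fieldNorm N₁ ρ k f + K * fieldNorm N₂ ρ k f := by
  simp only [fieldNorm, mul_add, ENNReal.tsum_add, Finset.sum_add_distrib, Finset.mul_sum,
    ← ENNReal.tsum_mul_left, mul_left_comm]

theorem tsum_le_fieldNorm (N : (ℂ → ℂ) → ℝ≥0∞) (ρ : ℝ) (k : ℕ) (f : Torus → ℂ → ℂ) :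
    ∑' α : ℤ, ENNReal.ofReal (Real.exp (ρ * |(α : ℝ)|)) * N (mode f α) ≤ fieldNorm N ρ k f := by
  let F : ℕ → ℕ → ℝ≥0∞ := fun j l =>
    ∑' α : ℤ, ENNReal.ofReal (Real.exp (ρ * |(α : ℝ)|)) * N (mode (dx^[j] (psiDz^[l] f)) α)
  calc _ = F 0 0 := rfl
    _ ≤ ∑ l ∈ Finset.range (k + 1 - 0), F 0 l :=
        Finset.single_le_sum (f := fun l => F 0 l) (fun _ _ => bot_le) (by simp)
    _ ≤ _ := Finset.single_le_sum (f := fun j => ∑ l ∈ Finset.range (k + 1 - j), F j l)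
        (fun _ _ => bot_le) (by simp)

/-- For nice fields, `∂ₓ` acts by multiplication on the modes, and only conormal derivatives of the
modes remain. -/
theorem NiceField.fieldNorm_eq {σ : ℝ} {N : (ℂ → ℂ) → ℝ≥0∞} (hN : SolidNorm σ N)
    {f : Torus → ℂ → ℂ} (hf : NiceField σ f) (ρ : ℝ) (k : ℕ) :
    fieldNorm N ρ k f = ∑ j ∈ Finset.range (k + 1), ∑' α : ℤ,
      ENNReal.ofReal (Real.exp (ρ * |(α : ℝ)|)) *
        (‖(Complex.I * α) ^ j‖ₑ * conSum N (k - j) (mode f α)) := by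
  refine Finset.sum_congr rfl fun j hj => ?_
  have hj : j ≤ k := Nat.lt_succ_iff.1 (Finset.mem_range.1 hj)
  rw [← Summable.tsum_finsetSum fun _ _ => ENNReal.summable]
  refine tsum_congr fun α => ?_
  rw [conSum, Finset.mul_sum, Finset.mul_sum, Nat.sub_add_comm hj]
  refine Finset.sum_congr rfl fun l _ => ?_
  rw [hN.congr (hf.mode_dx_psiDz j l α), hN.const_mul]

theorem NiceField.fieldNorm_le {σ : ℝ} {U V : (ℂ → ℂ) → ℝ≥0∞} (hU : SolidNorm σ U)
    (hV : SolidNorm σ V) {f g : Torus → ℂ → ℂ} (hf : NiceField σ f) (hg : NiceField σ g)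
    {C : ℝ} {k : ℕ} (h : ∀ l ≤ k, ∀ α, conSum V l (mode g α) ≤
      ENNReal.ofReal C * conSum U l (mode f α)) (ρ : ℝ) :
    fieldNorm V ρ k g ≤ ENNReal.ofReal C * fieldNorm U ρ k f := by
  rw [hg.fieldNorm_eq hV, hf.fieldNorm_eq hU, Finset.mul_sum]
  refine Finset.sum_le_sum fun j _ => ?_
  rw [← ENNReal.tsum_mul_left]
  refine ENNReal.tsum_le_tsum fun α => ?_
  refine (mul_le_mul_right (mul_le_mul_right (h _ (Nat.sub_le _ _) α) _) _).trans_eq ?_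
  ring

theorem mode_stokesSemigroup {ν σ t : ℝ} (hν : 0 < ν) (hσ : 0 < σ) (ht : 0 < t)
    {f : Torus → ℂ → ℂ} (hf : HasDecayingData f) (α : ℤ) :
    EqOn (mode (stokesSemigroup ν σ t f) α) (modeSol ν |(α : ℝ)| (datum f α) t) (pencil σ) := by
  intro z hz
  rw [← hf.mode_stokesField hν ht]
  unfold mode
  congr 1
  funext x
  exact stokesSemigroup_eqOn hν hσ hf ht.le x hz

theorem niceField_stokesSemigroup {ν σ t : ℝ} (hν : 0 < ν) (hσ : 0 < σ) (ht : 0 < t)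
    {f : Torus → ℂ → ℂ} (hf : HasDecayingData f) : NiceField σ (stokesSemigroup ν σ t f) where
  analytic :=
    (hf.isStokesSolution hν hσ).isStokesSolution_stokesSemigroup.isAnalyticField ht
  decay K hK hKs := by
    obtain ⟨B, ρ, hρ, h⟩ := (hf.niceField_stokesField hν ht).decay K hK hKs
    refine ⟨B, ρ, hρ, fun α z hz => ?_⟩
    rw [mode_stokesSemigroup hν hσ ht hf α (hKs hz), ← hf.mode_stokesField hν ht]
    exact h α z hz

/-- Bounds for the two kinds of Gaussian convolutions give bounds for the Stokes semigroup on
fields. The index set carries the parameters, over which the constant is uniform. -/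
theorem exists_fieldNorm_stokesSemigroup_le {ι : Type*} {σ ν t : ι → ℝ}
    {U V : ι → (ℂ → ℂ) → ℝ≥0∞} {A : ι → ℝ≥0∞} (hσ : ∀ i, 0 < σ i)
    (hν : ∀ i, 0 < ν i) (ht : ∀ i, 0 < t i)
    (hU : ∀ i, SolidNorm (σ i) (U i)) (hV : ∀ i, SolidNorm (σ i) (V i))
    (hA₁ : ∀ i, 1 ≤ A i) (hA : ∀ i v, A i * modeL1 (σ i) v ≤ U i v)
    (baseD : ∀ q : ℂ[X], ∃ C : ℝ, 0 < C ∧ ∀ i v, DifferentiableOn ℂ v (pencil (σ i)) → U i v < ∞ →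
      V i (halfConv q (Real.sqrt (ν i * t i)) v) ≤ ENNReal.ofReal C * U i v)
    (baseR : ∀ (j : ℕ) (q : ℂ[X]), ∃ C : ℝ, 0 < C ∧ ∀ i F, IntegrableOn F (Iic 0) →
      V i (reflConv j q (Real.sqrt (ν i * t i)) F) ≤
        ENNReal.ofReal C * (A i * ∫⁻ x in Iic (0 : ℝ), ‖F x‖ₑ)) (k : ℕ) :
    ∃ C : ℝ, 0 < C ∧ ∀ i ρ, 0 < ρ → ∀ f, IsAnalyticField (σ i) f →
      fieldNorm (V i) ρ k (stokesSemigroup (ν i) (σ i) (t i) f) ≤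
        ENNReal.ofReal C * fieldNorm (U i) ρ k f := by
  have hL : ∀ i v, modeL1 (σ i) v ≤ U i v := fun i v =>
    le_trans (by simpa using mul_le_mul_left (hA₁ i) (modeL1 (σ i) v)) (hA i v)
  choose C hC h using exists_conSum_modeSol_le hσ hν ht hU hV
    (fun i v _ hv => (hL i v).trans_lt hv) hA baseD baseR
  have hle : ∀ l ≤ k, C l ≤ ∑ l ∈ Finset.range (k + 1), C l := fun l hl =>
    Finset.single_le_sum (fun l _ => (hC l).le) (Finset.mem_range.2 (Nat.lt_succ_of_le hl))
  have hpos : 0 < ∑ l ∈ Finset.range (k + 1), C l := (hC 0).trans_le (hle 0 (Nat.zero_le k))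
  refine ⟨_, hpos, fun i ρ hρ f hf => ?_⟩
  rcases eq_or_ne (fieldNorm (U i) ρ k f) ∞ with htop | hfin
  · rw [htop, ENNReal.mul_top (ENNReal.ofReal_pos.2 hpos).ne']
    exact le_top
  have hL1 : normL1 ρ (σ i) f < ∞ := by
    refine lt_of_le_of_lt ?_ hfin.lt_top
    exact (ENNReal.tsum_le_tsum fun α => mul_le_mul_right (hL i (mode f α)) _).trans
      (tsum_le_fieldNorm (U i) ρ k f)
  have hd := hasDecayingData_of_normL1_lt_top hρ (hσ i) hf hL1
  refine (niceField_of_normL1_lt_top hρ (hσ i) hf hL1).fieldNorm_le (hU i) (hV i)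
    (niceField_stokesSemigroup (hν i) (hσ i) (ht i) hd) (fun l hl α => ?_) ρ
  refine le_trans ?_ (mul_le_mul_left (ENNReal.ofReal_le_ofReal (hle l hl)) _)
  rcases eq_or_ne (conSum (U i) l (mode f α)) ∞ with htop | hlt
  · rw [htop, ENNReal.mul_top (ENNReal.ofReal_pos.2 (hC l)).ne']
    exact le_top
  rw [(hV i).conSum_congr (mode_stokesSemigroup (hν i) (hσ i) (ht i) hd α) l]
  exact h l i _ (abs_nonneg _) _ _ (fun y hy => datum_of_pos hy) (hf.differentiableOn_mode α)
    hlt.lt_top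

/-! ### Uniform bounds for the Stokes semigroup -/

theorem exists_normW_stokesSemigroup_le {σ₁ : ℝ} (h0 : 0 ≤ σ₁) (h1 : σ₁ < 1) (k : ℕ) :
    ∃ C : ℝ, 0 < C ∧ ∀ ν ρ σ t, 0 < ν → 0 < ρ → 0 < σ → σ ≤ σ₁ → 0 < t →
      ∀ f, IsAnalyticField σ f →
        normW ρ σ k (stokesSemigroup ν σ t f) ≤ ENNReal.ofReal C * normW ρ σ k f := by
  -- The parameters are `(ν, σ, t)`.
  let ι := {p : ℝ × ℝ × ℝ // 0 < p.1 ∧ 0 < p.2.1 ∧ p.2.1 ≤ σ₁ ∧ 0 < p.2.2}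
  have hs : ∀ i : ι, 0 < Real.sqrt (i.1.1 * i.1.2.2) :=
    fun i => Real.sqrt_pos.2 (mul_pos i.2.1 i.2.2.2.2)
  obtain ⟨C, hC, h⟩ := exists_fieldNorm_stokesSemigroup_le (ι := ι) (ν := fun i => i.1.1)
    (σ := fun i => i.1.2.1) (t := fun i => i.1.2.2) (U := fun i => modeL1 i.1.2.1)
    (V := fun i => modeL1 i.1.2.1) (A := fun _ => 1) (fun i => i.2.2.1) (fun i => i.2.1)
    (fun i => i.2.2.2.2) (fun i => solidNorm_modeL1 _) (fun i => solidNorm_modeL1 _)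
    (fun _ => le_rfl) (fun i v => (one_mul _).le)
    (fun q => by
      obtain ⟨C, hC, h⟩ := exists_modeL1_halfConv_le q h0 h1
      exact ⟨C, hC, fun i v hv hlt => h _ (hs i) _ i.2.2.1 i.2.2.2.1 v hv hlt⟩)
    (fun j q => by
      obtain ⟨C, hC, h⟩ := exists_modeL1_reflConv_le j q h0 h1
      refine ⟨C, hC, fun i F hF => ?_⟩
      rw [one_mul]
      exact h _ (hs i) _ i.2.2.2.1 F hF) k
  exact ⟨C, hC, fun ν ρ σ t hν hρ hσ hσ₁ ht f hf => h ⟨(ν, σ, t), hν, hσ, hσ₁, ht⟩ ρ hρ f hf⟩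

/-- The bound in the boundary layer norms over a time interval `[s, t]`, for any `K` by which the
weight at time `s` is dominated by the weight at time `t`. -/
theorem exists_normBLk_stokesSemigroup_le {σ₁ P : ℝ} (h0 : 0 ≤ σ₁) (h1 : σ₁ < 1) (hP : 0 ≤ P)
    (β₀ T ν₀ : ℝ) (k : ℕ) :
    ∃ C : ℝ, 0 < C ∧ ∀ ν ρ σ s t K, 0 < ν → ν ≤ ν₀ → 0 < ρ → 0 < σ → σ ≤ σ₁ →
      0 ≤ s → s < t → t ≤ T → 0 ≤ K →
      (∀ r, 0 < r → blWeight ν P s r ≤ K * blWeight ν P t r) → ∀ f, IsAnalyticField σ f →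
        normBLk ν β₀ P ρ σ t k (stokesSemigroup ν σ (t - s) f) ≤
          ENNReal.ofReal C * (ENNReal.ofReal (Real.sqrt (t / (t - s))) * normW ρ σ k f +
            ENNReal.ofReal K * normBLk ν β₀ P ρ σ s k f) := by
  -- The parameters are `((ν, σ), s, t, K)`.
  let ι := {p : (ℝ × ℝ) × ℝ × ℝ × ℝ // (0 < p.1.1 ∧ p.1.1 ≤ ν₀) ∧ (0 < p.1.2 ∧ p.1.2 ≤ σ₁) ∧
    (0 ≤ p.2.1 ∧ p.2.1 < p.2.2.1 ∧ p.2.2.1 ≤ T) ∧ 0 ≤ p.2.2.2 ∧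
    ∀ r, 0 < r → blWeight p.1.1 P p.2.1 r ≤ p.2.2.2 * blWeight p.1.1 P p.2.2.1 r}
  let A : ι → ℝ≥0∞ := fun i => ENNReal.ofReal (Real.sqrt (i.1.2.2.1 / (i.1.2.2.1 - i.1.2.1)))
  obtain ⟨C, hC, h⟩ := exists_fieldNorm_stokesSemigroup_le (ι := ι) (ν := fun i => i.1.1.1)
    (σ := fun i => i.1.1.2) (t := fun i => i.1.2.2.1 - i.1.2.1)
    (U := fun i v => A i * modeL1 i.1.1.2 v +
      ENNReal.ofReal i.1.2.2.2 * modeBL i.1.1.1 β₀ P i.1.1.2 i.1.2.1 v)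
    (V := fun i => modeBL i.1.1.1 β₀ P i.1.1.2 i.1.2.2.1) (A := A)
    (fun i => i.2.2.1.1) (fun i => i.2.1.1) (fun i => sub_pos.2 i.2.2.2.1.2.1)
    (fun i => (solidNorm_modeL1 _).mul_add_mul (solidNorm_modeBL _ _ _ _ _) _ _)
    (fun i => solidNorm_modeBL _ _ _ _ _)
    (fun i => by
      have hs := i.2.2.2.1.1
      have hst := i.2.2.2.1.2.1
      refine ENNReal.one_le_ofReal.2 (Real.one_le_sqrt.2 ((one_le_div (by linarith)).2 ?_))
      linarith)
    (fun i v => le_self_add)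
    (fun q => by
      obtain ⟨C, hC, h⟩ := exists_modeBL_halfConv_le (β₀ := β₀) q h0 h1 hP T ν₀
      refine ⟨C, hC, fun i v hv hlt => ?_⟩
      have hs := i.2.2.2.1.1
      have hst := i.2.2.2.1.2.1
      have hlt1 : modeL1 i.1.1.2 v < ∞ := by
        have hA : A i ≠ 0 := by
          refine (ENNReal.ofReal_pos.2 (Real.sqrt_pos.2 (div_pos ?_ ?_))).ne' <;> linarith
        exact ENNReal.lt_top_of_mul_ne_top_right (le_self_add.trans_lt hlt).ne hA
      exact h _ _ _ _ _ _ i.2.1.1 i.2.1.2 (sub_pos.2 hst) (sub_le_self _ hs) i.2.2.2.1.2.2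
        i.2.2.1.1 i.2.2.1.2 i.2.2.2.2.1 i.2.2.2.2.2 v hv hlt1)
    (fun j q => by
      obtain ⟨C, hC, h⟩ := exists_modeBL_reflConv_le j q h0 h1 hP β₀ T ν₀
      exact ⟨C, hC, fun i F _ => h _ _ _ _ i.2.1.1 i.2.1.2 (sub_pos.2 i.2.2.2.1.2.1)
        (sub_le_self _ i.2.2.2.1.1) i.2.2.2.1.2.2 i.2.2.1.2 F⟩) k
  refine ⟨C, hC, fun ν ρ σ s t K hν hν₀ hρ hσ hσ₁ hs hst htT hK hw f hf => ?_⟩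
  have := h ⟨((ν, σ), s, t, K), ⟨hν, hν₀⟩, ⟨hσ, hσ₁⟩, ⟨hs, hst, htT⟩, hK, hw⟩ ρ hρ f hf
  rwa [fieldNorm_mul_add_mul] at this

theorem exists_normW_le_normBLk {P β₀ : ℝ} (hP : 1 < P) (hβ : 0 < β₀) (k : ℕ) :
    ∃ C : ℝ, 0 < C ∧ ∀ ν ρ σ, 0 < ν → 0 < ρ → 0 < σ → σ ≤ 1 → ∀ f, IsAnalyticField σ f →
      normW ρ σ k f ≤ ENNReal.ofReal C * normBLk ν β₀ P ρ σ 0 k f := by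
  obtain ⟨C, hC, h⟩ := exists_modeL1_le_modeBL hP hβ
  refine ⟨C, hC, fun ν ρ σ hν hρ hσ hσ₁ f hf => ?_⟩
  rcases eq_or_ne (normBLk ν β₀ P ρ σ 0 k f) ∞ with htop | hfin
  · rw [htop, ENNReal.mul_top (ENNReal.ofReal_pos.2 hC).ne']
    exact le_top
  have hL1 : normL1 ρ σ f < ∞ := by
    refine lt_of_le_of_lt ?_ (ENNReal.mul_lt_top (ENNReal.ofReal_lt_top (r := C)) hfin.lt_top)
    refine le_trans ?_ (mul_le_mul_right
      (tsum_le_fieldNorm (modeBL ν β₀ P σ 0) ρ k f) (ENNReal.ofReal C))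
    rw [← ENNReal.tsum_mul_left]
    refine ENNReal.tsum_le_tsum fun α => ?_
    rw [mul_left_comm]
    exact mul_le_mul_right (h ν σ hν hσ₁ _ (hf.differentiableOn_mode α).continuousOn) _
  have hn := niceField_of_normL1_lt_top hρ hσ hf hL1
  refine hn.fieldNorm_le (solidNorm_modeBL ν β₀ P σ 0) (solidNorm_modeL1 σ) hn
    (fun l _ α => ?_) ρ
  rw [conSum, conSum, Finset.mul_sum]
  exact Finset.sum_le_sum fun i _ =>
    h ν σ hν hσ₁ _ (differentiableOn_pd_iter (hf.differentiableOn_mode α) i).continuousOn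

theorem proposition5p1 :
    -- the linear Stokes problem is well posed, so that `e^{νtB}` is its solution operator,
    -- and `∂_x` commutes with `e^{νtB}`
    (∀ ν ρ σ : ℝ, 0 < ν → 0 < ρ → 0 < σ →
      ∀ f : Torus → ℂ → ℂ, IsAnalyticField σ f → normL1 ρ σ f < ∞ →
        IsStokesSolution ν σ f (fun t => stokesSemigroup ν σ t f) ∧
        (∀ ω : ℝ → Torus → ℂ → ℂ, IsStokesSolution ν σ f ω →
          ∀ t, 0 ≤ t → ∀ x, ∀ z ∈ pencil σ, ω t x z = stokesSemigroup ν σ t f x z) ∧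
        (∀ t, 0 ≤ t → ∀ x, ∀ z ∈ pencil σ,
          HasDerivAt (fun h : ℝ => stokesSemigroup ν σ t f (x + (h : Torus)) z)
            (stokesSemigroup ν σ t (dx f) x z) 0)) ∧
    -- the bounds, with one constant for all `0 < ν ≤ ν₀`, `0 < σ ≤ σ₁`, `ρ > 0` and `f`
    (∀ β₀ P : ℝ, 0 < β₀ → 1 < P →
      ∀ k : ℕ, ∀ T ν₀ σ₁ : ℝ, 0 < T → 0 < ν₀ → 0 < σ₁ → σ₁ < 1 →
        ∃ C : ℝ, 0 < C ∧
          ∀ ν ρ σ : ℝ, 0 < ν → ν ≤ ν₀ → 0 < ρ → 0 < σ → σ ≤ σ₁ →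
            ∀ f : Torus → ℂ → ℂ, IsAnalyticField σ f →
              (∀ t, 0 < t → t ≤ T →
                normBLk ν β₀ P ρ σ t k (stokesSemigroup ν σ t f) ≤
                  ENNReal.ofReal C * normBLk ν β₀ P ρ σ 0 k f) ∧
              (∀ s t, 0 < s → s < t → t ≤ T →
                normBLk ν β₀ P ρ σ t k (stokesSemigroup ν σ (t - s) f) ≤
                  ENNReal.ofReal C *
                    (ENNReal.ofReal (Real.sqrt (t / (t - s))) * normW ρ σ k f +
                      ENNReal.ofReal (Real.sqrt (t / s)) * normBLk ν β₀ P ρ σ s k f)) ∧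
              (∀ t, 0 < t → t ≤ T →
                normW ρ σ k (stokesSemigroup ν σ t f) ≤
                  ENNReal.ofReal C * normW ρ σ k f)) := by
  refine ⟨fun ν ρ σ hν hρ hσ f hf h => stokes_wellPosed hν hρ hσ hf h, ?_⟩
  intro β₀ P hβ hP k T ν₀ σ₁ hT hν₀ h0 h1
  have hP0 : 0 ≤ P := by linarith
  obtain ⟨C₁, hC₁, hW⟩ := exists_normW_stokesSemigroup_le h0.le h1 k
  obtain ⟨C₂, hC₂, hBL⟩ := exists_normBLk_stokesSemigroup_le h0.le h1 hP0 β₀ T ν₀ k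
  obtain ⟨C₃, hC₃, hE⟩ := exists_normW_le_normBLk hP hβ k
  refine ⟨C₁ + C₂ * (C₃ + 1), by positivity, fun ν ρ σ hν hνν₀ hρ hσ hσ₁ f hf =>
    ⟨fun t ht htT => ?_, fun s t hs hst htT => ?_, fun t ht _ => ?_⟩⟩
  · have h := hBL ν ρ σ 0 t 1 hν hνν₀ hρ hσ hσ₁ le_rfl ht htT zero_le_one
      (fun r _ => blWeight_zero_le ν P t r) f hf
    rw [sub_zero, div_self ht.ne', Real.sqrt_one, ENNReal.ofReal_one, one_mul, one_mul] at h
    calc _ ≤ ENNReal.ofReal C₂ * (ENNReal.ofReal C₃ * normBLk ν β₀ P ρ σ 0 k f +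
          normBLk ν β₀ P ρ σ 0 k f) :=
          h.trans (mul_le_mul_right
            (add_le_add (hE ν ρ σ hν hρ hσ (hσ₁.trans h1.le) f hf) le_rfl) _)
      _ = ENNReal.ofReal (C₂ * (C₃ + 1)) * normBLk ν β₀ P ρ σ 0 k f := by
          rw [ENNReal.ofReal_mul hC₂.le, ENNReal.ofReal_add hC₃.le zero_le_one,
            ENNReal.ofReal_one]
          ring
      _ ≤ _ := mul_le_mul_left (ENNReal.ofReal_le_ofReal (by linarith)) _
  · refine (hBL ν ρ σ s t _ hν hνν₀ hρ hσ hσ₁ hs.le hst htT (Real.sqrt_nonneg (t / s))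
      (fun r hr => blWeight_le_sqrt_mul hν hP0 hs hst.le hr.le) f hf).trans
      (mul_le_mul_left (ENNReal.ofReal_le_ofReal ?_) _)
    nlinarith [mul_pos hC₂ hC₃]
  · refine (hW ν ρ σ t hν hρ hσ hσ₁ ht f hf).trans
      (mul_le_mul_left (ENNReal.ofReal_le_ofReal ?_) _)
    exact le_add_of_nonneg_right (by positivity)
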